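/- Let $d\ge 1$, $\mathbb T=\mathbb R/2\pi\mathbb Z$, and let $\alpha>\frac4d$, with $\alpha<\frac{4}{d-1}$ in addition if $d\ge 2$. Consider the focusing nonlinear Schrödinger equation $$i\partial_t u+\Delta_{x,y}u=-|u|^\alpha u\qquad\text{on }\mathbb R^d_x\times\mathbb T_y. \tag{NLS}$$ For $u\in H^1(\mathbb R^d\times\mathbb T)$ put $$M(u)=\|u\|_2^2,\qquad E(u)=\tfrac12\|\nabla_{x,y}u\|_2^2-\tfrac1{\alpha+2}\|u\|_{\alpha+2}^{\alpha+2},\qquad Q(u)=\|\nabla_x u\|_2^2-\tfrac{\alpha d}{2(\alpha+2)}\|u\|_{\alpha+2}^{\alpha+2},$$ $$m_c=\inf\{E(v): v\in H^1(\mathbb R^d\times\mathbb T),\ M(v)=c,\ Q(v)=0\}.$$ A solution of (NLS) on an open interval $I\ni 0$ is a function $u\in C(I;H^1(\mathbb R^d\times\mathbb T))$ which satisfies (NLS) weakly and for which $u$, $\partial_{x_i}u$ and $\partial_y u$ lie in $L^q_tL^r_xL^2_y(J)$ for every compact interval $J\subset I$ and every pair $q,r\in[2,\infty]$ with $\frac2q+\frac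 dr=\frac d2$, $(q,d)\ne(2,2)$. It is maximal, with maximal lifespan $I$, if it does not extend to a solution on a strictly larger open interval. Theorem. Let $u$ be a maximal solution of (NLS) with maximal lifespan $I$. If $|x|u(0)\in L^2(\mathbb R^d\times\mathbb T)$, $E(u(0))<m_{M(u(0))}$ and $Q(u(0))<0$, then $u$ blows up in finite time, both forward and backward: $\sup I<\infty$ and $\inf I>-\infty$. -/

import Mathlib

open MeasureTheory Set
open scoped ENNReal ContDiff

noncomputable section

namespace Waveguide

/-- The circle `𝕋 = ℝ / 2πℤ`; its `volume` is Lebesgue measure, of total mass `2π`. -/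
abbrev Torus : Type := AddCircle (2 * Real.pi)

instance : Fact (0 < 2 * Real.pi) := ⟨Real.two_pi_pos⟩

/-- `ℝ^d` with its Euclidean norm. -/
abbrev Space (d : ℕ) : Type := EuclideanSpace ℝ (Fin d)

/-- The waveguide `ℝ^d × 𝕋`; its `volume` is the product measure `dx dy`. -/
abbrev Guide (d : ℕ) : Type := Space d × Torus

/-- The complex Hilbert space `L²(ℝ^d × 𝕋)`. -/
abbrev L2 (d : ℕ) : Type := Lp ℂ 2 (volume : Measure (Guide d))

/-- The classical derivative `∂φ/∂x_i`. -/
def derivX {d : ℕ} (i : Fin d) (φ : Guide d → ℂ) (p : Guide d) : ℂ :=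
  deriv (fun s : ℝ => φ (p.1 + s • EuclideanSpace.single i (1 : ℝ), p.2)) 0

/-- The classical derivative `∂φ/∂y`. -/
def derivY {d : ℕ} (φ : Guide d → ℂ) (p : Guide d) : ℂ :=
  deriv (fun s : ℝ => φ (p.1, p.2 + (s : Torus))) 0

/-- Test functions: smooth (that is, the `2π`-periodic lift to `ℝ^d × ℝ` is smooth) with compact
support in `ℝ^d × 𝕋`. -/
structure IsTestFunction {d : ℕ} (φ : Guide d → ℂ) : Prop where
  smooth : ContDiff ℝ ∞ (fun p : Space d × ℝ => φ (p.1, (p.2 : Torus)))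
  compact : HasCompactSupport φ

/-- `g` is the weak derivative `∂f/∂x_i`. -/
def HasWeakDerivX {d : ℕ} (i : Fin d) (f g : L2 d) : Prop :=
  ∀ φ : Guide d → ℂ, IsTestFunction φ → ∫ p, f p * derivX i φ p = - ∫ p, g p * φ p

/-- `g` is the weak derivative `∂f/∂y`. -/
def HasWeakDerivY {d : ℕ} (f g : L2 d) : Prop :=
  ∀ φ : Guide d → ℂ, IsTestFunction φ → ∫ p, f p * derivY φ p = - ∫ p, g p * φ p

/-- The Sobolev space `H¹(ℝ^d × 𝕋)`: functions of `L²` whose weak first derivatives are in `L²`.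
An element is recorded as `(u, (∂_{x_i} u)_i, ∂_y u)`; since weak derivatives are unique, the last
two entries are determined by the first. As a subtype of `L² × (L²)^d × L²` it carries the topology
of the `H¹` norm. -/
def H1 (d : ℕ) : Type :=
  {w : L2 d × (Fin d → L2 d) × L2 d //
    (∀ i, HasWeakDerivX i w.1 (w.2.1 i)) ∧ HasWeakDerivY w.1 w.2.2}

instance (d : ℕ) : TopologicalSpace (H1 d) :=
  inferInstanceAs (TopologicalSpace {w : L2 d × (Fin d → L2 d) × L2 d //
    (∀ i, HasWeakDerivX i w.1 (w.2.1 i)) ∧ HasWeakDerivY w.1 w.2.2})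

namespace H1

variable {d : ℕ}

/-- The underlying `L²` function. -/
def fn (u : H1 d) : L2 d := u.1.1

/-- The weak derivative `∂u/∂x_i`. -/
def dx (u : H1 d) (i : Fin d) : L2 d := u.1.2.1 i

/-- The weak derivative `∂u/∂y`. -/
def dy (u : H1 d) : L2 d := u.1.2.2

/-- The mass `M(u) = ‖u‖₂²`. -/
def mass (u : H1 d) : ℝ := ‖u.fn‖ ^ 2

/-- `‖∇ₓ u‖₂²`. -/
def gradXSq (u : H1 d) : ℝ := ∑ i, ‖u.dx i‖ ^ 2

/-- The nonlinear term `‖u‖_{α+2}^{α+2}`. -/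
def potential (α : ℝ) (u : H1 d) : ℝ := ∫ p, ‖u.fn p‖ ^ (α + 2)

/-- The energy `E(u) = ½ ‖∇_{x,y} u‖₂² - (α+2)⁻¹ ‖u‖_{α+2}^{α+2}`. -/
def energy (α : ℝ) (u : H1 d) : ℝ :=
  1 / 2 * (u.gradXSq + ‖u.dy‖ ^ 2) - 1 / (α + 2) * u.potential α

/-- The semivirial `Q(u) = ‖∇ₓ u‖₂² - αd/(2(α+2)) ‖u‖_{α+2}^{α+2}`. -/
def semivirial (α : ℝ) (u : H1 d) : ℝ :=
  u.gradXSq - α * d / (2 * (α + 2)) * u.potential α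

end H1

/-- The ground state level `m_c = inf {E(u) : u ∈ H¹, M(u) = c, Q(u) = 0}`. -/
def groundLevel (d : ℕ) (α c : ℝ) : ℝ :=
  sInf {e : ℝ | ∃ u : H1 d, u.mass = c ∧ u.semivirial α = 0 ∧ u.energy α = e}

/-- `(q, r)` is an `L²`-admissible pair on `ℝ^d`. -/
def Admissible (d : ℕ) (q r : ℝ≥0∞) : Prop :=
  2 ≤ q ∧ 2 ≤ r ∧ 2 / q + (d : ℝ≥0∞) / r = (d : ℝ≥0∞) / 2 ∧ ¬ (q = 2 ∧ d = 2)

/-- The mixed norm `‖F‖_{L^q_t L^r_x L^2_y}` over the times in `J`. -/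
def mixedNorm {d : ℕ} (q r : ℝ≥0∞) (J : Set ℝ) (F : ℝ → L2 d) : ℝ≥0∞ :=
  eLpNorm (fun t : ℝ => eLpNorm (fun x : Space d =>
    eLpNorm (fun y : Torus => F t (x, y)) 2 volume) r volume) q (volume.restrict J)

/-- `u ∈ X_loc(I)`: on every compact subinterval of `I`, the function `u` and all its first
derivatives are in `L^q_t L^r_x L^2_y` for every admissible pair `(q, r)`. -/
def MemXloc {d : ℕ} (I : Set ℝ) (u : ℝ → H1 d) : Prop :=
  ∀ a ∈ I, ∀ b ∈ I, ∀ q r : ℝ≥0∞, Admissible d q r →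
    mixedNorm q r (Icc a b) (fun t => (u t).fn) < ⊤ ∧
    (∀ i, mixedNorm q r (Icc a b) (fun t => (u t).dx i) < ⊤) ∧
    mixedNorm q r (Icc a b) (fun t => (u t).dy) < ⊤

/-- `u` is a solution of `i ∂_t u + Δ_{x,y} u = -|u|^α u` on the open time interval `I ∋ 0`:
`u ∈ C(I; H¹) ∩ X_loc(I)`, and the equation, in the form `∂_t u = i (Δ_{x,y} u + |u|^α u)`, holds
weakly at all times in `I`. -/
structure IsSolution {d : ℕ} (α : ℝ) (I : Set ℝ) (u : ℝ → H1 d) : Prop where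
  isOpen : IsOpen I
  ordConnected : I.OrdConnected
  zero_mem : (0 : ℝ) ∈ I
  continuousOn : ContinuousOn u I
  memXloc : MemXloc I u
  equation : ∀ φ : Guide d → ℂ, IsTestFunction φ → ∀ t ∈ I,
    HasDerivAt (fun s : ℝ => ∫ p, (u s).fn p * φ p)
      (Complex.I * (-(∑ i, ∫ p, (u t).dx i p * derivX i φ p) - (∫ p, (u t).dy p * derivY φ p)
        + ∫ p, ((‖(u t).fn p‖ ^ α : ℝ) : ℂ) * (u t).fn p * φ p)) t

/-- `u` is a solution with maximal lifespan `I`: it does not extend, as a solution, to a strictly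
larger open interval. -/
def IsMaximalSolution {d : ℕ} (α : ℝ) (I : Set ℝ) (u : ℝ → H1 d) : Prop :=
  IsSolution α I u ∧
    ∀ (J : Set ℝ) (v : ℝ → H1 d), IsSolution α J v → I ⊆ J → EqOn v u I → J = I

end Waveguide

end

noncomputable section

namespace Waveguide

open Filter Topology
open scoped InnerProductSpace BoundedContinuousFunction

variable {d : ℕ}

/-! The proof is Glassey's virial argument combined with trapping below the ground state level. For
V(t) = ∫ |x|²|u|² one has formally V'' = 8 Q(u). If Q(u(t)) ≤ -η < 0 on all of I, then 0 ≤ V(T) ≤ A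
+ B|T| - 4ηT², which bounds T in both directions (`exists_abs_le`).

Trapping. The dilation u ↦ r^{d/2} u(rx, y) acts on x only: it preserves the mass and ‖∂_y u‖₂,
multiplies ‖∇ₓu‖₂² by r² and the potential by r^{αd/2}, where αd/2 > 2. If Q(u) < 0, some r < 1
brings Q to zero, and the energy of the dilate is at most E(u) - Q(u) (`exists_virS_eq_zero`). Hence
m_c ≤ E(u) - Q(u) (`groundLevel_le`). By conservation of mass and energy, Q(u(t)) < 0 then improves
itself to Q(u(t)) ≤ -(m_c - E), and by continuity in time Q cannot leave this region (`virS_le`).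

The bulk of the work justifies the conservation laws and the virial identity for a solution that is
merely continuous into H¹. A form Re⟨Lu, u⟩ with L bounded on H¹ and symmetric can be differentiated
along the flow (`hasDerivAt_quadratic`); this gives the mass. For the kinetic energy and the
momentum, L would lose a derivative, so derivatives are replaced by difference quotients D_s and s →
0 is taken after integration in time. The errors are controlled by space-time integrals of |u|^a
|D_s u|², finite uniformly in s: Sobolev and Hölder bound the weighted integral by an admissible
mixed norm (`exists_weighted_admissible`), and a convexity argument passes from derivatives to
difference quotients (`lintegral_diffQ_le`). For the momentum the error is O(s) (`mom_sub_eq`). For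
the energy the potential is truncated at height k, the error is O(k^{-δ}), and k → ∞ follows s → 0
(`energyS_eq`). The unbounded weight |x|² is approximated by the bounded weights 2ρ⁻²(1 - cos ρx_j).
-/

instance : (volume : Measure (Guide d)).IsAddHaarMeasure :=
  inferInstanceAs ((volume : Measure (Space d)).prod (volume : Measure Torus)).IsAddHaarMeasure

/-! ### Coordinates on ℝ^d × 𝕋, test functions and their classical derivatives. -/

/-- The covering map `ℝ^d × ℝ → ℝ^d × 𝕋`. -/
def cover (q : Space d × ℝ) : Guide d := (q.1, (q.2 : Torus))

/-- The coordinate directions of `ℝ^d × 𝕋`: `some j` for `x_j` and `none` for `y`. -/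
def basisDir : Option (Fin d) → Space d × ℝ
  | some j => (EuclideanSpace.single j 1, 0)
  | none => (0, 1)

/-- Displacement by `s` in the direction `i`. -/
def shift (i : Option (Fin d)) (s : ℝ) : Guide d := cover (s • basisDir i)

/-- The classical partial derivative in the direction `i`. -/
def pderiv (i : Option (Fin d)) (φ : Guide d → ℂ) (p : Guide d) : ℂ :=
  deriv (fun s : ℝ => φ (p + shift i s)) 0

theorem cover_add (q r : Space d × ℝ) : cover (q + r) = cover q + cover r := by
  simp [cover]

theorem cover_neg (q : Space d × ℝ) : cover (-q) = -cover q := by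
  simp [cover]

theorem cover_sub (q r : Space d × ℝ) : cover (q - r) = cover q - cover r := by
  simp [cover]

theorem cover_surjective : Function.Surjective (cover (d := d)) := by
  rintro ⟨x, y⟩
  obtain ⟨y, rfl⟩ := QuotientAddGroup.mk_surjective y
  exact ⟨(x, y), rfl⟩

theorem continuous_cover : Continuous (cover (d := d)) :=
  continuous_fst.prodMk ((AddCircle.continuous_mk' _).comp continuous_snd)

theorem isOpenQuotientMap_cover : IsOpenQuotientMap (cover (d := d)) := by
  refine ⟨cover_surjective, continuous_cover, ?_⟩
  exact IsOpenMap.prodMap IsOpenMap.id QuotientAddGroup.isOpenMap_coe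

theorem shift_add (i : Option (Fin d)) (s t : ℝ) : shift i (s + t) = shift i s + shift i t := by
  simp [shift, add_smul, cover_add]

@[simp] theorem shift_zero (i : Option (Fin d)) : shift i 0 = 0 := by
  simp [shift, cover]

theorem shift_neg (i : Option (Fin d)) (s : ℝ) : shift i (-s) = -shift i s := by
  simp [shift, cover_neg]

theorem continuous_shift (i : Option (Fin d)) : Continuous (shift i) :=
  continuous_cover.comp (by fun_prop)

theorem derivX_eq_pderiv (j : Fin d) (φ : Guide d → ℂ) : derivX j φ = pderiv (some j) φ := by
  funext p
  simp only [derivX, pderiv, shift, basisDir, cover]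
  congr 1
  funext s
  congr 1
  ext <;> simp

theorem derivY_eq_pderiv (φ : Guide d → ℂ) : derivY φ = pderiv none φ := by
  funext p
  simp only [derivY, pderiv, shift, basisDir, cover]
  congr 1
  funext s
  congr 1
  ext <;> simp

namespace IsTestFunction

variable {φ ψ : Guide d → ℂ}

theorem contDiff (h : IsTestFunction φ) : ContDiff ℝ ∞ (φ ∘ cover) := h.smooth

theorem continuous (h : IsTestFunction φ) : Continuous φ :=
  isOpenQuotientMap_cover.isQuotientMap.continuous_iff.2 h.contDiff.continuous

theorem hasDerivAt_zero (h : IsTestFunction φ) (i : Option (Fin d)) (q : Space d × ℝ) :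
    HasDerivAt (fun s : ℝ => φ (cover q + shift i s)) (fderiv ℝ (φ ∘ cover) q (basisDir i)) 0 := by
  have h1 : HasDerivAt (fun s : ℝ => q + s • basisDir i) (basisDir i) 0 := by
    simpa using ((hasDerivAt_id (0 : ℝ)).smul_const (basisDir i)).const_add q
  have h2 : HasFDerivAt (φ ∘ cover) (fderiv ℝ (φ ∘ cover) q) (q + (0 : ℝ) • basisDir i) := by
    simpa using (h.contDiff.differentiable (by simp) q).hasFDerivAt
  have := h2.comp_hasDerivAt (0 : ℝ) h1
  refine this.congr_of_eventuallyEq (Eventually.of_forall fun s => ?_)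
  simp [shift, cover_add]

theorem pderiv_cover (h : IsTestFunction φ) (i : Option (Fin d)) (q : Space d × ℝ) :
    pderiv i φ (cover q) = fderiv ℝ (φ ∘ cover) q (basisDir i) :=
  (h.hasDerivAt_zero i q).deriv

theorem hasDerivAt (h : IsTestFunction φ) (i : Option (Fin d)) (p : Guide d) (s : ℝ) :
    HasDerivAt (fun s : ℝ => φ (p + shift i s)) (pderiv i φ (p + shift i s)) s := by
  obtain ⟨q, rfl⟩ := cover_surjective p
  have h1 := h.hasDerivAt_zero i (q + s • basisDir i)
  rw [← h.pderiv_cover, cover_add] at h1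
  have h2 := HasDerivAt.comp_sub_const (f := fun s' => φ (cover q + cover (s • basisDir i) + shift i s'))
    s s (by simpa using h1)
  refine h2.congr_of_eventuallyEq (Eventually.of_forall fun s' => ?_)
  have : shift i s' = shift i s + shift i (s' - s) := by rw [← shift_add]; congr 1; ring
  simp only [this, ← add_assoc]
  rfl

theorem pderiv (h : IsTestFunction φ) (i : Option (Fin d)) : IsTestFunction (pderiv i φ) where
  smooth := by
    have : (fun q : Space d × ℝ => fderiv ℝ (φ ∘ cover) q (basisDir i)) =
        fun p : Space d × ℝ => Waveguide.pderiv i φ (p.1, (p.2 : Torus)) := by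
      funext q
      exact (h.pderiv_cover i q).symm
    rw [← this]
    exact (h.contDiff.fderiv_right (m := ∞) (by simp)).clm_apply contDiff_const
  compact := by
    refine HasCompactSupport.intro h.compact fun p hp => ?_
    have h0 : φ =ᶠ[𝓝 p] 0 := notMem_tsupport_iff_eventuallyEq.1 hp
    have hc : Tendsto (fun s : ℝ => p + shift i s) (𝓝 0) (𝓝 p) := by
      have : Continuous fun s : ℝ => p + shift i s := continuous_const.add (continuous_shift i)
      simpa using this.tendsto 0
    have : (fun s : ℝ => φ (p + shift i s)) =ᶠ[𝓝 0] fun _ => 0 := hc.eventually h0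
    rw [Waveguide.pderiv, this.deriv_eq]
    simp

theorem translate (h : IsTestFunction φ) (z : Guide d) : IsTestFunction fun p => φ (p + z) where
  smooth := by
    obtain ⟨q, rfl⟩ := cover_surjective z
    have : (fun p : Space d × ℝ => φ ((p.1, (p.2 : Torus)) + cover q)) =
        fun p => (φ ∘ cover) (p + q) := by
      funext p
      simp [cover_add]
      rfl
    rw [this]
    exact h.contDiff.comp (contDiff_id.add contDiff_const)
  compact := h.compact.comp_homeomorph (Homeomorph.addRight z)

theorem reflect (h : IsTestFunction φ) (z : Guide d) : IsTestFunction fun p => φ (z - p) where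
  smooth := by
    obtain ⟨q, rfl⟩ := cover_surjective z
    have : (fun p : Space d × ℝ => φ (cover q - (p.1, (p.2 : Torus)))) =
        fun p => (φ ∘ cover) (q - p) := by
      funext p
      simp [cover_sub]
      rfl
    rw [this]
    exact h.contDiff.comp (contDiff_const.sub contDiff_id)
  compact := h.compact.comp_homeomorph (Homeomorph.subLeft z)

theorem conj (h : IsTestFunction φ) : IsTestFunction fun p => star (φ p) where
  smooth := (Complex.conjCLE.contDiff (n := ∞)).comp h.smooth
  compact := h.compact.comp_left (g := star) (by simp)

theorem add (h : IsTestFunction φ) (h' : IsTestFunction ψ) : IsTestFunction fun p => φ p + ψ p where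
  smooth := h.smooth.add h'.smooth
  compact := h.compact.add h'.compact

theorem mul (h : IsTestFunction φ) (h' : IsTestFunction ψ) : IsTestFunction fun p => φ p * ψ p where
  smooth := h.smooth.mul h'.smooth
  compact := h.compact.mul_right

theorem smul (h : IsTestFunction φ) (c : ℂ) : IsTestFunction fun p => c * φ p where
  smooth := contDiff_const.mul h.smooth
  compact := h.compact.mul_left (f := fun _ => c)

theorem zero : IsTestFunction fun _ : Guide d => (0 : ℂ) where
  smooth := contDiff_const
  compact := HasCompactSupport.zero

theorem weight (h : IsTestFunction φ) {m : ℝ → ℝ} (hm : ContDiff ℝ ∞ m) (j : Fin d) :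
    IsTestFunction fun p => (m (p.1 j) : ℂ) * φ p where
  smooth := by
    refine ContDiff.mul ?_ h.smooth
    refine Complex.ofRealCLM.contDiff.comp (hm.comp ?_)
    exact (EuclideanSpace.proj (𝕜 := ℝ) j).contDiff.comp contDiff_fst
  compact := h.compact.mul_left

theorem memLp (h : IsTestFunction φ) (p : ℝ≥0∞) : MemLp φ p volume :=
  h.continuous.memLp_of_hasCompactSupport h.compact

end IsTestFunction

theorem pderiv_translate (i : Option (Fin d)) (φ : Guide d → ℂ) (z p : Guide d) :
    pderiv i (fun p => φ (p + z)) p = pderiv i φ (p + z) := by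
  simp only [pderiv, add_right_comm]

theorem pderiv_conj (i : Option (Fin d)) (φ : Guide d → ℂ) (p : Guide d) :
    pderiv i (fun p => star (φ p)) p = star (pderiv i φ p) := by
  simp only [pderiv]
  exact deriv.star

theorem pderiv_reflect (i : Option (Fin d)) (φ : Guide d → ℂ) (z p : Guide d) :
    pderiv i (fun p => φ (z - p)) p = -pderiv i φ (z - p) := by
  have : (fun s : ℝ => φ (z - (p + shift i s))) = fun s => (fun s => φ (z - p + shift i s)) (-s) := by
    funext s
    simp only [shift_neg]
    congr 1
    abel
  simp only [pderiv, this]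
  rw [deriv_comp_neg (fun s => φ (z - p + shift i s)) 0, neg_zero]

theorem pderiv_add {φ ψ : Guide d → ℂ} (h : IsTestFunction φ) (h' : IsTestFunction ψ)
    (i : Option (Fin d)) (p : Guide d) :
    pderiv i (fun p => φ p + ψ p) p = pderiv i φ p + pderiv i ψ p := by
  have := (h.hasDerivAt i p 0).fun_add (h'.hasDerivAt i p 0)
  rw [pderiv, this.deriv, shift_zero, add_zero]

theorem pderiv_smul {φ : Guide d → ℂ} (h : IsTestFunction φ) (c : ℂ)
    (i : Option (Fin d)) (p : Guide d) :
    pderiv i (fun p => c * φ p) p = c * pderiv i φ p := by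
  have := (h.hasDerivAt i p 0).const_mul c
  rw [pderiv, this.deriv, shift_zero, add_zero]

theorem pderiv_weight {φ : Guide d → ℂ} (h : IsTestFunction φ) {m : ℝ → ℝ} (hm : ContDiff ℝ ∞ m)
    (j : Fin d) (i : Option (Fin d)) (p : Guide d) :
    pderiv i (fun p => (m (p.1 j) : ℂ) * φ p) p =
      (m (p.1 j) : ℂ) * pderiv i φ p +
        if i = some j then ((deriv m (p.1 j) : ℝ) : ℂ) * φ p else 0 := by
  have h1 := h.hasDerivAt i p 0
  have hm' : ∀ t, HasDerivAt m (deriv m t) t := fun t =>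
    (hm.differentiable (by simp) t).hasDerivAt
  have h2 : HasDerivAt (fun s : ℝ => ((m ((p + shift i s).1 j) : ℝ) : ℂ))
      (if i = some j then ((deriv m (p.1 j) : ℝ) : ℂ) else 0) 0 := by
    rcases i with _ | k
    · simp only [shift, basisDir, cover]
      simpa using hasDerivAt_const _ _
    · by_cases hk : k = j
      · subst hk
        simp only [if_true]
        have : HasDerivAt (fun s : ℝ => m (p.1 k + s)) (deriv m (p.1 k)) 0 := by
          have := HasDerivAt.comp_const_add (f := m) (p.1 k) 0 (hm' _)
          simpa using this
        simpa [shift, basisDir, cover] using this.ofReal_comp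
      · have : (some k : Option (Fin d)) ≠ some j := by simpa using hk
        simp only [this, if_false]
        have h3 : ∀ s : ℝ, (p + shift (some k) s).1 j = p.1 j := by
          intro s
          simp [shift, basisDir, cover, Ne.symm hk]
        simp only [h3]
        exact hasDerivAt_const _ _
  have := h2.fun_mul h1
  rw [pderiv, this.deriv]
  simp only [shift_zero, add_zero]
  split_ifs <;> ring

/-- Local integrability of `g` is enough: while s stays within distance 1 of s₀, the translated
derivatives are supported in one compact set K, on which |g| times a sup bound dominates. -/
theorem hasDerivAt_integral_translate {g φ : Guide d → ℂ} (hg : LocallyIntegrable g volume)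
    (hφ : IsTestFunction φ) (i : Option (Fin d)) (s₀ : ℝ) :
    HasDerivAt (fun s => ∫ p, g p * φ (p + shift i s))
      (∫ p, g p * pderiv i φ (p + shift i s₀)) s₀ := by
  have hφ' := hφ.pderiv i
  obtain ⟨C, hC⟩ := hφ'.compact.exists_bound_of_continuous hφ'.continuous
  let K : Set (Guide d) := (fun q : Guide d × ℝ => q.1 - shift i q.2) ''
    (tsupport (pderiv i φ) ×ˢ Metric.closedBall s₀ 1)
  have hK : IsCompact K := (hφ'.compact.prod (isCompact_closedBall s₀ 1)).image
    (continuous_fst.sub ((continuous_shift i).comp continuous_snd))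
  have hint : ∀ s, ∀ {ψ : Guide d → ℂ}, IsTestFunction ψ →
      Integrable (fun p => g p * ψ (p + shift i s)) volume := by
    intro s ψ hψ
    have hψ' := hψ.translate (shift i s)
    simpa [mul_comm, smul_eq_mul] using
      hg.integrable_smul_left_of_hasCompactSupport hψ'.continuous hψ'.compact
  refine (hasDerivAt_integral_of_dominated_loc_of_deriv_le (Metric.ball_mem_nhds s₀ one_pos)
    (bound := K.indicator fun p => ‖g p‖ * C) (Eventually.of_forall fun s =>
      (hint s hφ).aestronglyMeasurable) (hint s₀ hφ) (hint s₀ hφ').aestronglyMeasurable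
    (Eventually.of_forall fun p s hs => ?_) ?_ (Eventually.of_forall fun p s _ =>
      (hφ.hasDerivAt i p s).const_mul (g p))).2
  · by_cases hp : p ∈ K
    · rw [indicator_of_mem hp, norm_mul]
      gcongr
      exact hC _
    · rw [indicator_of_notMem hp]
      have : p + shift i s ∉ tsupport (pderiv i φ) := fun h =>
        hp ⟨(p + shift i s, s), ⟨h, Metric.ball_subset_closedBall hs⟩, by simp⟩
      rw [image_eq_zero_of_notMem_tsupport this]
      simp
  · rw [integrable_indicator_iff hK.measurableSet]
    exact ((hg.integrableOn_isCompact hK).norm.mul_const C)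

/-- The integral of a product of test functions is invariant under translation, so its derivative in
the translation parameter vanishes; the product rule turns this into integration by parts. -/
theorem integral_pderiv_mul {φ ψ : Guide d → ℂ} (hφ : IsTestFunction φ) (hψ : IsTestFunction ψ)
    (i : Option (Fin d)) :
    ∫ p, φ p * pderiv i ψ p = -∫ p, pderiv i φ p * ψ p := by
  have h1 := hasDerivAt_integral_translate (g := fun _ => 1) (locallyIntegrable_const 1)
    (hφ.mul hψ) i 0
  have h2 : ∀ s, ∫ p, (1 : ℂ) * (φ (p + shift i s) * ψ (p + shift i s)) =
      ∫ p, φ p * ψ p := fun s => by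
    simpa using integral_add_right_eq_self (μ := volume) (fun p => φ p * ψ p) (shift i s)
  have h3 := (hasDerivAt_const (0 : ℝ) (∫ p, φ p * ψ p)).congr_of_eventuallyEq
    (Eventually.of_forall h2)
  have h4 := h1.unique h3
  have h5 : ∀ p, pderiv i (fun p => φ p * ψ p) p = φ p * pderiv i ψ p + pderiv i φ p * ψ p := by
    intro p
    have := (hφ.hasDerivAt i p 0).fun_mul (hψ.hasDerivAt i p 0)
    rw [pderiv, this.deriv]
    simp [add_comm]
  simp only [shift_zero, add_zero, one_mul, h5] at h4
  rw [integral_add] at h4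
  · exact eq_neg_of_add_eq_zero_left h4
  · exact memLp_one_iff_integrable.1 ((hφ.mul (hψ.pderiv i)).memLp 1)
  · exact memLp_one_iff_integrable.1 (((hφ.pderiv i).mul hψ).memLp 1)

/-! ### Translations on L², mollification and a duality criterion for density. -/

/-- Translation `g ↦ g(· + z)` on `L²(ℝ^d × 𝕋)`. -/
def trans (z : Guide d) : L2 d →ₗᵢ[ℂ] L2 d :=
  Lp.compMeasurePreservingₗᵢ ℂ (fun p => p + z) (measurePreserving_add_right volume z)

theorem coeFn_trans (z : Guide d) (g : L2 d) : trans z g =ᵐ[volume] fun p => g (p + z) :=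
  Lp.coeFn_compMeasurePreserving g (measurePreserving_add_right volume z)

theorem ae_translate {P : Guide d → Prop} (h : ∀ᵐ p : Guide d, P p) (z : Guide d) :
    ∀ᵐ p : Guide d, P (p + z) :=
  (measurePreserving_add_right volume z).quasiMeasurePreserving.ae h

@[simp] theorem trans_zero (g : L2 d) : trans 0 g = g := by
  refine Lp.ext ?_
  filter_upwards [coeFn_trans 0 g] with p hp
  simp [hp]

theorem trans_trans (z w : Guide d) (g : L2 d) : trans z (trans w g) = trans (z + w) g := by
  refine Lp.ext ?_
  filter_upwards [coeFn_trans z (trans w g), coeFn_trans (z + w) g,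
    ae_translate (coeFn_trans w g) z] with p h1 h2 h3
  rw [h1, h2, h3, add_assoc]

theorem inner_trans_left (z : Guide d) (f g : L2 d) :
    ⟪trans z f, g⟫_ℂ = ⟪f, trans (-z) g⟫_ℂ := by
  rw [← (trans z).inner_map_map f, trans_trans, add_neg_cancel, trans_zero]

theorem continuous_trans (g : L2 d) : Continuous fun z => trans z g := by
  have h : Continuous fun z : Guide d => (ContinuousMap.mk (fun p : Guide d => p + z)
      (continuous_id.add continuous_const)) := by
    refine ContinuousMap.continuous_of_continuous_uncurry _ ?_
    exact continuous_snd.add continuous_fst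
  exact (continuous_const (y := g)).compMeasurePreservingLp h
    (fun z => measurePreserving_add_right volume z) (by simp)

theorem inner_eq_integral (f g : L2 d) : ⟪f, g⟫_ℂ = ∫ p, star (f p) * g p := by
  rw [L2.inner_def]
  congr 1
  funext p
  rw [RCLike.inner_apply, mul_comm]
  rfl

/-- The cosine as a function on the circle. -/
def circleCos : Torus → ℝ := Real.cos_periodic.lift

theorem circleCos_coe (y : ℝ) : circleCos (y : Torus) = Real.cos y := rfl

theorem circleCos_le_one (y : Torus) : circleCos y ≤ 1 := by
  obtain ⟨y, rfl⟩ := QuotientAddGroup.mk_surjective y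
  exact Real.cos_le_one y

theorem neg_one_le_circleCos (y : Torus) : -1 ≤ circleCos y := by
  obtain ⟨y, rfl⟩ := QuotientAddGroup.mk_surjective y
  exact Real.neg_one_le_cos y

theorem circleCos_eq_one {y : Torus} (h : circleCos y = 1) : y = 0 := by
  obtain ⟨y, rfl⟩ := QuotientAddGroup.mk_surjective y
  obtain ⟨n, hn⟩ := (Real.cos_eq_one_iff y).1 h
  refine (AddCircle.coe_eq_zero_iff (2 * Real.pi)).2 ⟨n, ?_⟩
  simpa using hn

/-- A smooth compactly supported function with a unique maximum at `0`. -/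
def peak (p : Guide d) : ℝ :=
  (default : ContDiffBump (0 : Space d)) p.1 * Real.exp (-‖p.1‖ ^ 2) * ((1 + circleCos p.2) / 2)

theorem peak_nonneg (p : Guide d) : 0 ≤ peak p := by
  have := neg_one_le_circleCos p.2
  unfold peak
  have := (default : ContDiffBump (0 : Space d)).nonneg (x := p.1)
  have : 0 ≤ (1 + circleCos p.2) / 2 := by linarith
  positivity

theorem peak_zero : peak (0 : Guide d) = 1 := by
  have h : circleCos 0 = 1 := by
    have := circleCos_coe 0
    simpa using this
  simp only [peak, Prod.fst_zero, Prod.snd_zero, h, norm_zero]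
  rw [ContDiffBump.one_of_mem_closedBall _ (Metric.mem_closedBall_self
    (default : ContDiffBump (0 : Space d)).rIn_pos.le)]
  norm_num

/-- The bump alone equals 1 on a whole ball; the Gaussian makes the maximum strict in x and the
factor (1 + cos y)/2 makes it strict in y. -/
theorem peak_lt_one {p : Guide d} (hp : p ≠ 0) : peak p < 1 := by
  have h0 := (default : ContDiffBump (0 : Space d)).nonneg (x := p.1)
  have h1 := (default : ContDiffBump (0 : Space d)).le_one (x := p.1)
  have h2 := neg_one_le_circleCos p.2
  have h3 := circleCos_le_one p.2
  have h4 : Real.exp (-‖p.1‖ ^ 2) ≤ 1 := Real.exp_le_one_iff.2 (by nlinarith [norm_nonneg p.1])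
  have h5 := Real.exp_pos (-‖p.1‖ ^ 2)
  unfold peak
  by_cases hx : p.1 = 0
  · have hy : p.2 ≠ 0 := fun hy => hp (Prod.ext hx hy)
    have h6 : circleCos p.2 < 1 := lt_of_le_of_ne h3 fun h => hy (circleCos_eq_one h)
    have h7 : (default : ContDiffBump (0 : Space d)) p.1 * Real.exp (-‖p.1‖ ^ 2) ≤ 1 :=
      mul_le_one₀ h1 h5.le h4
    have h8 : 0 ≤ (default : ContDiffBump (0 : Space d)) p.1 * Real.exp (-‖p.1‖ ^ 2) := by
      positivity
    nlinarith
  · have h6 : Real.exp (-‖p.1‖ ^ 2) < 1 := by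
      have := norm_pos_iff.2 hx
      rw [← Real.exp_zero, Real.exp_lt_exp]
      nlinarith
    have h7 : (default : ContDiffBump (0 : Space d)) p.1 * Real.exp (-‖p.1‖ ^ 2) < 1 := by
      nlinarith
    have h8 : 0 ≤ (default : ContDiffBump (0 : Space d)) p.1 * Real.exp (-‖p.1‖ ^ 2) := by
      positivity
    nlinarith

theorem isTestFunction_peak : IsTestFunction fun p : Guide d => (peak p : ℂ) where
  smooth := by
    refine Complex.ofRealCLM.contDiff.comp ?_
    change ContDiff ℝ ∞ fun p : Space d × ℝ => (default : ContDiffBump (0 : Space d)) p.1 *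
      Real.exp (-‖p.1‖ ^ 2) * ((1 + Real.cos p.2) / 2)
    refine ContDiff.mul (ContDiff.mul ?_ ?_) ?_
    · exact (ContDiffBump.contDiff _).comp contDiff_fst
    · exact Real.contDiff_exp.comp (contDiff_norm_sq ℝ |>.comp contDiff_fst).neg
    · exact (contDiff_const.add (Real.contDiff_cos.comp contDiff_snd)).div_const _
  compact := by
    refine HasCompactSupport.intro
      ((isCompact_closedBall (0 : Space d) 2).prod (isCompact_univ (X := Torus))) fun p hp => ?_
    have : p.1 ∉ Metric.closedBall (0 : Space d) 2 := fun h => hp ⟨h, mem_univ _⟩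
    have h0 : (default : ContDiffBump (0 : Space d)) p.1 = 0 := by
      refine ContDiffBump.zero_of_le_dist _ ?_
      rw [Metric.mem_closedBall, not_le] at this
      exact this.le
    simp [peak, h0]

theorem IsTestFunction.pow {φ : Guide d → ℂ} (h : IsTestFunction φ) (n : ℕ) :
    IsTestFunction fun p => φ p ^ (n + 1) := by
  induction n with
  | zero => simpa using h
  | succ n ih =>
    simp only [pow_succ _ (n + 1)]
    exact ih.mul h

/-- An approximate identity made of real test functions. -/
theorem exists_mollifier : ∃ ρ : ℕ → Guide d → ℝ, (∀ n, IsTestFunction fun p => (ρ n p : ℂ)) ∧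
    ∀ g : L2 d, Tendsto (fun n => ∫ z, (ρ n z : ℂ) • trans z g) atTop (𝓝 g) := by
  let s : Set (Guide d) := Metric.closedBall (0 : Space d) 2 ×ˢ univ
  have hs : IsCompact s := (isCompact_closedBall (0 : Space d) 2).prod isCompact_univ
  have hcont : Continuous (peak (d := d)) := by
    have := Complex.continuous_re.comp (isTestFunction_peak (d := d)).continuous
    exact this
  have hzero : ∀ p ∉ s, peak p = 0 := by
    intro p hp
    have : p.1 ∉ Metric.closedBall (0 : Space d) 2 := fun h => hp ⟨h, mem_univ _⟩
    have h0 : (default : ContDiffBump (0 : Space d)) p.1 = 0 := by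
      refine ContDiffBump.zero_of_le_dist _ ?_
      rw [Metric.mem_closedBall, not_le] at this
      exact this.le
    simp [peak, h0]
  -- Normalised powers of a function with a strict maximum at 0 concentrate there. The exponent n +
  -- 1 avoids the zeroth power, which is not compactly supported.
  refine ⟨fun n p => (∫ x in s, peak x ^ (n + 1))⁻¹ * peak p ^ (n + 1), fun n => ?_, fun g => ?_⟩
  · simpa using (isTestFunction_peak.pow n).smul ((∫ x in s, peak x ^ (n + 1) : ℝ) : ℂ)⁻¹
  · have h0 : (0 : Guide d) ∈ closure (interior s) := by
      refine subset_closure ?_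
      rw [interior_prod_eq]
      refine ⟨?_, by simp⟩
      exact Metric.ball_subset_interior_closedBall (by simp)
    have := tendsto_setIntegral_pow_smul_of_unique_maximum_of_isCompact_of_continuousOn (μ := volume)
      (g := fun z => trans z g) hs hcont.continuousOn
      (fun y _ hy => by rw [peak_zero]; exact peak_lt_one hy) (fun x _ => peak_nonneg x)
      (by rw [peak_zero]; exact one_pos) h0 (continuous_trans g).continuousOn
    rw [trans_zero] at this
    refine (this.comp (tendsto_add_atTop_nat 1)).congr fun n => ?_
    simp only [Function.comp_apply]
    rw [setIntegral_eq_integral_of_forall_compl_eq_zero (s := s)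
      (f := fun x => peak x ^ (n + 1) • trans x g), ← integral_smul]
    · congr 1
      funext z
      rw [smul_smul]
      exact RCLike.real_smul_eq_coe_smul (K := ℂ) _ _
    · intro p hp
      simp [hzero p hp]

/-- Since |fg| ≤ |f|² + |g|², the integrand is dominated by two convolution integrands of integrable
functions; this licenses the uses of Fubini below. -/
theorem integrable_mollify {f g : Guide d → ℂ} {k : Guide d → ℂ} (hf : MemLp f 2 volume)
    (hg : MemLp g 2 volume) (hk : IsTestFunction k) :
    Integrable (fun x : Guide d × Guide d => f x.2 * g x.1 * k (x.1 - x.2))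
      ((volume : Measure (Guide d)).prod volume) := by
  have hkI : Integrable (fun z => ‖k z‖) volume := (memLp_one_iff_integrable.1 (hk.memLp 1)).norm
  have hkI' : Integrable (fun z => ‖k (0 - z)‖) volume :=
    (memLp_one_iff_integrable.1 ((hk.reflect 0).memLp 1)).norm
  have h1 := (hf.integrable_norm_pow (p := 2) (by simp)).convolution_integrand
    (ContinuousLinearMap.mul ℝ ℝ) hkI
  have h2 := ((hg.integrable_norm_pow (p := 2) (by simp)).convolution_integrand
    (ContinuousLinearMap.mul ℝ ℝ) hkI').swap
  refine (h1.add h2).mono' ?_ (Eventually.of_forall fun x => ?_)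
  · refine AEStronglyMeasurable.mul (AEStronglyMeasurable.mul ?_ ?_) ?_
    · exact hf.aestronglyMeasurable.comp_snd
    · exact hg.aestronglyMeasurable.comp_fst
    · exact (hk.continuous.comp (continuous_fst.sub continuous_snd)).aestronglyMeasurable
  · simp only [Pi.add_apply, ContinuousLinearMap.mul_apply', Function.comp_apply, Prod.fst_swap,
      Prod.snd_swap, norm_mul, zero_sub, neg_sub, ← add_mul]
    gcongr
    nlinarith [sq_nonneg (‖f x.2‖ - ‖g x.1‖), norm_nonneg (f x.2), norm_nonneg (g x.1)]

/-- Fubini and the substitution z = p - q leave `u` integrated against a translated test function,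
the form to which the definition of a weak derivative applies. -/
theorem inner_mollify {k : Guide d → ℂ} (hk : IsTestFunction k) (ψ u : L2 d) :
    ⟪ψ, ∫ z, k z • trans z u⟫_ℂ = ∫ q, star (ψ q) * ∫ p, u p * k (p - q) := by
  have hI := integrable_mollify (f := fun q => star (ψ q)) (Lp.memLp ψ).star (Lp.memLp u) hk
  have hint : Integrable (fun z => k z • trans z u) volume :=
    (hk.continuous.smul (continuous_trans u)).integrable_of_hasCompactSupport hk.compact.smul_right
  rw [← innerSL_apply_apply ℂ, ← ContinuousLinearMap.integral_comp_comm _ hint]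
  have hI2 := (measurePreserving_prod_add (volume : Measure (Guide d)) volume).integrable_comp
    hI.swap.aestronglyMeasurable |>.2 hI.swap
  have e1 : ∀ z, (innerSL ℂ ψ) (k z • trans z u) = ∫ q, star (ψ q) * u (q + z) * k z := by
    intro z
    rw [map_smul, innerSL_apply_apply, inner_eq_integral, smul_eq_mul, ← integral_const_mul]
    refine integral_congr_ae ?_
    filter_upwards [coeFn_trans z u] with q hq
    rw [hq]
    ring
  simp only [e1]
  rw [integral_integral_swap]
  · congr 1
    funext q
    simp only [mul_assoc]
    rw [integral_const_mul]
    congr 1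
    rw [← integral_add_left_eq_self _ (-q)]
    refine integral_congr_ae (Eventually.of_forall fun p => ?_)
    simp [sub_eq_neg_add]
  · refine hI2.swap.congr (Eventually.of_forall fun x => ?_)
    simp [Function.uncurry]

theorem integral_mollify_swap {k : Guide d → ℂ} (hk : IsTestFunction k) (ψ u : L2 d) :
    ∫ q, star (ψ q) * ∫ p, u p * k (p - q) = ∫ p, u p * ∫ q, star (ψ q) * k (p - q) := by
  have hI := integrable_mollify (f := fun q => star (ψ q)) (Lp.memLp ψ).star (Lp.memLp u) hk
  simp only [← integral_const_mul]
  rw [integral_integral_swap]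
  · congr 1
    funext p
    congr 1
    funext q
    ring
  · refine hI.swap.congr (Eventually.of_forall fun x => ?_)
    simp [Function.uncurry]
    ring

/-- Hahn–Banach: a functional separating x from the closure of S has real part bounded above on a
subspace, hence zero there by scaling, and multiplication by -i disposes of the imaginary part. The
hypothesis then gives f x = 0, against the separation. -/
theorem mem_closure_of_forall_dual {E : Type*} [NormedAddCommGroup E] [NormedSpace ℂ E]
    (S : Submodule ℂ E) (x : E)
    (h : ∀ f : StrongDual ℂ E, (∀ a ∈ S, f a = 0) → f x = 0) : x ∈ closure (S : Set E) := by
  by_contra hx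
  have hx' : x ∉ (S.topologicalClosure : Set E) := hx
  let _ : NormedSpace ℝ E := NormedSpace.restrictScalars ℝ ℂ E
  obtain ⟨f, r, h1, h2⟩ := RCLike.geometric_hahn_banach_closed_point (𝕜 := ℂ)
    ((S.topologicalClosure.restrictScalars ℝ).convex) S.isClosed_topologicalClosure hx'
  have hre : ∀ a ∈ S.topologicalClosure, (f a).re = 0 := by
    intro a ha
    by_contra hne
    have := h1 (((r / (f a).re : ℝ) : ℂ) • a) (S.topologicalClosure.smul_mem _ ha)
    rw [map_smul, smul_eq_mul] at this
    simp [hne] at this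
  have h0 : ∀ a ∈ S, f a = 0 := by
    intro a ha
    have ha' := S.le_topologicalClosure ha
    refine Complex.ext (hre a ha') ?_
    have := hre ((-Complex.I) • a) (S.topologicalClosure.smul_mem _ ha')
    rw [map_smul] at this
    simpa using this
  have h3 := h1 0 S.topologicalClosure.zero_mem
  rw [h f h0] at h2
  simp at h2 h3
  linarith

/-! ### Weak derivatives, the Sobolev space and density of test functions. -/

/-- `g` is the weak derivative of `f` in the direction `i`. -/
def IsWeakDeriv (i : Option (Fin d)) (f g : L2 d) : Prop :=
  ∀ φ : Guide d → ℂ, IsTestFunction φ → ∫ p, f p * pderiv i φ p = - ∫ p, g p * φ p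

/-- The class in `L²` of a test function. -/
def IsTestFunction.toL2 {φ : Guide d → ℂ} (h : IsTestFunction φ) : L2 d := (h.memLp 2).toLp φ

theorem IsTestFunction.coeFn_toL2 {φ : Guide d → ℂ} (h : IsTestFunction φ) :
    h.toL2 =ᵐ[volume] φ := MemLp.coeFn_toLp _

theorem inner_toL2 {φ : Guide d → ℂ} (h : IsTestFunction φ) (f : L2 d) :
    ⟪h.toL2, f⟫_ℂ = ∫ p, star (φ p) * f p := by
  rw [inner_eq_integral]
  refine integral_congr_ae ?_
  filter_upwards [h.coeFn_toL2] with p hp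
  rw [hp]

/-- The inner product conjugates its first slot and the definition does not; stability of test
functions under conjugation reconciles the two. -/
theorem isWeakDeriv_iff {i : Option (Fin d)} {f g : L2 d} :
    IsWeakDeriv i f g ↔ ∀ (φ : Guide d → ℂ) (h : IsTestFunction φ),
      ⟪(h.pderiv i).toL2, f⟫_ℂ = -⟪h.toL2, g⟫_ℂ := by
  simp only [inner_toL2]
  constructor
  · intro H φ h
    have := H _ h.conj
    simpa only [pderiv_conj, mul_comm] using this
  · intro H φ h
    have := H _ h.conj
    simpa only [pderiv_conj, mul_comm, star_star] using this

theorem isWeakDeriv_toL2 {φ : Guide d → ℂ} (h : IsTestFunction φ) (i : Option (Fin d)) :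
    IsWeakDeriv i h.toL2 (h.pderiv i).toL2 := by
  intro ψ hψ
  have e1 : ∫ p, h.toL2 p * pderiv i ψ p = ∫ p, φ p * pderiv i ψ p := by
    refine integral_congr_ae ?_
    filter_upwards [h.coeFn_toL2] with p hp
    rw [hp]
  have e2 : ∫ p, (h.pderiv i).toL2 p * ψ p = ∫ p, pderiv i φ p * ψ p := by
    refine integral_congr_ae ?_
    filter_upwards [(h.pderiv i).coeFn_toL2] with p hp
    rw [hp]
  rw [e1, e2, integral_pderiv_mul h hψ]

/-- The Sobolev space `H¹(ℝ^d × 𝕋)` as a subspace of `L² × (L²)^{d+1}`. -/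
def Sob (d : ℕ) : Submodule ℂ (L2 d × (Option (Fin d) → L2 d)) where
  carrier := {w | ∀ i, IsWeakDeriv i w.1 (w.2 i)}
  add_mem' := by
    intro a b ha hb i
    rw [isWeakDeriv_iff]
    intro φ h
    simp only [Prod.fst_add, Prod.snd_add, Pi.add_apply, inner_add_right,
      isWeakDeriv_iff.1 (ha i) φ h, isWeakDeriv_iff.1 (hb i) φ h]
    ring
  zero_mem' := by
    intro i
    rw [isWeakDeriv_iff]
    simp
  smul_mem' := by
    intro c a ha i
    rw [isWeakDeriv_iff]
    intro φ h
    simp only [Prod.smul_fst, Prod.smul_snd, Pi.smul_apply, inner_smul_right,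
      isWeakDeriv_iff.1 (ha i) φ h]
    ring

/-- The underlying `L²` function. -/
def fnL : Sob d →L[ℂ] L2 d := (ContinuousLinearMap.fst ℂ _ _).comp (Sob d).subtypeL

/-- The weak derivative in the direction `i`. -/
def weakD (i : Option (Fin d)) : Sob d →L[ℂ] L2 d :=
  (ContinuousLinearMap.proj i).comp ((ContinuousLinearMap.snd ℂ _ _).comp (Sob d).subtypeL)

theorem isWeakDeriv_weakD (i : Option (Fin d)) (u : Sob d) : IsWeakDeriv i (fnL u) (weakD i u) :=
  u.2 i

theorem norm_fnL_le (u : Sob d) : ‖fnL u‖ ≤ ‖u‖ := norm_fst_le u.1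

theorem norm_weakD_le (i : Option (Fin d)) (u : Sob d) : ‖weakD i u‖ ≤ ‖u‖ :=
  (norm_le_pi_norm u.1.2 i).trans (norm_snd_le u.1)

/-- A test function as an element of the Sobolev space. -/
def IsTestFunction.toSob {φ : Guide d → ℂ} (h : IsTestFunction φ) : Sob d :=
  ⟨(h.toL2, fun i => (h.pderiv i).toL2), fun i => isWeakDeriv_toL2 h i⟩

@[simp] theorem fnL_toSob {φ : Guide d → ℂ} (h : IsTestFunction φ) : fnL h.toSob = h.toL2 := rfl

@[simp] theorem weakD_toSob {φ : Guide d → ℂ} (h : IsTestFunction φ) (i : Option (Fin d)) :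
    weakD i h.toSob = (h.pderiv i).toL2 := rfl

theorem toL2_congr {φ ψ : Guide d → ℂ} (h : IsTestFunction φ) (h' : IsTestFunction ψ)
    (e : φ = ψ) : h.toL2 = h'.toL2 := by
  subst e
  rfl

theorem toL2_add {φ ψ : Guide d → ℂ} (h : IsTestFunction φ) (h' : IsTestFunction ψ) :
    (h.add h').toL2 = h.toL2 + h'.toL2 := MemLp.toLp_add _ _

theorem toL2_smul {φ : Guide d → ℂ} (h : IsTestFunction φ) (c : ℂ) :
    (h.smul c).toL2 = c • h.toL2 := MemLp.toLp_const_smul c _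

theorem trans_toL2 {φ : Guide d → ℂ} (h : IsTestFunction φ) (z : Guide d) :
    trans z h.toL2 = (h.translate z).toL2 := by
  refine Lp.ext ?_
  filter_upwards [coeFn_trans z h.toL2, (h.translate z).coeFn_toL2,
    ae_translate h.coeFn_toL2 z] with p h1 h2 h3
  rw [h1, h2, h3]

/-- The subspace of test functions in `L² × (L²)^{d+1}`. -/
def testSubmodule (d : ℕ) : Submodule ℂ (L2 d × (Option (Fin d) → L2 d)) where
  carrier := {w | ∃ (φ : Guide d → ℂ) (h : IsTestFunction φ), w = h.toSob.1}
  add_mem' := by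
    rintro _ _ ⟨φ, h, rfl⟩ ⟨ψ, h', rfl⟩
    refine ⟨_, h.add h', ?_⟩
    refine Prod.ext (toL2_add h h').symm (funext fun i => ?_)
    rw [Prod.snd_add, Pi.add_apply]
    change (h.pderiv i).toL2 + (h'.pderiv i).toL2 = ((h.add h').pderiv i).toL2
    rw [← toL2_add]
    exact toL2_congr _ _ (funext fun p => (pderiv_add h h' i p).symm)
  zero_mem' := by
    have h0 := IsTestFunction.zero (d := d)
    refine ⟨_, h0.smul 0, ?_⟩
    refine Prod.ext ?_ (funext fun i => ?_)
    · exact ((toL2_smul h0 0).trans (zero_smul _ _)).symm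
    · refine Eq.symm ((toL2_congr ((h0.smul 0).pderiv i) ((h0.pderiv i).smul 0)
        (funext fun p => pderiv_smul h0 0 i p)).trans ?_)
      exact (toL2_smul (h0.pderiv i) 0).trans (zero_smul _ _)
  smul_mem' := by
    rintro c _ ⟨φ, h, rfl⟩
    refine ⟨_, h.smul c, ?_⟩
    refine Prod.ext (toL2_smul h c).symm (funext fun i => ?_)
    rw [Prod.smul_snd, Pi.smul_apply]
    change c • (h.pderiv i).toL2 = ((h.smul c).pderiv i).toL2
    rw [← toL2_smul]
    exact toL2_congr _ _ (funext fun p => (pderiv_smul h c i p).symm)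

theorem integral_mul_translate_weakD {i : Option (Fin d)} {f g : L2 d} (hfg : IsWeakDeriv i f g)
    {k : Guide d → ℂ} (hk : IsTestFunction k) (q : Guide d) :
    ∫ p, g p * k (p - q) = -∫ p, f p * pderiv i k (p - q) := by
  have := hfg _ (hk.translate (-q))
  simp only [pderiv_translate] at this
  simp only [← sub_eq_add_neg] at this
  rw [this, neg_neg]

/-- Test functions are dense in the Sobolev space. -/
theorem mem_closure_test (u : Sob d) :
    u ∈ closure {v : Sob d | ∃ (φ : Guide d → ℂ) (h : IsTestFunction φ), v = h.toSob} := by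
  rw [closure_subtype]
  have key : (u : L2 d × (Option (Fin d) → L2 d)) ∈ closure (testSubmodule d : Set _) := by
    -- By duality, a functional `f` vanishing on test functions must be shown to vanish at `u`. It
    -- is represented by a tuple of L² functions. Evaluated on the mollified tuple of `u`, it
    -- becomes the integral over p of `u` times the value of `f` at the test function q ↦ ρₙ(p - q),
    -- which is zero.
    refine mem_closure_of_forall_dual _ _ fun f hf => ?_
    let ψ₀ : L2 d := (InnerProductSpace.toDual ℂ (L2 d)).symm
      (f.comp (ContinuousLinearMap.inl ℂ _ _))
    let ψ : Option (Fin d) → L2 d := fun i => (InnerProductSpace.toDual ℂ (L2 d)).symm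
      ((f.comp (ContinuousLinearMap.inr ℂ _ _)).comp (ContinuousLinearMap.single ℂ (fun _ : Option (Fin d) => L2 d) i))
    have hrep : ∀ w : L2 d × (Option (Fin d) → L2 d),
        f w = ⟪ψ₀, w.1⟫_ℂ + ∑ i, ⟪ψ i, w.2 i⟫_ℂ := by
      intro w
      simp only [ψ₀, ψ, InnerProductSpace.toDual_symm_apply]
      have : w = ContinuousLinearMap.inl ℂ _ _ w.1 +
          ∑ i, ContinuousLinearMap.inr ℂ _ _ (ContinuousLinearMap.single ℂ _ i (w.2 i)) := by
        rw [← map_sum]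
        refine Prod.ext (by simp) ?_
        simp only [ContinuousLinearMap.inl_apply, ContinuousLinearMap.inr_apply, Prod.snd_add,
          zero_add]
        funext j
        simp [Finset.sum_apply, Pi.single_apply]
      conv_lhs => rw [this]
      rw [map_add, map_sum]
      rfl
    obtain ⟨ρ, hρ, hlim⟩ := exists_mollifier (d := d)
    have hzero : ∀ n, ⟪ψ₀, ∫ z, (ρ n z : ℂ) • trans z (fnL u)⟫_ℂ +
        ∑ i, ⟪ψ i, ∫ z, (ρ n z : ℂ) • trans z (weakD i u)⟫_ℂ = 0 := by
      intro n
      have h1 : ∀ i, ⟪ψ i, ∫ z, (ρ n z : ℂ) • trans z (weakD i u)⟫_ℂ =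
          ∫ p, fnL u p * ∫ q, star (ψ i q) * pderiv i (fun q => (ρ n (p - q) : ℂ)) q := by
        intro i
        rw [inner_mollify (hρ n)]
        simp only [integral_mul_translate_weakD (isWeakDeriv_weakD i u) (hρ n), mul_neg,
          integral_neg]
        rw [integral_mollify_swap ((hρ n).pderiv i), ← integral_neg]
        refine integral_congr_ae (Eventually.of_forall fun p => ?_)
        simp only [← mul_neg, ← integral_neg]
        congr 2
        funext q
        rw [pderiv_reflect i (fun z => (ρ n z : ℂ)) p q]
      simp only [h1]
      rw [inner_mollify (hρ n), integral_mollify_swap (hρ n)]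
      have hI : ∀ i, Integrable (fun p => fnL u p * ∫ q, star (ψ i q) *
          pderiv i (fun q => (ρ n (p - q) : ℂ)) q) := by
        intro i
        have := (integrable_mollify (f := fun q => star (ψ i q)) (Lp.memLp (ψ i)).star
          (Lp.memLp (fnL u)) ((hρ n).pderiv i)).integral_prod_left.neg
        refine this.congr (Eventually.of_forall fun p => ?_)
        simp only [Pi.neg_apply, ← integral_const_mul, ← integral_neg]
        congr 1
        funext q
        rw [pderiv_reflect i (fun z => (ρ n z : ℂ)) p q]
        ring
      have hI0 : Integrable (fun p => fnL u p * ∫ q, star (ψ₀ q) * (ρ n (p - q) : ℂ)) := by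
        have := (integrable_mollify (f := fun q => star (ψ₀ q)) (Lp.memLp ψ₀).star
          (Lp.memLp (fnL u)) (hρ n)).integral_prod_left
        refine this.congr (Eventually.of_forall fun p => ?_)
        simp only [← integral_const_mul]
        congr 1
        funext q
        ring
      rw [← integral_finsetSum _ fun i _ => hI i, ← integral_add hI0
        (integrable_finsetSum _ fun i _ => hI i)]
      refine integral_eq_zero_of_ae (Eventually.of_forall fun p => ?_)
      simp only [← Finset.mul_sum, ← mul_add, Pi.zero_apply]
      have h2 := hf _ ⟨_, (hρ n).reflect p, rfl⟩
      rw [hrep] at h2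
      have h3 : ∀ {k : Guide d → ℂ} (hk : IsTestFunction k) (χ : L2 d),
          ⟪χ, hk.toL2⟫_ℂ = ∫ q, star (χ q) * k q := by
        intro k hk χ
        rw [inner_eq_integral]
        refine integral_congr_ae ?_
        filter_upwards [hk.coeFn_toL2] with p hp
        rw [hp]
      have h4 : ⟪ψ₀, ((hρ n).reflect p).toL2⟫_ℂ +
        ∑ i, ⟪ψ i, (((hρ n).reflect p).pderiv i).toL2⟫_ℂ = 0 := h2
      simp only [h3] at h4
      rw [h4, mul_zero]
    have hl : Tendsto (fun n => ⟪ψ₀, ∫ z, (ρ n z : ℂ) • trans z (fnL u)⟫_ℂ +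
        ∑ i, ⟪ψ i, ∫ z, (ρ n z : ℂ) • trans z (weakD i u)⟫_ℂ) atTop
        (𝓝 (⟪ψ₀, fnL u⟫_ℂ + ∑ i, ⟪ψ i, weakD i u⟫_ℂ)) :=
      (tendsto_const_nhds.inner (hlim _)).add
        (tendsto_finsetSum _ fun i _ => tendsto_const_nhds.inner (hlim _))
    simp only [hzero] at hl
    rw [hrep]
    exact (tendsto_nhds_unique hl tendsto_const_nhds)
  refine closure_mono ?_ key
  rintro _ ⟨φ, h, rfl⟩
  exact ⟨h.toSob, ⟨φ, h, rfl⟩, rfl⟩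

/-- The values of a mollification of `g` are pairings of `g` with translated test functions, hence
zero; pairing `g` with its mollifications gives ‖g‖² = 0 in the limit. -/
theorem eq_zero_of_forall_test {g : L2 d}
    (hg : ∀ (φ : Guide d → ℂ) (h : IsTestFunction φ), ⟪h.toL2, g⟫_ℂ = 0) : g = 0 := by
  obtain ⟨ρ, hρ, hlim⟩ := exists_mollifier (d := d)
  have h0 : ∀ n, ⟪g, ∫ z, (ρ n z : ℂ) • trans z g⟫_ℂ = 0 := by
    intro n
    rw [inner_mollify (hρ n)]
    refine integral_eq_zero_of_ae (Eventually.of_forall fun q => ?_)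
    have := hg _ ((hρ n).translate (-q)).conj
    simp only [inner_toL2, star_star, ← sub_eq_add_neg] at this
    simp only [Pi.zero_apply, mul_comm (g _)]
    rw [this, mul_zero]
  have hl := (tendsto_const_nhds (x := g)).inner (𝕜 := ℂ) (hlim g)
  simp only [h0] at hl
  exact inner_self_eq_zero.1 (tendsto_nhds_unique tendsto_const_nhds hl).symm

/-! ### Difference quotients and their relation to weak derivatives. -/

theorem hasDerivAt_inner_trans {i : Option (Fin d)} {f g : L2 d} (hfg : IsWeakDeriv i f g)
    {φ : Guide d → ℂ} (h : IsTestFunction φ) (s : ℝ) :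
    HasDerivAt (fun s => ⟪h.toL2, trans (shift i s) f⟫_ℂ) ⟪h.toL2, trans (shift i s) g⟫_ℂ s := by
  have e : ∀ (s : ℝ) (f : L2 d), ⟪h.toL2, trans (shift i s) f⟫_ℂ =
      ∫ p, f p * star (φ (p + shift i (-s))) := by
    intro s f
    rw [← neg_neg (shift i s), ← inner_trans_left, ← shift_neg, trans_toL2, inner_toL2]
    simp only [mul_comm]
  simp only [e]
  have h1 := (hasDerivAt_integral_translate (g := f)
    ((Lp.memLp f).locallyIntegrable (by norm_num)) h.conj i (-s)).scomp s (hasDerivAt_neg s)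
  have h2 := hfg _ (h.conj.translate (shift i (-s)))
  simp only [pderiv_translate i (fun p => star (φ p))] at h2
  rw [h2] at h1
  simpa [Function.comp_def] using h1

/-- Paired with a test function this is the fundamental theorem of calculus, and such pairings
determine an L² function. It exhibits a difference quotient as an average of translates of the weak
derivative. -/
theorem trans_shift_sub {i : Option (Fin d)} {f g : L2 d} (hfg : IsWeakDeriv i f g) (s : ℝ) :
    trans (shift i s) f - f = ∫ σ in (0 : ℝ)..s, trans (shift i σ) g := by
  rw [← sub_eq_zero]
  refine eq_zero_of_forall_test fun φ h => ?_
  have hc : Continuous fun σ : ℝ => trans (shift i σ) g :=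
    (continuous_trans g).comp (continuous_shift i)
  have h1 : ∫ σ in (0 : ℝ)..s, ⟪h.toL2, trans (shift i σ) g⟫_ℂ =
      ⟪h.toL2, ∫ σ in (0 : ℝ)..s, trans (shift i σ) g⟫_ℂ :=
    (innerSL ℂ h.toL2).intervalIntegral_comp_comm (hc.intervalIntegrable 0 s)
  rw [inner_sub_right, ← h1, intervalIntegral.integral_eq_sub_of_hasDerivAt
    (fun σ _ => hasDerivAt_inner_trans hfg h σ)
    ((continuous_const.inner hc).intervalIntegrable 0 s)]
  simp [inner_sub_right]

theorem hasDerivAt_trans_shift {i : Option (Fin d)} {f g : L2 d} (hfg : IsWeakDeriv i f g) :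
    HasDerivAt (fun s => trans (shift i s) f) g 0 := by
  have hc : Continuous fun σ : ℝ => trans (shift i σ) g :=
    (continuous_trans g).comp (continuous_shift i)
  have h1 := intervalIntegral.integral_hasDerivAt_right (hc.intervalIntegrable 0 0)
    (hc.stronglyMeasurableAtFilter _ _) hc.continuousAt
  rw [shift_zero, trans_zero] at h1
  refine (h1.add_const f).congr_of_eventuallyEq (Eventually.of_forall fun s => ?_)
  simp [← trans_shift_sub hfg]

/-- The difference quotient in the direction `i`. -/
def diffQ (i : Option (Fin d)) (s : ℝ) (f : L2 d) : L2 d :=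
  (s⁻¹ : ℂ) • (trans (shift i s) f - f)

theorem tendsto_diffQ {i : Option (Fin d)} {f g : L2 d} (hfg : IsWeakDeriv i f g) :
    Tendsto (fun s => diffQ i s f) (𝓝[≠] 0) (𝓝 g) := by
  have := hasDerivAt_iff_tendsto_slope_zero.1 (hasDerivAt_trans_shift hfg)
  refine this.congr fun s => ?_
  simp only [zero_add, shift_zero, trans_zero, diffQ]
  rw [← Complex.ofReal_inv]
  exact RCLike.real_smul_eq_coe_smul (K := ℂ) _ _

theorem norm_diffQ_le {i : Option (Fin d)} {f g : L2 d} (hfg : IsWeakDeriv i f g) (s : ℝ) :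
    ‖diffQ i s f‖ ≤ ‖g‖ := by
  rcases eq_or_ne s 0 with rfl | hs
  · simp [diffQ]
  rw [diffQ, norm_smul, trans_shift_sub hfg]
  have := intervalIntegral.norm_integral_le_of_norm_le_const (a := 0) (b := s) (C := ‖g‖)
    (f := fun σ => trans (shift i σ) g) fun σ _ => ((trans _).norm_map g).le
  rw [sub_zero] at this
  calc _ ≤ ‖(s⁻¹ : ℂ)‖ * (‖g‖ * |s|) := by gcongr
    _ = ‖g‖ := by
      rw [norm_inv, Complex.norm_real, Real.norm_eq_abs]
      field_simp

theorem inner_diffQ_left (i : Option (Fin d)) (s : ℝ) (f g : L2 d) :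
    ⟪diffQ i s f, g⟫_ℂ = -⟪f, diffQ i (-s) g⟫_ℂ := by
  simp only [diffQ, inner_smul_left, inner_smul_right, inner_sub_left, inner_sub_right,
    inner_trans_left, shift_neg]
  simp

/-- By Banach–Alaoglu, bounded difference quotients converge weakly along an ultrafilter finer than
s → 0. Moving the difference quotient onto the test function identifies the limit as a weak
derivative. -/
theorem exists_isWeakDeriv {i : Option (Fin d)} {f : L2 d} {C : ℝ}
    (hC : ∀ s, ‖diffQ i s f‖ ≤ C) : ∃ g, IsWeakDeriv i f g := by
  let F : ℝ → WeakDual ℂ (L2 d) := fun s =>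
    StrongDual.toWeakDual (InnerProductSpace.toDual ℂ (L2 d) (diffQ i s f))
  let U : Ultrafilter ℝ := Ultrafilter.of (𝓝[≠] 0)
  have hU : (U : Filter ℝ) ≤ 𝓝[≠] 0 := Ultrafilter.of_le _
  have hK := WeakDual.isCompact_closedBall (𝕜 := ℂ) (0 : StrongDual ℂ (L2 d)) C
  obtain ⟨ℓ, -, hℓ⟩ := hK.ultrafilter_le_nhds (U.map F) (by
    rw [Ultrafilter.coe_map, le_principal_iff]
    refine Filter.mem_map.2 (Eventually.of_forall fun s => ?_)
    simpa [F] using hC s)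
  have hlim : ∀ g : L2 d, Tendsto (fun s => ⟪diffQ i s f, g⟫_ℂ) U (𝓝 (ℓ g)) := fun g =>
    ((WeakDual.eval_continuous g).tendsto ℓ).comp hℓ
  refine ⟨(InnerProductSpace.toDual ℂ (L2 d)).symm (WeakDual.toStrongDual ℓ),
    isWeakDeriv_iff.2 fun φ h => ?_⟩
  have h1 : Tendsto (fun s => ⟪diffQ i s f, h.toL2⟫_ℂ) U (𝓝 (-⟪f, (h.pderiv i).toL2⟫_ℂ)) := by
    simp only [inner_diffQ_left]
    have h2 : Tendsto (fun s : ℝ => diffQ i (-s) h.toL2) (𝓝[≠] 0) (𝓝 (h.pderiv i).toL2) := by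
      refine (tendsto_diffQ (isWeakDeriv_toL2 h i)).comp ?_
      refine tendsto_nhdsWithin_iff.2 ⟨?_, ?_⟩
      · have : Tendsto (fun s : ℝ => -s) (𝓝 0) (𝓝 0) := by simpa using tendsto_neg (0 : ℝ)
        exact this.mono_left nhdsWithin_le_nhds
      · filter_upwards [self_mem_nhdsWithin] with s hs
        simpa using hs
    exact (tendsto_const_nhds.inner (h2.mono_left hU)).neg
  have h3 := tendsto_nhds_unique (hlim h.toL2) h1
  have h4 : ⟪(InnerProductSpace.toDual ℂ (L2 d)).symm (WeakDual.toStrongDual ℓ), h.toL2⟫_ℂ =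
      ℓ h.toL2 := InnerProductSpace.toDual_symm_apply
  rw [← inner_conj_symm, ← inner_conj_symm h.toL2, h4, h3]
  simp

theorem trans_compLp {F : ℂ → ℂ} {c : NNReal} (hF : LipschitzWith c F) (F0 : F 0 = 0)
    (z : Guide d) (f : L2 d) : trans z (hF.compLp F0 f) = hF.compLp F0 (trans z f) := by
  refine Lp.ext ?_
  filter_upwards [coeFn_trans z (hF.compLp F0 f), hF.coeFn_compLp F0 (trans z f), coeFn_trans z f,
    ae_translate (hF.coeFn_compLp F0 f) z] with p h1 h2 h3 h4
  rw [h1, h2, Function.comp_apply, h3, h4, Function.comp_apply]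

/-- Lipschitz functions act on the Sobolev space. -/
theorem exists_sob_compLp {F : ℂ → ℂ} {c : NNReal} (hF : LipschitzWith c F) (F0 : F 0 = 0)
    (u : Sob d) : ∃ v : Sob d, fnL v = hF.compLp F0 (fnL u) := by
  have h : ∀ i, ∃ g, IsWeakDeriv i (hF.compLp F0 (fnL u)) g := by
    intro i
    -- Translation commutes with composition, so a difference quotient of F ∘ u has norm at most c
    -- times that of `u`.
    refine exists_isWeakDeriv (C := c * ‖weakD i u‖) fun s => ?_
    refine le_trans ?_ (mul_le_mul_of_nonneg_left
      (norm_diffQ_le (isWeakDeriv_weakD i u) s) c.coe_nonneg)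
    simp only [diffQ, norm_smul, trans_compLp]
    calc _ ≤ ‖(s⁻¹ : ℂ)‖ * (c * ‖trans (shift i s) (fnL u) - fnL u‖) := by
          gcongr
          exact hF.norm_compLp_sub_le F0 _ _
      _ = _ := by ring
  choose g hg using h
  exact ⟨⟨(_, g), hg⟩, rfl⟩

/-! ### The Sobolev inequality on ℝ^d × 𝕋. -/

instance : (volume : Measure (Space d × ℝ)).IsAddHaarMeasure :=
  inferInstanceAs ((volume : Measure (Space d)).prod (volume : Measure ℝ)).IsAddHaarMeasure

theorem setLIntegral_cover {H : Guide d → ℝ≥0∞} (hH : Measurable H) (t : ℝ) :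
    ∫⁻ q in (univ : Set (Space d)) ×ˢ Ioc t (t + 2 * Real.pi), H (cover q) = ∫⁻ p, H p := by
  have hHc : Measurable fun q : Space d × ℝ => H (cover q) := hH.comp continuous_cover.measurable
  rw [Measure.volume_eq_prod, ← Measure.prod_restrict, Measure.restrict_univ,
    lintegral_prod _ hHc.aemeasurable,
    Measure.volume_eq_prod, lintegral_prod _ hH.aemeasurable]
  congr 1
  funext x
  exact AddCircle.lintegral_preimage (2 * Real.pi) t fun y => H (x, y)

theorem lintegral_cover_Icc_le {H : Guide d → ℝ≥0∞} (hH : Measurable H) :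
    ∫⁻ q in (univ : Set (Space d)) ×ˢ Icc (-(2 * Real.pi)) (2 * Real.pi), H (cover q) ≤
      3 * ∫⁻ p, H p := by
  -- Two half-open periods miss the left endpoint -2π of the closed window; the third one is there
  -- to cover it.
  have hsub : (univ : Set (Space d)) ×ˢ Icc (-(2 * Real.pi)) (2 * Real.pi) ⊆
      (univ ×ˢ Ioc (-(4 * Real.pi)) (-(4 * Real.pi) + 2 * Real.pi)) ∪
      ((univ ×ˢ Ioc (-(2 * Real.pi)) (-(2 * Real.pi) + 2 * Real.pi)) ∪
      (univ ×ˢ Ioc 0 (0 + 2 * Real.pi))) := by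
    rintro ⟨x, y⟩ ⟨-, hy1, hy2⟩
    have := Real.pi_pos
    simp only [mem_union, mem_prod, mem_univ, true_and, mem_Ioc]
    simp only at hy1 hy2
    rcases lt_or_ge 0 y with h | h
    · right; right; constructor <;> linarith
    · rcases eq_or_lt_of_le hy1 with h' | h'
      · left; constructor <;> linarith
      · right; left; constructor <;> linarith
  calc _ ≤ _ := lintegral_mono_set hsub
    _ ≤ _ := lintegral_union_le _ _ _
    _ ≤ _ := add_le_add_right (lintegral_union_le _ _ _) _
    _ = 3 * ∫⁻ p, H p := by
      simp only [setLIntegral_cover hH]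
      ring

theorem norm_fderiv_cover_le {φ : Guide d → ℂ} (h : IsTestFunction φ) (q : Space d × ℝ) :
    ‖fderiv ℝ (φ ∘ cover) q‖ ≤ ∑ i, ‖pderiv i φ (cover q)‖ := by
  refine ContinuousLinearMap.opNorm_le_bound _ (Finset.sum_nonneg fun _ _ => norm_nonneg _) ?_
  rintro ⟨x, y⟩
  have hx : ((x, y) : Space d × ℝ) = y • basisDir none + ∑ j, x j • basisDir (some j) := by
    refine Prod.ext ?_ ?_
    · simp only [basisDir, Prod.fst_add, Prod.smul_fst, smul_zero, zero_add, Prod.fst_sum]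
      ext k
      simp [Pi.single_apply]
    · simp [basisDir, Prod.snd_sum]
  conv_lhs => rw [hx]
  rw [map_add, map_sum, Fintype.sum_option, add_mul, Finset.sum_mul]
  refine (norm_add_le _ _).trans (add_le_add ?_ ((norm_sum_le _ _).trans
    (Finset.sum_le_sum fun j _ => ?_)))
  · rw [map_smul, norm_smul, h.pderiv_cover, mul_comm]
    gcongr
    exact norm_snd_le (x, y)
  · rw [map_smul, norm_smul, h.pderiv_cover, mul_comm]
    gcongr
    exact (PiLp.norm_apply_le x j).trans (norm_fst_le (x, y))

/-- Cutoff in the periodic variable. -/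
def cutoff : ContDiffBump (0 : ℝ) :=
  ⟨Real.pi, 2 * Real.pi, Real.pi_pos, by linarith [Real.pi_pos]⟩

theorem exists_cutoff_deriv_bound : ∃ C : ℝ, 0 ≤ C ∧ ∀ t : ℝ, ‖deriv cutoff t‖ ≤ C := by
  have hc : Continuous (deriv cutoff) := cutoff.contDiff.continuous_deriv (n := 1) le_rfl
  obtain ⟨C, hC⟩ := cutoff.hasCompactSupport.deriv.exists_bound_of_continuous hc
  exact ⟨C, (norm_nonneg _).trans (hC 0), hC⟩

/-- The Gagliardo–Nirenberg–Sobolev inequality for powers of test functions. -/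
theorem exists_lintegral_rpow_le {γ : ℝ} (hγ : 1 < γ) (hd : 1 ≤ d) : ∃ C : ℝ≥0∞, C ≠ ⊤ ∧
    ∀ φ : Guide d → ℂ, IsTestFunction φ → ∫⁻ p, ‖φ p‖ₑ ^ (γ * ((d + 1) / d)) ≤
      C * (∫⁻ p, (‖φ p‖ₑ ^ (γ - 1) * ∑ i, ‖pderiv i φ p‖ₑ + ‖φ p‖ₑ ^ (γ - 1) * ‖φ p‖ₑ)) ^
        ((d + 1 : ℝ) / d) := by
  obtain ⟨Cη, hCη0, hCη⟩ := exists_cutoff_deriv_bound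
  have hd' : (0 : ℝ) < d := by exact_mod_cast hd
  -- The exponent conjugate to the dimension d + 1, as in the L¹ Gagliardo–Nirenberg–Sobolev
  -- inequality on ℝ^{d+1}.
  let r : NNReal := (d + 1) / d
  have hr : (r : ℝ) = (d + 1) / d := by simp [r]
  have hr0 : (0 : ℝ) < r := by rw [hr]; positivity
  have hconj : NNReal.HolderConjugate (Module.finrank ℝ (Space d × ℝ)) r := by
    rw [NNReal.holderConjugate_iff]
    have : Module.finrank ℝ (Space d × ℝ) = d + 1 := by simp
    rw [this]
    constructor
    · have : (1 : ℝ) < ((d + 1 : ℕ) : NNReal) := by push_cast; linarith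
      exact_mod_cast this
    · rw [← NNReal.coe_inj]
      push_cast
      rw [hr]
      field_simp
      try ring
  let K : ℝ≥0∞ := (eLpNormLESNormFDerivOneConst (volume : Measure (Space d × ℝ)) r : ℝ≥0∞)
  -- γ comes from differentiating |Φ|^γ and Cη from differentiating the cutoff; the factor 3 in the
  -- constant counts the periods needed to cover the cutoff's support.
  obtain ⟨A, hAdef⟩ : ∃ A : ℝ, A = γ + Cη := ⟨_, rfl⟩
  refine ⟨(K * (ENNReal.ofReal A * 3)) ^ (r : ℝ), by
    refine ENNReal.rpow_ne_top_of_nonneg hr0.le ?_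
    exact ENNReal.mul_ne_top ENNReal.coe_ne_top (ENNReal.mul_ne_top ENNReal.ofReal_ne_top (by simp)),
    fun φ hφ => ?_⟩
  let H : Guide d → ℝ≥0∞ := fun p =>
    ‖φ p‖ₑ ^ (γ - 1) * ∑ i, ‖pderiv i φ p‖ₑ + ‖φ p‖ₑ ^ (γ - 1) * ‖φ p‖ₑ
  have hφm : Measurable fun p => ‖φ p‖ₑ := hφ.continuous.enorm.measurable
  have hHm : Measurable H := by
    refine Measurable.add (Measurable.mul (hφm.pow_const _) ?_) ((hφm.pow_const _).mul hφm)
    exact Finset.measurable_sum _ fun i _ => (hφ.pderiv i).continuous.enorm.measurable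
  have hHc : Measurable fun q : Space d × ℝ => H (cover q) := hHm.comp continuous_cover.measurable
  let Φ := φ ∘ (cover (d := d))
  -- A periodic lift is not compactly supported, so |Φ|^γ is cut off in y. The cutoff is 1 on the
  -- full period (-π, π], hence the L^r norm of ψ still controls the integral over ℝ^d × 𝕋; γ > 1
  -- makes |Φ|^γ continuously differentiable.
  let ψ : Space d × ℝ → ℝ := fun q => cutoff q.2 * ‖Φ q‖ ^ γ
  have hΦ : Differentiable ℝ Φ := hφ.contDiff.differentiable (by simp)
  have hN : ContDiff ℝ 1 fun q => ‖Φ q‖ ^ γ :=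
    (contDiff_norm_rpow hγ).comp (hφ.contDiff.of_le (by simp))
  have hη : ContDiff ℝ 1 fun q : Space d × ℝ => cutoff q.2 :=
    (cutoff.contDiff (n := 1)).comp contDiff_snd
  have hψ : ContDiff ℝ 1 ψ := hη.mul hN
  have hsupp : ∀ q : Space d × ℝ, q.2 ∉ Icc (-(2 * Real.pi)) (2 * Real.pi) → cutoff q.2 = 0 := by
    intro q hq
    refine cutoff.zero_of_le_dist ?_
    rw [Real.dist_eq, sub_zero]
    by_contra! hlt
    exact hq (abs_le.1 hlt.le)
  have hcs : HasCompactSupport ψ := by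
    refine HasCompactSupport.intro ((hφ.compact.image continuous_fst).prod
      (isCompact_Icc (a := -(2 * Real.pi)) (b := 2 * Real.pi))) fun q hq => ?_
    by_cases hy : q.2 ∈ Icc (-(2 * Real.pi)) (2 * Real.pi)
    · have : cover q ∉ tsupport φ := fun h => hq ⟨⟨_, h, rfl⟩, hy⟩
      have h0 : Φ q = 0 := image_eq_zero_of_notMem_tsupport (f := φ) this
      simp [ψ, h0, Real.zero_rpow (by linarith : γ ≠ 0)]
    · simp [ψ, hsupp q hy]
  have hmain := eLpNorm_le_eLpNorm_fderiv_one (volume : Measure (Space d × ℝ)) hψ hcs hconj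
  have hgrad : ∀ q, ‖fderiv ℝ ψ q‖ₑ ≤ ((univ : Set (Space d)) ×ˢ
      Icc (-(2 * Real.pi)) (2 * Real.pi)).indicator
      (fun q => ENNReal.ofReal A * H (cover q)) q := by
    intro q
    by_cases hy : q ∈ (univ : Set (Space d)) ×ˢ Icc (-(2 * Real.pi)) (2 * Real.pi)
    · rw [indicator_of_mem hy]
      have h1 : fderiv ℝ ψ q = cutoff q.2 • fderiv ℝ (fun q => ‖Φ q‖ ^ γ) q +
          ‖Φ q‖ ^ γ • fderiv ℝ (fun q : Space d × ℝ => cutoff q.2) q :=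
        fderiv_fun_mul (hη.differentiable one_ne_zero q) (hN.differentiable one_ne_zero q)
      have h2 : ‖fderiv ℝ (fun q : Space d × ℝ => cutoff q.2) q‖ ≤ Cη := by
        have := ((cutoff.contDiff (n := 1)).differentiable one_ne_zero q.2).hasDerivAt.comp_hasFDerivAt
          q (hasFDerivAt_snd (𝕜 := ℝ) (E := Space d) (F := ℝ) (p := q))
        have e : fderiv ℝ (fun q : Space d × ℝ => cutoff q.2) q = _ := this.fderiv
        rw [e, norm_smul]
        calc _ ≤ Cη * 1 := by
              gcongr
              · exact hCη _
              · exact ContinuousLinearMap.norm_snd_le ℝ _ _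
          _ = Cη := mul_one _
      have h3 : ‖fderiv ℝ (fun q => ‖Φ q‖ ^ γ) q‖ ≤ γ * ‖Φ q‖ ^ (γ - 1) * ‖fderiv ℝ Φ q‖ :=
        norm_fderiv_norm_rpow_le hΦ hγ
      have h4 : ‖Φ q‖ ^ γ = ‖Φ q‖ ^ (γ - 1) * ‖Φ q‖ := by
        rcases eq_or_ne ‖Φ q‖ 0 with h0 | h0
        · rw [h0, Real.zero_rpow (by linarith), mul_zero]
        · rw [← Real.rpow_add_one h0, sub_add_cancel]
      have h5 := norm_fderiv_cover_le hφ q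
      have hnn : 0 ≤ ‖Φ q‖ ^ (γ - 1) := Real.rpow_nonneg (norm_nonneg _) _
      have h6 : ‖fderiv ℝ ψ q‖ ≤ A * (‖Φ q‖ ^ (γ - 1) * ∑ i, ‖pderiv i φ (cover q)‖ +
          ‖Φ q‖ ^ (γ - 1) * ‖Φ q‖) := by
        rw [h1]
        have hS : 0 ≤ ∑ i, ‖pderiv i φ (cover q)‖ := Finset.sum_nonneg fun _ _ => norm_nonneg _
        calc _ ≤ ‖cutoff q.2‖ * ‖fderiv ℝ (fun q => ‖Φ q‖ ^ γ) q‖ +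
              ‖‖Φ q‖ ^ γ‖ * ‖fderiv ℝ (fun q : Space d × ℝ => cutoff q.2) q‖ := by
              refine (norm_add_le _ _).trans ?_
              rw [norm_smul, norm_smul]
          _ ≤ 1 * (γ * ‖Φ q‖ ^ (γ - 1) * ∑ i, ‖pderiv i φ (cover q)‖) +
              (‖Φ q‖ ^ (γ - 1) * ‖Φ q‖) * Cη := by
              refine add_le_add ?_ ?_
              · refine mul_le_mul ?_ (h3.trans (by gcongr)) (norm_nonneg _) zero_le_one
                rw [Real.norm_eq_abs, abs_of_nonneg cutoff.nonneg]
                exact cutoff.le_one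
              · rw [h4, Real.norm_eq_abs, abs_of_nonneg (by positivity)]
                gcongr
          _ ≤ _ := by
              have e1 : 0 ≤ ‖Φ q‖ ^ (γ - 1) * ∑ i, ‖pderiv i φ (cover q)‖ := by positivity
              have e2 : 0 ≤ ‖Φ q‖ ^ (γ - 1) * ‖Φ q‖ := by positivity
              rw [hAdef]
              nlinarith [mul_nonneg hCη0 e1, mul_nonneg (by linarith : (0 : ℝ) ≤ γ) e2]
      have hA : 0 ≤ A := by rw [hAdef]; linarith
      rw [← ofReal_norm]
      refine (ENNReal.ofReal_le_ofReal h6).trans (le_of_eq ?_)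
      rw [ENNReal.ofReal_mul hA, ENNReal.ofReal_add (by positivity) (by positivity),
        ENNReal.ofReal_mul hnn, ENNReal.ofReal_mul hnn,
        ENNReal.ofReal_sum_of_nonneg fun _ _ => norm_nonneg _,
        ← ENNReal.ofReal_rpow_of_nonneg (norm_nonneg _) (by linarith)]
      simp only [ofReal_norm, H]
      rfl
    · rw [indicator_of_notMem hy]
      have : q ∉ tsupport ψ := by
        have hsub : tsupport ψ ⊆ (univ : Set (Space d)) ×ˢ
            Icc (-(2 * Real.pi)) (2 * Real.pi) := by
          refine closure_minimal ?_ (isClosed_univ.prod isClosed_Icc)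
          intro q hq
          refine ⟨mem_univ _, ?_⟩
          by_contra hq'
          exact hq (by simp [ψ, hsupp q hq'])
        exact fun h => hy (hsub h)
      have h0 : fderiv ℝ ψ q = 0 :=
        image_eq_zero_of_notMem_tsupport fun h => this (tsupport_fderiv_subset ℝ h)
      rw [h0, ← ofReal_norm, norm_zero, ENNReal.ofReal_zero]
  have hL1 : eLpNorm (fderiv ℝ ψ) 1 volume ≤ ENNReal.ofReal A * 3 * ∫⁻ p, H p := by
    rw [eLpNorm_one_eq_lintegral_enorm]
    refine (lintegral_mono hgrad).trans ?_
    rw [lintegral_indicator (MeasurableSet.univ.prod measurableSet_Icc),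
      lintegral_const_mul _ hHc, mul_assoc]
    gcongr
    exact lintegral_cover_Icc_le hHm
  have hlow : ∫⁻ p, ‖φ p‖ₑ ^ (γ * ((d + 1) / d)) ≤ (eLpNorm ψ r volume) ^ (r : ℝ) := by
    rw [eLpNorm_nnreal_pow_eq_lintegral (by exact_mod_cast hr0.ne'),
      ← setLIntegral_cover (hφm.pow_const _) (-Real.pi)]
    refine le_trans (setLIntegral_mono' (MeasurableSet.univ.prod measurableSet_Ioc) ?_)
      (setLIntegral_le_lintegral _ _)
    rintro q ⟨-, hq1, hq2⟩
    have h1 : cutoff q.2 = 1 := by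
      refine cutoff.one_of_mem_closedBall ?_
      rw [Metric.mem_closedBall, Real.dist_eq, sub_zero, abs_le]
      constructor
      · exact hq1.le
      · change q.2 ≤ Real.pi
        linarith
    have h2 : ‖ψ q‖ₑ = ‖φ (cover q)‖ₑ ^ γ := by
      simp only [ψ, h1, one_mul]
      rw [Real.enorm_rpow_of_nonneg (norm_nonneg _) (by linarith), enorm_norm]
      rfl
    rw [h2, ← ENNReal.rpow_mul, hr]
  calc _ ≤ _ := hlow
    _ ≤ (K * (ENNReal.ofReal A * 3 * ∫⁻ p, H p)) ^ (r : ℝ) := by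
      gcongr
      exact hmain.trans (by gcongr)
    _ = _ := by
      rw [← mul_assoc, ENNReal.mul_rpow_of_nonneg _ _ hr0.le, ← hr]

theorem lintegral_enorm_sq (f : L2 d) : ∫⁻ p, ‖f p‖ₑ ^ (2 : ℝ) = ‖f‖ₑ ^ (2 : ℝ) := by
  rw [Lp.enorm_def, eLpNorm_eq_lintegral_rpow_enorm_toReal (by simp) (by simp), ← ENNReal.rpow_mul]
  simp

theorem lintegral_enorm_sq_test {φ : Guide d → ℂ} (h : IsTestFunction φ) :
    ∫⁻ p, ‖φ p‖ₑ ^ (2 : ℝ) = ‖h.toL2‖ₑ ^ (2 : ℝ) := by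
  rw [← lintegral_enorm_sq]
  refine lintegral_congr_ae ?_
  filter_upwards [h.coeFn_toL2] with p hp
  rw [hp]

theorem enorm_fnL_le (u : Sob d) : ‖fnL u‖ₑ ≤ ‖u‖ₑ := by
  rw [← ofReal_norm, ← ofReal_norm]
  exact ENNReal.ofReal_le_ofReal (norm_fnL_le u)

theorem enorm_weakD_le (i : Option (Fin d)) (u : Sob d) : ‖weakD i u‖ₑ ≤ ‖u‖ₑ := by
  rw [← ofReal_norm, ← ofReal_norm]
  exact ENNReal.ofReal_le_ofReal (norm_weakD_le i u)

theorem IsTestFunction.enorm_measurable {φ : Guide d → ℂ} (h : IsTestFunction φ) :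
    Measurable fun p => ‖φ p‖ₑ := h.continuous.enorm.measurable

theorem lintegral_mul_test_le {φ ψ : Guide d → ℂ} (h : IsTestFunction φ) (h' : IsTestFunction ψ)
    (b : ℝ) : ∫⁻ p, ‖φ p‖ₑ ^ b * ‖ψ p‖ₑ ≤
      (∫⁻ p, ‖φ p‖ₑ ^ (2 * b)) ^ (1 / 2 : ℝ) * ‖h'.toL2‖ₑ := by
  refine (ENNReal.lintegral_mul_le_Lp_mul_Lq volume Real.HolderConjugate.two_two
    (h.enorm_measurable.pow_const b).aemeasurable h'.enorm_measurable.aemeasurable).trans ?_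
  rw [lintegral_enorm_sq_test h', ← ENNReal.rpow_mul (‖h'.toL2‖ₑ)]
  simp only [← ENNReal.rpow_mul, mul_comm b 2]
  norm_num

/-- A uniform `L^P` bound for test functions in the unit ball of `H¹`. -/
def HasSobolevBound (d : ℕ) (P : ℝ) : Prop := ∃ C : ℝ≥0∞, C ≠ ⊤ ∧
  ∀ (φ : Guide d → ℂ) (h : IsTestFunction φ), ‖h.toSob‖ₑ ≤ 1 → ∫⁻ p, ‖φ p‖ₑ ^ P ≤ C

theorem hasSobolevBound_two : HasSobolevBound d 2 := by
  refine ⟨1, ENNReal.one_ne_top, fun φ h h1 => ?_⟩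
  rw [lintegral_enorm_sq_test h]
  exact ENNReal.rpow_le_one ((enorm_fnL_le h.toSob).trans h1) (by norm_num)

theorem rpow_le_add_rpow (x : ℝ≥0∞) {a b c : ℝ} (h1 : a ≤ b) (h2 : b ≤ c) :
    x ^ b ≤ x ^ a + x ^ c := by
  rcases le_total x 1 with h | h
  · exact (ENNReal.rpow_le_rpow_of_exponent_ge h h1).trans le_self_add
  · exact (ENNReal.rpow_le_rpow_of_exponent_le h h2).trans le_add_self

theorem HasSobolevBound.mono {P P' : ℝ} (h : HasSobolevBound d P) (h2 : 2 ≤ P') (hP : P' ≤ P) :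
    HasSobolevBound d P' := by
  obtain ⟨C, hC, hb⟩ := h
  obtain ⟨C', hC', hb'⟩ := hasSobolevBound_two (d := d)
  refine ⟨C' + C, ENNReal.add_ne_top.2 ⟨hC', hC⟩, fun φ hφ h1 => ?_⟩
  calc _ ≤ ∫⁻ p, (‖φ p‖ₑ ^ (2 : ℝ) + ‖φ p‖ₑ ^ P) :=
        lintegral_mono fun p => rpow_le_add_rpow _ h2 hP
    _ = _ := lintegral_add_left (hφ.enorm_measurable.pow_const _) _
    _ ≤ _ := add_le_add (hb' φ hφ h1) (hb φ hφ h1)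

/-- With γ = P/2 + 1 the weight |φ|^{γ-1} = |φ|^{P/2} is square integrable by the L^P bound, so
Cauchy–Schwarz against ∂φ and φ controls the right-hand side of the Gagliardo–Nirenberg–Sobolev
inequality. -/
theorem HasSobolevBound.step (hd : 1 ≤ d) {P : ℝ} (h : HasSobolevBound d P) (h2 : 2 ≤ P) :
    HasSobolevBound d ((P / 2 + 1) * ((d + 1) / d)) := by
  obtain ⟨C, hC, hb⟩ := h
  obtain ⟨K, hK, hk⟩ := exists_lintegral_rpow_le (γ := P / 2 + 1) (by linarith) hd
  refine ⟨K * ((d + 2) * C ^ (1 / 2 : ℝ)) ^ ((d + 1 : ℝ) / d), ?_, fun φ hφ h1 => ?_⟩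
  · refine ENNReal.mul_ne_top hK (ENNReal.rpow_ne_top_of_nonneg (by positivity) ?_)
    refine ENNReal.mul_ne_top ?_ (ENNReal.rpow_ne_top_of_nonneg (by norm_num) hC)
    exact ENNReal.add_ne_top.2 ⟨ENNReal.natCast_ne_top d, by simp⟩
  · refine (hk φ hφ).trans ?_
    gcongr
    have hexp : P / 2 + 1 - 1 = P / 2 := by ring
    simp only [hexp, Finset.mul_sum]
    have e : ∀ {ψ : Guide d → ℂ} (h' : IsTestFunction ψ), ‖h'.toL2‖ₑ ≤ 1 →
        ∫⁻ p, ‖φ p‖ₑ ^ (P / 2) * ‖ψ p‖ₑ ≤ C ^ (1 / 2 : ℝ) := by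
      intro ψ h' h1'
      refine (lintegral_mul_test_le hφ h' (P / 2)).trans ?_
      rw [mul_div_cancel₀ P two_ne_zero]
      calc _ ≤ C ^ (1 / 2 : ℝ) * 1 := by
            gcongr
            exact hb φ hφ h1
        _ = _ := mul_one _
    have hm : ∀ i ∈ Finset.univ, Measurable fun p => ‖φ p‖ₑ ^ (P / 2) * ‖pderiv i φ p‖ₑ :=
      fun i _ => (hφ.enorm_measurable.pow_const _).mul (hφ.pderiv i).enorm_measurable
    rw [lintegral_add_left (Finset.measurable_sum _ hm), lintegral_finsetSum _ hm]
    calc _ ≤ ∑ i : Option (Fin d), C ^ (1 / 2 : ℝ) + C ^ (1 / 2 : ℝ) := by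
          refine add_le_add (Finset.sum_le_sum fun i _ => e (hφ.pderiv i) ?_) (e hφ ?_)
          · exact (enorm_weakD_le i hφ.toSob).trans h1
          · exact (enorm_fnL_le hφ.toSob).trans h1
      _ = _ := by
          simp
          ring

/-- Bootstrap from the exponent 2. One step takes p to (p/2 + 1)(d + 1)/d, a gain of (2(d + 1) - p(d
- 1))/(2d). For p ≤ P this is at least δ, its value at P, which is positive; finitely many steps
reach P. -/
theorem hasSobolevBound (hd : 1 ≤ d) {P : ℝ} (h2 : 2 ≤ P) (hP : P * (d - 1) < 2 * (d + 1)) :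
    HasSobolevBound d P := by
  have hd' : (1 : ℝ) ≤ d := by exact_mod_cast hd
  obtain ⟨δ, hδ⟩ : ∃ δ : ℝ, δ = (2 * (d + 1) - P * (d - 1)) / (2 * d) := ⟨_, rfl⟩
  have hδ0 : 0 < δ := by
    rw [hδ]
    exact div_pos (by linarith) (by linarith)
  have key : ∀ n : ℕ, HasSobolevBound d (min P (2 + n * δ)) := by
    intro n
    induction n with
    | zero => simpa [h2] using hasSobolevBound_two
    | succ n ih =>
      have hle : 2 ≤ min P (2 + n * δ) := le_min h2 (by
        have : 0 ≤ n * δ := by positivity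
        linarith)
      refine (ih.step hd hle).mono (le_min h2 ?_) ?_
      · have : 0 ≤ ((n + 1 : ℕ) : ℝ) * δ := by positivity
        linarith
      · obtain ⟨p, hp⟩ : ∃ p, p = min P (2 + n * δ) := ⟨_, rfl⟩
        rw [← hp]
        have hpP : p ≤ P := hp ▸ min_le_left _ _
        have hgap : p + δ ≤ (p / 2 + 1) * ((d + 1) / d) := by
          have : (p / 2 + 1) * ((d + 1 : ℝ) / d) - p = (2 * (d + 1) - p * (d - 1)) / (2 * d) := by
            field_simp
            ring
          have h3 : δ ≤ (2 * (d + 1) - p * (d - 1)) / (2 * d) := by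
            rw [hδ]
            gcongr
          linarith
        refine le_trans ?_ hgap
        rcases min_choice P (2 + n * δ) with h | h
        · refine (min_le_left _ _).trans ?_
          rw [hp, h]
          linarith
        · refine (min_le_right _ _).trans ?_
          rw [hp, h]
          push_cast
          linarith
  obtain ⟨n, hn⟩ := exists_nat_ge ((P - 2) / δ)
  have h3 : P ≤ 2 + n * δ := by
    rw [div_le_iff₀ hδ0] at hn
    linarith
  simpa [h3] using key n

/-- Homogeneity: the unit ball bound is applied to φ/‖φ‖, the case ‖φ‖ = 0 being treated apart. -/
theorem exists_lintegral_test_le (hd : 1 ≤ d) {P : ℝ} (h2 : 2 ≤ P)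
    (hP : P * (d - 1) < 2 * (d + 1)) : ∃ C : ℝ≥0∞, C ≠ ⊤ ∧
    ∀ (φ : Guide d → ℂ) (h : IsTestFunction φ), ∫⁻ p, ‖φ p‖ₑ ^ P ≤ C * ‖h.toSob‖ₑ ^ P := by
  obtain ⟨C, hC, hb⟩ := hasSobolevBound hd h2 hP
  refine ⟨C, hC, fun φ h => ?_⟩
  have hP0 : 0 < P := by linarith
  rcases eq_or_ne ‖h.toSob‖ₑ 0 with h0 | h0
  · have h1 : ‖h.toL2‖ₑ = 0 := le_antisymm ((enorm_fnL_le h.toSob).trans h0.le) zero_le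
    have h3 := lintegral_enorm_sq_test h
    rw [h1, ENNReal.zero_rpow_of_pos two_pos,
      lintegral_eq_zero_iff (h.enorm_measurable.pow_const _)] at h3
    have h4 : ∫⁻ p, ‖φ p‖ₑ ^ P = 0 := by
      rw [lintegral_eq_zero_iff (h.enorm_measurable.pow_const _)]
      filter_upwards [h3] with p hp
      have : ‖φ p‖ₑ = 0 := by
        simpa using hp
      simp [this, hP0]
    simp [h4]
  · have hnt : ‖h.toSob‖ₑ ≠ ⊤ := enorm_ne_top
    have hn0 : (‖h.toSob‖ : ℂ) ≠ 0 := by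
      intro hz
      apply h0
      rw [← ofReal_norm, Complex.ofReal_eq_zero.1 hz, ENNReal.ofReal_zero]
    have hc : ‖((‖h.toSob‖ : ℂ))⁻¹‖ₑ = ‖h.toSob‖ₑ⁻¹ := by
      rw [enorm_inv hn0, ← ofReal_norm (‖h.toSob‖ : ℂ), ← ofReal_norm]
      simp
    have hs : (h.smul (‖h.toSob‖ : ℂ)⁻¹).toSob = (‖h.toSob‖ : ℂ)⁻¹ • h.toSob := by
      refine Subtype.ext (Prod.ext (toL2_smul h _) (funext fun i => ?_))
      refine (toL2_congr ((h.smul _).pderiv i) ((h.pderiv i).smul _) ?_).trans (toL2_smul (h.pderiv i) _)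
      exact funext fun p => pderiv_smul h _ i p
    have := hb _ (h.smul (‖h.toSob‖ : ℂ)⁻¹) (by
      rw [hs, enorm_smul, hc, ENNReal.inv_mul_cancel h0 hnt])
    simp only [enorm_mul, hc] at this
    simp only [ENNReal.mul_rpow_of_nonneg _ _ hP0.le] at this
    rw [lintegral_const_mul _ (h.enorm_measurable.pow_const _), ENNReal.inv_rpow,
      ENNReal.inv_mul_le_iff] at this
    · rwa [mul_comm C]
    · simp [h0, hnt]
    · exact ENNReal.rpow_ne_top_of_nonneg hP0.le hnt

/-- Convergence in H¹ takes care of right-hand sides, and almost everywhere convergence, along a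
subsequence, lets Fatou's lemma handle left-hand sides. Estimates for test functions thereby extend
to the Sobolev space. -/
theorem exists_test_seq (u : Sob d) : ∃ (φ : ℕ → Guide d → ℂ) (h : ∀ n, IsTestFunction (φ n)),
    Tendsto (fun n => (h n).toSob) atTop (𝓝 u) ∧
    ∀ᵐ p, Tendsto (fun n => φ n p) atTop (𝓝 (fnL u p)) := by
  obtain ⟨v, hv, hlim⟩ := mem_closure_iff_seq_limit.1 (mem_closure_test u)
  choose φ h hφ using hv
  have hl : Tendsto (fun n => (h n).toSob) atTop (𝓝 u) := by
    simpa only [← hφ] using hlim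
  have h1 : Tendsto (fun n => (h n).toL2) atTop (𝓝 (fnL u)) :=
    (fnL.continuous.tendsto u).comp hl
  obtain ⟨ns, hns, hae⟩ := (tendstoInMeasure_of_tendsto_Lp h1).exists_seq_tendsto_ae
  refine ⟨fun n => φ (ns n), fun n => h (ns n), hl.comp hns.tendsto_atTop, ?_⟩
  have : ∀ᵐ p, ∀ n, (h (ns n)).toL2 p = φ (ns n) p := ae_all_iff.2 fun n => (h (ns n)).coeFn_toL2
  filter_upwards [hae, this] with p hp1 hp2
  simpa only [hp2] using hp1

theorem coeFn_enorm_measurable (f : L2 d) : Measurable fun p => ‖f p‖ₑ :=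
  (Lp.stronglyMeasurable f).enorm

/-- The Sobolev inequality on `ℝ^d × 𝕋`. -/
theorem exists_sobolev (hd : 1 ≤ d) {P : ℝ} (h2 : 2 ≤ P)
    (hP : P * (d - 1) < 2 * (d + 1)) : ∃ C : ℝ≥0∞, C ≠ ⊤ ∧
    ∀ u : Sob d, ∫⁻ p, ‖fnL u p‖ₑ ^ P ≤ C * ‖u‖ₑ ^ P := by
  obtain ⟨C, hC, hb⟩ := exists_lintegral_test_le hd h2 hP
  refine ⟨C, hC, fun u => ?_⟩
  obtain ⟨φ, h, hl, hae⟩ := exists_test_seq u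
  have h1 : Tendsto (fun n => C * ‖(h n).toSob‖ₑ ^ P) atTop (𝓝 (C * ‖u‖ₑ ^ P)) :=
    ENNReal.Tendsto.const_mul (((ENNReal.continuous_rpow_const.tendsto _).comp
      ((continuous_enorm.tendsto u).comp hl))) (Or.inr hC)
  calc _ ≤ ∫⁻ p, liminf (fun n => ‖φ n p‖ₑ ^ P) atTop := by
        refine lintegral_mono_ae ?_
        filter_upwards [hae] with p hp
        refine le_of_eq (Eq.symm ?_)
        exact Tendsto.liminf_eq ((ENNReal.continuous_rpow_const.tendsto _).comp
          ((continuous_enorm.tendsto _).comp hp))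
    _ ≤ liminf (fun n => ∫⁻ p, ‖φ n p‖ₑ ^ P) atTop :=
        lintegral_liminf_le fun n => (h n).enorm_measurable.pow_const _
    _ ≤ liminf (fun n => C * ‖(h n).toSob‖ₑ ^ P) atTop :=
        liminf_le_liminf (Eventually.of_forall fun n => hb (φ n) (h n))
    _ = _ := h1.liminf_eq

/-! ### Weighted estimates in mixed norms. -/

/-- A test function is controlled pointwise on each circle by integrals over that circle. -/
theorem enorm_rpow_le_slice {φ : Guide d → ℂ} (h : IsTestFunction φ) {m : ℝ} (hm : 1 < m)
    (x : Space d) (y : Torus) : ‖φ (x, y)‖ₑ ^ m ≤ ∫⁻ y', (‖φ (x, y')‖ₑ ^ m +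
      ENNReal.ofReal m * (‖φ (x, y')‖ₑ ^ (m - 1) * ‖pderiv none φ (x, y')‖ₑ)) := by
  have hsl : Measurable fun y' : Torus => ((x, y') : Guide d) := measurable_const.prodMk measurable_id
  let f : ℝ → ℂ := fun t => φ (x, (t : Torus))
  have hf : ∀ t : ℝ, HasDerivAt f (pderiv none φ (x, (t : Torus))) t := by
    intro t
    have := h.hasDerivAt none (x, 0) t
    simpa [shift, basisDir, cover] using this
  have hfd : Differentiable ℝ f := fun t => (hf t).differentiableAt
  let H : Torus → ℝ≥0∞ := fun y' =>
    ENNReal.ofReal m * (‖φ (x, y')‖ₑ ^ (m - 1) * ‖pderiv none φ (x, y')‖ₑ)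
  have hHm : Measurable H := Measurable.const_mul
    (((h.enorm_measurable.comp hsl).pow_const _).mul ((h.pderiv none).enorm_measurable.comp hsl)) _
  have hfc : ContDiff ℝ 1 fun t => ‖f t‖ ^ m := by
    refine (contDiff_norm_rpow hm).comp ?_
    exact (h.smooth.of_le (by simp)).comp (contDiff_const.prodMk contDiff_id)
  -- From y' one reaches y by moving less than one period along the circle, so |φ|^m grows by at
  -- most the integral of H.
  have hpt : ∀ y', ‖φ (x, y)‖ₑ ^ m ≤ ‖φ (x, y')‖ₑ ^ m + ∫⁻ z, H z := by
    intro y'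
    obtain ⟨t₀, rfl⟩ := QuotientAddGroup.mk_surjective y'
    obtain ⟨t, ⟨ht1, ht2⟩, rfl⟩ : y ∈ (fun t : ℝ => (t : Torus)) '' Ico t₀ (t₀ + 2 * Real.pi) := by
      rw [AddCircle.coe_image_Ico_eq]
      trivial
    have e1 : ‖f t‖ ^ m = ‖f t₀‖ ^ m + ∫ s in t₀..t, deriv (fun t => ‖f t‖ ^ m) s := by
      rw [intervalIntegral.integral_deriv_eq_sub
        (fun s _ => hfc.differentiable one_ne_zero s)
        ((hfc.continuous_deriv le_rfl).intervalIntegrable _ _)]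
      ring
    have e2 : ∀ t, ‖f t‖ₑ ^ m = ‖‖f t‖ ^ m‖ₑ := by
      intro t
      rw [Real.enorm_rpow_of_nonneg (norm_nonneg _) (by linarith), enorm_norm]
    have e3 : ‖∫ s in t₀..t, deriv (fun t => ‖f t‖ ^ m) s‖ₑ ≤ ∫⁻ z, H z := by
      rw [intervalIntegral.integral_of_le ht1]
      refine (enorm_integral_le_lintegral_enorm _).trans ?_
      rw [← AddCircle.lintegral_preimage (2 * Real.pi) t₀ H]
      refine le_trans (lintegral_mono fun s => ?_) (lintegral_mono_set (Ioc_subset_Ioc_right ht2.le))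
      have := norm_fderiv_norm_rpow_le (x := s) hfd hm
      rw [← norm_deriv_eq_norm_fderiv, ← norm_deriv_eq_norm_fderiv, (hf s).deriv] at this
      rw [← ofReal_norm]
      refine (ENNReal.ofReal_le_ofReal this).trans (le_of_eq ?_)
      rw [mul_assoc, ENNReal.ofReal_mul (by linarith), ENNReal.ofReal_mul (by positivity),
        ← ENNReal.ofReal_rpow_of_nonneg (norm_nonneg _) (by linarith), ofReal_norm, ofReal_norm]
    change ‖f t‖ₑ ^ m ≤ ‖f t₀‖ₑ ^ m + _
    rw [e2 t, e1, e2 t₀]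
    exact (enorm_add_le _ _).trans (by gcongr)
  have hvol : (volume : Measure Torus) univ = ENNReal.ofReal (2 * Real.pi) := AddCircle.measure_univ _
  -- Integrating over y' and dividing by 2π leaves a factor 1/(2π) ≤ 1 on the first term and none on
  -- the second.
  have hvol1 : 1 ≤ (volume : Measure Torus) univ := by
    rw [hvol, ← ENNReal.ofReal_one]
    exact ENNReal.ofReal_le_ofReal (by linarith [Real.pi_gt_three])
  have hvolt : (volume : Measure Torus) univ ≠ ⊤ := by
    rw [hvol]
    exact ENNReal.ofReal_ne_top
  have hint : ∫⁻ _ : Torus, ‖φ (x, y)‖ₑ ^ m ≤ ∫⁻ y', (‖φ (x, y')‖ₑ ^ m + ∫⁻ z, H z) :=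
    lintegral_mono hpt
  rw [lintegral_const, lintegral_add_right _ measurable_const, lintegral_const] at hint
  rw [lintegral_add_right _ hHm]
  have hv0 : (volume : Measure Torus) univ ≠ 0 := (zero_lt_one.trans_le hvol1).ne'
  rw [← ENNReal.mul_le_mul_iff_left hv0 hvolt, add_mul]
  refine hint.trans (add_le_add ?_ le_rfl)
  exact le_mul_of_one_le_right zero_le hvol1

/-- The norm of `L^r_x L^2_y`. -/
def sliceNorm (r : ℝ≥0∞) (g : L2 d) : ℝ≥0∞ :=
  eLpNorm (fun x : Space d => eLpNorm (fun y : Torus => g (x, y)) 2 volume) r volume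

/-- On each circle |φ|^a is bounded by Ξ(x)^{a/m}, free of y, and Hölder in x with exponents m/a and
m/(m - a) separates it from the squared L²_y norm of `g`. Integrating Ξ requires φ in L^m and, by
Cauchy–Schwarz, in L^{2(m-1)}; both are Sobolev exponents because m(d - 1) < 2d. -/
theorem exists_weighted_test (hd : 1 ≤ d) {a m : ℝ} (ha : 0 < a) (ham : a < m) (hm2 : 2 ≤ m)
    (hmd : m * (d - 1) < 2 * d) : ∃ C : ℝ≥0∞, C ≠ ⊤ ∧
    ∀ (φ : Guide d → ℂ) (h : IsTestFunction φ) (g : L2 d),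
      ∫⁻ p, ‖φ p‖ₑ ^ a * ‖g p‖ₑ ^ (2 : ℝ) ≤
        C * ‖h.toSob‖ₑ ^ a * sliceNorm (ENNReal.ofReal (2 * m / (m - a))) g ^ (2 : ℝ) := by
  have hd' : (1 : ℝ) ≤ d := by exact_mod_cast hd
  have hm0 : 0 < m := by linarith
  have hma : 0 < m - a := by linarith
  obtain ⟨C₁, hC₁, hb₁⟩ := exists_lintegral_test_le hd hm2 (by nlinarith : m * (d - 1) < 2 * (d + 1))
  obtain ⟨C₂, hC₂, hb₂⟩ := exists_lintegral_test_le hd (by linarith : 2 ≤ 2 * (m - 1))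
    (by nlinarith : 2 * (m - 1) * (d - 1) < 2 * (d + 1))
  let B : ℝ≥0∞ := C₁ + ENNReal.ofReal m * C₂ ^ (1 / 2 : ℝ)
  have hB : B ≠ ⊤ := ENNReal.add_ne_top.2 ⟨hC₁, ENNReal.mul_ne_top ENNReal.ofReal_ne_top
    (ENNReal.rpow_ne_top_of_nonneg (by norm_num) hC₂)⟩
  refine ⟨B ^ (a / m), ENNReal.rpow_ne_top_of_nonneg (by positivity) hB, fun φ h g => ?_⟩
  let Ξ : Space d → ℝ≥0∞ := fun x => ∫⁻ y', (‖φ (x, y')‖ₑ ^ m +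
      ENNReal.ofReal m * (‖φ (x, y')‖ₑ ^ (m - 1) * ‖pderiv none φ (x, y')‖ₑ))
  have hΞ0 : Measurable fun p : Guide d => ‖φ p‖ₑ ^ m +
      ENNReal.ofReal m * (‖φ p‖ₑ ^ (m - 1) * ‖pderiv none φ p‖ₑ) :=
    (h.enorm_measurable.pow_const _).add (((h.enorm_measurable.pow_const _).mul
      (h.pderiv none).enorm_measurable).const_mul _)
  have hΞm : Measurable Ξ := hΞ0.lintegral_prod_right'
  have hΞ : ∫⁻ x, Ξ x ≤ B * ‖h.toSob‖ₑ ^ m := by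
    have e1 : ∫⁻ x, Ξ x = ∫⁻ p : Guide d, (‖φ p‖ₑ ^ m +
        ENNReal.ofReal m * (‖φ p‖ₑ ^ (m - 1) * ‖pderiv none φ p‖ₑ)) := by
      rw [Measure.volume_eq_prod, lintegral_prod _ hΞ0.aemeasurable]
    rw [e1, lintegral_add_left (h.enorm_measurable.pow_const _), lintegral_const_mul' _ _ (by simp)]
    simp only [B, add_mul, mul_assoc]
    refine add_le_add (hb₁ φ h) (mul_le_mul_right ?_ _)
    refine (lintegral_mul_test_le h (h.pderiv none) (m - 1)).trans ?_
    calc _ ≤ (C₂ * ‖h.toSob‖ₑ ^ (2 * (m - 1))) ^ (1 / 2 : ℝ) * ‖h.toSob‖ₑ := by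
          gcongr
          · exact hb₂ φ h
          · exact enorm_weakD_le none h.toSob
      _ = C₂ ^ (1 / 2 : ℝ) * (‖h.toSob‖ₑ ^ (m - 1) * ‖h.toSob‖ₑ ^ (1 : ℝ)) := by
          rw [ENNReal.mul_rpow_of_nonneg _ _ (by norm_num), ← ENNReal.rpow_mul, ENNReal.rpow_one,
            mul_assoc]
          congr 3
          ring
      _ = _ := by
          rw [← ENNReal.rpow_add_of_nonneg _ _ (by linarith) zero_le_one, sub_add_cancel]
  let G : Space d → ℝ≥0∞ := fun x => ∫⁻ y, ‖g (x, y)‖ₑ ^ (2 : ℝ)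
  have hGm : Measurable G := ((coeFn_enorm_measurable g).pow_const 2).lintegral_prod_right'
  have hr : 0 < 2 * m / (m - a) := by positivity
  have hY : sliceNorm (ENNReal.ofReal (2 * m / (m - a))) g ^ (2 : ℝ) =
      (∫⁻ x, G x ^ (m / (m - a))) ^ (1 / (m / (m - a))) := by
    rw [sliceNorm, eLpNorm_eq_lintegral_rpow_enorm_toReal (by simpa using hr) (by simp),
      ENNReal.toReal_ofReal hr.le, ← ENNReal.rpow_mul]
    congr 1
    · refine lintegral_congr fun x => ?_
      rw [enorm_eq_self, eLpNorm_eq_lintegral_rpow_enorm_toReal (by simp) (by simp), ← ENNReal.rpow_mul]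
      simp only [ENNReal.toReal_ofNat, G]
      congr 1
      field_simp
    · field_simp
  have hhol : (m / a).HolderConjugate (m / (m - a)) := by
    rw [Real.holderConjugate_iff]
    constructor
    · rwa [lt_div_iff₀ ha, one_mul]
    · field_simp
      ring
  have hmeas : Measurable fun p : Guide d => ‖φ p‖ₑ ^ a * ‖g p‖ₑ ^ (2 : ℝ) :=
    (h.enorm_measurable.pow_const _).mul ((coeFn_enorm_measurable g).pow_const 2)
  calc _ = ∫⁻ x, ∫⁻ y, ‖φ (x, y)‖ₑ ^ a * ‖g (x, y)‖ₑ ^ (2 : ℝ) := by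
        exact lintegral_prod _ hmeas.aemeasurable
    _ ≤ ∫⁻ x, Ξ x ^ (a / m) * G x := by
        refine lintegral_mono fun x => ?_
        have hgx : Measurable fun y => ‖g (x, y)‖ₑ ^ (2 : ℝ) :=
          ((coeFn_enorm_measurable g).pow_const 2).comp (measurable_const.prodMk measurable_id)
        simp only [G]
        rw [← lintegral_const_mul _ hgx]
        refine lintegral_mono fun y => ?_
        gcongr
        have := ENNReal.rpow_le_rpow (enorm_rpow_le_slice h (by linarith : 1 < m) x y)
          (by positivity : 0 ≤ a / m)
        rwa [← ENNReal.rpow_mul, mul_div_cancel₀ a hm0.ne'] at this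
    _ ≤ (∫⁻ x, (Ξ x ^ (a / m)) ^ (m / a)) ^ (1 / (m / a)) *
          (∫⁻ x, G x ^ (m / (m - a))) ^ (1 / (m / (m - a))) :=
        ENNReal.lintegral_mul_le_Lp_mul_Lq volume hhol (hΞm.pow_const _).aemeasurable
          hGm.aemeasurable
    _ ≤ (B * ‖h.toSob‖ₑ ^ m) ^ (a / m) * sliceNorm (ENNReal.ofReal (2 * m / (m - a))) g ^ (2 : ℝ) := by
        rw [hY, one_div_div]
        simp only [← ENNReal.rpow_mul]
        have : a / m * (m / a) = 1 := by field_simp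
        simp only [this, ENNReal.rpow_one]
        gcongr
    _ = _ := by
        rw [ENNReal.mul_rpow_of_nonneg _ _ (by positivity), ← ENNReal.rpow_mul,
          mul_div_cancel₀ a hm0.ne']

/-- Fatou along test functions tending to `u`; finiteness of the slice norm makes the right-hand
sides converge. -/
theorem exists_weighted_sob (hd : 1 ≤ d) {a m : ℝ} (ha : 0 < a) (ham : a < m) (hm2 : 2 ≤ m)
    (hmd : m * (d - 1) < 2 * d) : ∃ C : ℝ≥0∞, C ≠ ⊤ ∧
    ∀ (u : Sob d) (g : L2 d), sliceNorm (ENNReal.ofReal (2 * m / (m - a))) g ≠ ⊤ →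
      ∫⁻ p, ‖fnL u p‖ₑ ^ a * ‖g p‖ₑ ^ (2 : ℝ) ≤
        C * ‖u‖ₑ ^ a * sliceNorm (ENNReal.ofReal (2 * m / (m - a))) g ^ (2 : ℝ) := by
  obtain ⟨C, hC, hb⟩ := exists_weighted_test hd ha ham hm2 hmd
  refine ⟨C, hC, fun u g hg => ?_⟩
  obtain ⟨φ, h, hl, hae⟩ := exists_test_seq u
  set Y := sliceNorm (ENNReal.ofReal (2 * m / (m - a))) g
  have h1 : Tendsto (fun n => C * ‖(h n).toSob‖ₑ ^ a * Y ^ (2 : ℝ)) atTop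
      (𝓝 (C * ‖u‖ₑ ^ a * Y ^ (2 : ℝ))) :=
    ENNReal.Tendsto.mul_const (ENNReal.Tendsto.const_mul
      (((ENNReal.continuous_rpow_const.tendsto _).comp
      ((continuous_enorm.tendsto u).comp hl))) (Or.inr hC))
      (Or.inr (ENNReal.rpow_ne_top_of_nonneg (by norm_num) hg))
  have hgm := (coeFn_enorm_measurable g).pow_const (2 : ℝ)
  calc _ ≤ ∫⁻ p, liminf (fun n => ‖φ n p‖ₑ ^ a * ‖g p‖ₑ ^ (2 : ℝ)) atTop := by
        refine lintegral_mono_ae ?_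
        filter_upwards [hae] with p hp
        refine le_of_eq (Eq.symm ?_)
        exact Tendsto.liminf_eq (ENNReal.Tendsto.mul_const
          ((ENNReal.continuous_rpow_const.tendsto _).comp ((continuous_enorm.tendsto _).comp hp))
          (Or.inr (ENNReal.rpow_ne_top_of_nonneg (by norm_num) enorm_ne_top)))
    _ ≤ liminf (fun n => ∫⁻ p, ‖φ n p‖ₑ ^ a * ‖g p‖ₑ ^ (2 : ℝ)) atTop :=
        lintegral_liminf_le fun n => ((h n).enorm_measurable.pow_const _).mul hgm
    _ ≤ liminf (fun n => C * ‖(h n).toSob‖ₑ ^ a * Y ^ (2 : ℝ)) atTop :=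
        liminf_le_liminf (Eventually.of_forall fun n => hb (φ n) (h n) g)
    _ = _ := h1.liminf_eq

/-- The smoothing estimate with weight `|u|^a` in an admissible mixed norm. -/
theorem exists_weighted_admissible (hd : 1 ≤ d) {a : ℝ} (ha : 4 / (d : ℝ) < a)
    (ha' : 2 ≤ d → a < 4 / ((d : ℝ) - 1)) : ∃ q r : ℝ≥0∞, Admissible d q r ∧ q ≠ ⊤ ∧
    ∃ C : ℝ≥0∞, C ≠ ⊤ ∧ ∀ (u : Sob d) (g : L2 d), sliceNorm r g ≠ ⊤ →
      ∫⁻ p, ‖fnL u p‖ₑ ^ a * ‖g p‖ₑ ^ (2 : ℝ) ≤ C * ‖u‖ₑ ^ a * sliceNorm r g ^ (2 : ℝ) := by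
  have hd' : (1 : ℝ) ≤ d := by exact_mod_cast hd
  have hd0 : (0 : ℝ) < d := by linarith
  have ha0 : 0 < a := lt_trans (by positivity) ha
  have had : 4 < a * d := by rwa [div_lt_iff₀ hd0] at ha
  -- Hölder needs a < m, the pair needs ad/2 < m so that q = 4m/(ad) > 2, and Sobolev needs m(d - 1)
  -- < 2d. For d ≥ 2 these are compatible because a(d - 1) < 4. With r = 2m/(m - a) one gets 2/q +
  -- d/r = ad/(2m) + d(m - a)/(2m) = d/2.
  obtain ⟨m, hm1, hm2, hm3⟩ : ∃ m : ℝ, a < m ∧ a * d / 2 < m ∧ m * (d - 1) < 2 * d := by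
    rcases Nat.lt_or_ge d 2 with h | h
    · have : d = 1 := by omega
      subst this
      refine ⟨a + 1, by linarith, ?_, by norm_num⟩
      push_cast
      linarith
    · have h2 : (2 : ℝ) ≤ d := by exact_mod_cast h
      have h3 := ha' h
      rw [lt_div_iff₀ (by linarith)] at h3
      have h4 : max a (a * d / 2) < 2 * d / (d - 1) := by
        rw [max_lt_iff, lt_div_iff₀ (by linarith), lt_div_iff₀ (by linarith)]
        constructor
        · linarith
        · nlinarith
      obtain ⟨m, h5, h6⟩ := exists_between h4
      rw [max_lt_iff] at h5
      rw [lt_div_iff₀ (by linarith)] at h6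
      exact ⟨m, h5.1, h5.2, h6⟩
  have hma : 0 < m - a := by linarith
  have hm0 : 0 < m := by linarith
  obtain ⟨C, hC, hb⟩ := exists_weighted_sob hd ha0 hm1 (by linarith) hm3
  refine ⟨ENNReal.ofReal (4 * m / (a * d)), ENNReal.ofReal (2 * m / (m - a)), ?_, by simp,
    C, hC, hb⟩
  have hq : 2 < 4 * m / (a * d) := by
    rw [lt_div_iff₀ (by positivity)]
    linarith
  have hr : 2 ≤ 2 * m / (m - a) := by
    rw [le_div_iff₀ hma]
    linarith
  have e2 : (2 : ℝ≥0∞) = ENNReal.ofReal 2 := by simp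
  have ed : (d : ℝ≥0∞) = ENNReal.ofReal d := by simp
  refine ⟨?_, ?_, ?_, ?_⟩
  · rw [e2]
    exact ENNReal.ofReal_le_ofReal hq.le
  · rw [e2]
    exact ENNReal.ofReal_le_ofReal hr
  · rw [e2, ed, ← ENNReal.ofReal_div_of_pos (by positivity),
      ← ENNReal.ofReal_div_of_pos (by positivity), ← ENNReal.ofReal_div_of_pos (by positivity),
      ← ENNReal.ofReal_add (by positivity) (by positivity)]
    congr 1
    field_simp
    ring
  · rintro ⟨h, -⟩
    rw [e2, ENNReal.ofReal_eq_ofReal_iff (by positivity) (by norm_num)] at h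
    linarith

/-! ### The nonlinear term and the weak form of the equation. -/

/-- The range of exponents: mass supercritical on `ℝ^d`, energy subcritical on `ℝ^{d+1}`. -/
structure IsIntercritical (d : ℕ) (α : ℝ) : Prop where
  one_le : 1 ≤ d
  lower : 4 / (d : ℝ) < α
  upper : 2 ≤ d → α < 4 / ((d : ℝ) - 1)

namespace IsIntercritical

variable {α : ℝ}

theorem pos (h : IsIntercritical d α) : 0 < α := lt_of_le_of_lt (by positivity) h.lower

theorem four_lt (h : IsIntercritical d α) : 4 < α * d := by
  have : (0 : ℝ) < d := by exact_mod_cast h.one_le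
  have h1 := h.lower
  rwa [div_lt_iff₀ this] at h1

theorem mul_lt (h : IsIntercritical d α) : α * (d - 1) < 4 := by
  rcases Nat.lt_or_ge d 2 with h' | h'
  · have : d = 1 := by have := h.one_le; omega
    subst this
    norm_num
  · have h2 : (2 : ℝ) ≤ d := by exact_mod_cast h'
    have h3 := h.upper h'
    rwa [lt_div_iff₀ (by linarith)] at h3

theorem sobolev_lt (h : IsIntercritical d α) : (α + 2) * (d - 1) < 2 * (d + 1) := by
  have := h.mul_lt
  linarith

end IsIntercritical

/-- The nonlinearity `z ↦ |z|^α z`. -/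
def nl (α : ℝ) (z : ℂ) : ℂ := ((‖z‖ ^ α : ℝ) : ℂ) * z

theorem continuous_nl {α : ℝ} (hα : 0 ≤ α) : Continuous (nl α) :=
  (Complex.continuous_ofReal.comp (continuous_norm.rpow_const fun _ => Or.inr hα)).mul continuous_id

/-- With t = A/B this reads 1 - t^α ≤ (1 + α)(1 - t): Bernoulli's inequality for α ≥ 1, and t ≤ t^α
for α ≤ 1. -/
theorem mul_rpow_sub_rpow_le {α A B : ℝ} (hα : 0 < α) (hA : 0 ≤ A) (hAB : A ≤ B) :
    B * (B ^ α - A ^ α) ≤ (1 + α) * B ^ α * (B - A) := by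
  rcases eq_or_lt_of_le (hA.trans hAB) with hB | hB
  · have : A = 0 := le_antisymm (hAB.trans hB.ge) hA
    simp [← hB, this]
  obtain ⟨t, ht⟩ : ∃ t, t = A / B := ⟨_, rfl⟩
  have ht0 : 0 ≤ t := ht ▸ div_nonneg hA hB.le
  have ht1 : t ≤ 1 := ht ▸ (div_le_one hB).2 hAB
  have hAt : A = B * t := by rw [ht]; field_simp
  have key : 1 - t ^ α ≤ (1 + α) * (1 - t) := by
    rcases le_total 1 α with h1 | h1
    · have := one_add_mul_self_le_rpow_one_add (s := t - 1) (by linarith) h1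
      rw [add_sub_cancel] at this
      nlinarith
    · have : t ≤ t ^ α := by
        rcases eq_or_lt_of_le ht0 with h0 | h0
        · rw [← h0, Real.zero_rpow hα.ne']
        · simpa using Real.rpow_le_rpow_of_exponent_ge h0 ht1 h1
      nlinarith
  rw [hAt, Real.mul_rpow hB.le ht0]
  have hBα : 0 ≤ B ^ α := by positivity
  calc B * (B ^ α - B ^ α * t ^ α) = B * B ^ α * (1 - t ^ α) := by ring
    _ ≤ B * B ^ α * ((1 + α) * (1 - t)) := by gcongr
    _ = _ := by ring

/-- A common Lipschitz estimate, used for the weight r^α, for its truncation and for their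
difference. If |a| ≤ |b|, then θ(|b|)b - θ(|a|)a splits into θ(|b|)(b - a) and (θ(|b|) - θ(|a|))a,
and the hypothesis on increments of θ bounds the second term. -/
theorem norm_weighted_sub_le {θ : ℝ → ℝ} {c K : ℝ} (hθ0 : ∀ r, 0 ≤ r → 0 ≤ θ r)
    {a b : ℂ} (hc : θ (max ‖a‖ ‖b‖) ≤ c)
    (hinc : ∀ A B, 0 ≤ A → A ≤ B → B ≤ max ‖a‖ ‖b‖ → A * |θ B - θ A| ≤ K * (B - A)) :
    ‖(θ ‖b‖ : ℂ) * b - (θ ‖a‖ : ℂ) * a‖ ≤ (c + K) * ‖b - a‖ := by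
  have main : ∀ a b : ℂ, ‖a‖ ≤ ‖b‖ → θ ‖b‖ ≤ c →
      ‖a‖ * |θ ‖b‖ - θ ‖a‖| ≤ K * (‖b‖ - ‖a‖) → 0 ≤ K →
      ‖(θ ‖b‖ : ℂ) * b - (θ ‖a‖ : ℂ) * a‖ ≤ (c + K) * ‖b - a‖ := by
    intro a b hab hcb h hK
    have e : (θ ‖b‖ : ℂ) * b - (θ ‖a‖ : ℂ) * a =
        (θ ‖b‖ : ℂ) * (b - a) + ((θ ‖b‖ - θ ‖a‖ : ℝ) : ℂ) * a := by push_cast; ring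
    rw [e]
    refine (norm_add_le _ _).trans ?_
    rw [norm_mul, norm_mul, Complex.norm_real, Complex.norm_real, Real.norm_eq_abs,
      Real.norm_eq_abs, abs_of_nonneg (hθ0 _ (norm_nonneg b)), add_mul]
    refine add_le_add (by gcongr) ?_
    rw [mul_comm]
    refine h.trans ?_
    gcongr
    exact norm_sub_norm_le b a
  have hK : a ≠ b → 0 ≤ K := by
    intro hne
    have hM : 0 < max ‖a‖ ‖b‖ := by
      by_contra! hle
      have h1 := norm_le_zero_iff.1 ((le_max_left ‖a‖ ‖b‖).trans hle)
      have h2 := norm_le_zero_iff.1 ((le_max_right ‖a‖ ‖b‖).trans hle)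
      exact hne (h1.trans h2.symm)
    have := hinc 0 _ le_rfl hM.le le_rfl
    rw [zero_mul, sub_zero] at this
    exact nonneg_of_mul_nonneg_left this hM
  rcases eq_or_ne a b with rfl | hne
  · simp
  rcases le_total ‖a‖ ‖b‖ with h | h
  · rw [max_eq_right h] at hc hinc
    exact main a b h hc (hinc _ _ (norm_nonneg _) h le_rfl) (hK hne)
  · rw [max_eq_left h] at hc hinc
    have := main b a h hc (hinc _ _ (norm_nonneg _) h le_rfl) (hK hne)
    rwa [norm_sub_rev, norm_sub_rev a b] at this

theorem norm_nl_sub_le {α : ℝ} (hα : 0 < α) (a b : ℂ) :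
    ‖nl α b - nl α a‖ ≤ (2 + α) * (‖a‖ ^ α + ‖b‖ ^ α) * ‖b - a‖ := by
  have h := norm_weighted_sub_le (θ := fun r => r ^ α) (c := ‖a‖ ^ α + ‖b‖ ^ α)
    (K := (1 + α) * (‖a‖ ^ α + ‖b‖ ^ α)) (a := a) (b := b) (fun r hr => by positivity) ?_ ?_
  · refine h.trans (le_of_eq ?_)
    ring
  · rcases max_choice ‖a‖ ‖b‖ with h | h <;> rw [h]
    · exact le_add_of_nonneg_right (by positivity)
    · exact le_add_of_nonneg_left (by positivity)
  · intro A B hA hAB hB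
    have h1 : A ^ α ≤ B ^ α := Real.rpow_le_rpow hA hAB hα.le
    rw [abs_of_nonneg (sub_nonneg.2 h1)]
    have h2 : B ^ α ≤ ‖a‖ ^ α + ‖b‖ ^ α := by
      refine (Real.rpow_le_rpow (hA.trans hAB) hB hα.le).trans ?_
      rcases max_choice ‖a‖ ‖b‖ with h | h <;> rw [h]
      · exact le_add_of_nonneg_right (by positivity)
      · exact le_add_of_nonneg_left (by positivity)
    calc A * (B ^ α - A ^ α) ≤ B * (B ^ α - A ^ α) := by
          gcongr
      _ ≤ _ := mul_rpow_sub_rpow_le hα hA hAB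
      _ ≤ _ := by
          have : 0 ≤ B - A := by linarith
          gcongr

/-- The trilinear bound behind the nonlinear term. -/
theorem exists_trilinear {α : ℝ} (h : IsIntercritical d α) : ∃ C : ℝ≥0∞, C ≠ ⊤ ∧
    ∀ v u w : Sob d, ∫⁻ p, ‖fnL v p‖ₑ * ‖fnL u p‖ₑ ^ α * ‖fnL w p‖ₑ ≤
      C * (‖v‖ₑ * ‖u‖ₑ ^ α * ‖w‖ₑ) := by
  have hα := h.pos
  obtain ⟨C, hC, hb⟩ := exists_sobolev h.one_le (P := α + 2) (by linarith) h.sobolev_lt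
  refine ⟨C, hC, fun v u w => ?_⟩
  let g : Fin 3 → L2 d := ![fnL v, fnL u, fnL w]
  -- Hölder with three factors, every function being measured in L^{α+2}; the weights sum to one.
  let e : Fin 3 → ℝ := ![1 / (α + 2), α / (α + 2), 1 / (α + 2)]
  have hP : α + 2 ≠ 0 := by linarith
  have h1 := ENNReal.lintegral_prod_norm_pow_le (μ := (volume : Measure (Guide d))) Finset.univ
    (f := fun i p => ‖g i p‖ₑ ^ (α + 2)) (p := e)
    (fun i _ => ((coeFn_enorm_measurable (g i)).pow_const _).aemeasurable)
    (by simp only [e, Fin.sum_univ_three]; simp; field_simp; ring)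
    (by
      intro i _
      fin_cases i <;> simp [e] <;> positivity)
  simp only [Fin.prod_univ_three, ← ENNReal.rpow_mul, g, e] at h1
  simp only [Matrix.cons_val_zero, Matrix.cons_val_one, Matrix.cons_val_two, Matrix.head_cons,
    Matrix.tail_cons, mul_div_cancel₀ _ hP, ENNReal.rpow_one] at h1
  refine h1.trans ?_
  have h2 : ∀ (u : Sob d) {s : ℝ}, 0 ≤ s → (∫⁻ p, ‖fnL u p‖ₑ ^ (α + 2)) ^ (s / (α + 2)) ≤
      C ^ (s / (α + 2)) * ‖u‖ₑ ^ s := by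
    intro u s hs
    refine (ENNReal.rpow_le_rpow (hb u) (by positivity)).trans (le_of_eq ?_)
    rw [ENNReal.mul_rpow_of_nonneg _ _ (by positivity), ← ENNReal.rpow_mul, mul_div_cancel₀ _ hP]
  have h3 : C ^ (1 / (α + 2)) * C ^ (α / (α + 2)) * C ^ (1 / (α + 2)) = C := by
    rw [← ENNReal.rpow_add_of_nonneg _ _ (by positivity) (by positivity),
      ← ENNReal.rpow_add_of_nonneg _ _ (by positivity) (by positivity)]
    have : 1 / (α + 2) + α / (α + 2) + 1 / (α + 2) = 1 := by field_simp; ring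
    rw [this, ENNReal.rpow_one]
  calc _ ≤ (C ^ (1 / (α + 2)) * ‖v‖ₑ ^ (1 : ℝ)) * (C ^ (α / (α + 2)) * ‖u‖ₑ ^ α) *
        (C ^ (1 / (α + 2)) * ‖w‖ₑ ^ (1 : ℝ)) := by
        gcongr
        · exact h2 v zero_le_one
        · exact h2 u hα.le
        · exact h2 w zero_le_one
    _ = (C ^ (1 / (α + 2)) * C ^ (α / (α + 2)) * C ^ (1 / (α + 2))) *
        (‖v‖ₑ * ‖u‖ₑ ^ α * ‖w‖ₑ) := by
        simp only [ENNReal.rpow_one]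
        ring
    _ = _ := by rw [h3]

theorem integrable_trilinear {α : ℝ} (h : IsIntercritical d α) (v u w : Sob d) :
    Integrable fun p => ‖fnL v p‖ * ‖fnL u p‖ ^ α * ‖fnL w p‖ := by
  obtain ⟨C, hC, hb⟩ := exists_trilinear h
  have hα := h.pos
  refine ⟨?_, ?_⟩
  · have hm : ∀ u : Sob d, AEStronglyMeasurable (fun p => ‖fnL u p‖) volume := fun u =>
      (Lp.aestronglyMeasurable (fnL u)).norm
    exact ((hm v).mul ((hm u).aemeasurable.pow_const _).aestronglyMeasurable).mul (hm w)
  · refine lt_of_le_of_lt (le_of_eq ?_) (lt_of_le_of_lt (hb v u w) ?_)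
    · refine lintegral_congr fun p => ?_
      rw [enorm_mul, enorm_mul, Real.enorm_rpow_of_nonneg (norm_nonneg _) hα.le]
      simp only [enorm_norm]
    · refine (ENNReal.mul_ne_top hC (ENNReal.mul_ne_top (ENNReal.mul_ne_top enorm_ne_top
        (ENNReal.rpow_ne_top_of_nonneg hα.le enorm_ne_top)) enorm_ne_top)).lt_top

theorem exists_integral_trilinear {α : ℝ} (h : IsIntercritical d α) : ∃ C : ℝ, 0 ≤ C ∧
    ∀ v u w : Sob d, ∫ p, ‖fnL v p‖ * ‖fnL u p‖ ^ α * ‖fnL w p‖ ≤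
      C * (‖v‖ * ‖u‖ ^ α * ‖w‖) := by
  obtain ⟨C, hC, hb⟩ := exists_trilinear h
  have hα := h.pos
  refine ⟨C.toReal, ENNReal.toReal_nonneg, fun v u w => ?_⟩
  have hf := integrable_trilinear h v u w
  rw [integral_eq_lintegral_of_nonneg_ae (Eventually.of_forall fun p => by positivity)
    hf.aestronglyMeasurable]
  refine ENNReal.toReal_le_of_le_ofReal (by positivity) ?_
  have e : ∀ x y z : ℝ, 0 ≤ x → 0 ≤ y → ENNReal.ofReal (x * y ^ α * z) =
      ENNReal.ofReal x * ENNReal.ofReal y ^ α * ENNReal.ofReal z := by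
    intro x y z hx hy
    rw [ENNReal.ofReal_mul (by positivity), ENNReal.ofReal_mul hx,
      ENNReal.ofReal_rpow_of_nonneg hy hα.le]
  rw [ENNReal.ofReal_mul ENNReal.toReal_nonneg, ENNReal.ofReal_toReal hC,
    e _ _ _ (norm_nonneg _) (norm_nonneg _)]
  simp only [e _ _ _ (norm_nonneg _) (norm_nonneg _), ofReal_norm]
  exact hb v u w

/-- The nonlinear form `∫ v̄ |u|^α u`. -/
def nlForm (α : ℝ) (v u : Sob d) : ℂ := ∫ p, star (fnL v p) * nl α (fnL u p)

theorem norm_nl {α : ℝ} (z : ℂ) : ‖nl α z‖ = ‖z‖ ^ α * ‖z‖ := by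
  rw [nl, norm_mul, Complex.norm_real, Real.norm_eq_abs, abs_of_nonneg (by positivity)]

theorem aestronglyMeasurable_nl {α : ℝ} (h : IsIntercritical d α) (f : L2 d) :
    AEStronglyMeasurable (fun p => nl α (f p)) volume :=
  (continuous_nl h.pos.le).comp_aestronglyMeasurable (Lp.aestronglyMeasurable f)

theorem integrable_nlForm {α : ℝ} (h : IsIntercritical d α) (v u : Sob d) :
    Integrable fun p => star (fnL v p) * nl α (fnL u p) := by
  refine (integrable_trilinear h v u u).mono' ((Lp.aestronglyMeasurable (fnL v)).star.mul
    (aestronglyMeasurable_nl h _)) (Eventually.of_forall fun p => ?_)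
  rw [norm_mul, norm_star, norm_nl, mul_assoc]

theorem nlForm_add_left {α : ℝ} (h : IsIntercritical d α) (v w u : Sob d) :
    nlForm α (v + w) u = nlForm α v u + nlForm α w u := by
  rw [nlForm, nlForm, nlForm, ← integral_add (integrable_nlForm h v u) (integrable_nlForm h w u)]
  refine integral_congr_ae ?_
  rw [map_add]
  filter_upwards [Lp.coeFn_add (fnL v) (fnL w)] with p hp
  rw [hp, Pi.add_apply, star_add, add_mul]

theorem nlForm_smul_left {α : ℝ} (c : ℂ) (v u : Sob d) :
    nlForm α (c • v) u = star c * nlForm α v u := by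
  rw [nlForm, nlForm, ← integral_const_mul]
  refine integral_congr_ae ?_
  rw [map_smul]
  filter_upwards [Lp.coeFn_smul c (fnL v)] with p hp
  rw [hp, Pi.smul_apply, smul_eq_mul, star_mul']
  ring

theorem nlForm_sub_left {α : ℝ} (h : IsIntercritical d α) (v w u : Sob d) :
    nlForm α (v - w) u = nlForm α v u - nlForm α w u := by
  have := nlForm_add_left h (v - w) w u
  rw [sub_add_cancel] at this
  rw [this, add_sub_cancel_right]

theorem exists_nlForm_bounds {α : ℝ} (h : IsIntercritical d α) : ∃ C : ℝ, 0 ≤ C ∧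
    (∀ v u : Sob d, ‖nlForm α v u‖ ≤ C * (‖v‖ * ‖u‖ ^ α * ‖u‖)) ∧
    ∀ v u w : Sob d, ‖nlForm α v u - nlForm α v w‖ ≤
      C * (‖v‖ * (‖u‖ ^ α + ‖w‖ ^ α) * ‖u - w‖) := by
  obtain ⟨C, hC, hb⟩ := exists_integral_trilinear h
  have hα := h.pos
  refine ⟨(2 + α) * C, by positivity, fun v u => ?_, fun v u w => ?_⟩
  · calc _ ≤ ∫ p, ‖fnL v p‖ * ‖fnL u p‖ ^ α * ‖fnL u p‖ := by
          refine norm_integral_le_of_norm_le (integrable_trilinear h v u u)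
            (Eventually.of_forall fun p => ?_)
          rw [norm_mul, norm_star, norm_nl, mul_assoc]
      _ ≤ C * (‖v‖ * ‖u‖ ^ α * ‖u‖) := hb v u u
      _ ≤ _ := by
          have : 0 ≤ C * (‖v‖ * ‖u‖ ^ α * ‖u‖) := by positivity
          nlinarith
  · rw [nlForm, nlForm, ← integral_sub (integrable_nlForm h v u) (integrable_nlForm h v w)]
    have i1 := integrable_trilinear h v u (u - w)
    have i2 := integrable_trilinear h v w (u - w)
    calc _ ≤ ∫ p, (2 + α) * (‖fnL v p‖ * ‖fnL u p‖ ^ α * ‖fnL (u - w) p‖ +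
            ‖fnL v p‖ * ‖fnL w p‖ ^ α * ‖fnL (u - w) p‖) := by
          refine norm_integral_le_of_norm_le ((i1.add i2).const_mul _) ?_
          rw [map_sub]
          filter_upwards [Lp.coeFn_sub (fnL u) (fnL w)] with p hp
          rw [hp, Pi.sub_apply, ← mul_sub, norm_mul, norm_star]
          calc _ ≤ ‖fnL v p‖ * ((2 + α) * (‖fnL w p‖ ^ α + ‖fnL u p‖ ^ α) *
                ‖fnL u p - fnL w p‖) := by
                gcongr
                exact norm_nl_sub_le hα _ _
            _ = _ := by ring
      _ = (2 + α) * (∫ p, ‖fnL v p‖ * ‖fnL u p‖ ^ α * ‖fnL (u - w) p‖) +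
          (2 + α) * ∫ p, ‖fnL v p‖ * ‖fnL w p‖ ^ α * ‖fnL (u - w) p‖ := by
          rw [integral_const_mul, integral_add i1 i2]
          ring
      _ ≤ (2 + α) * (C * (‖v‖ * ‖u‖ ^ α * ‖u - w‖)) +
          (2 + α) * (C * (‖v‖ * ‖w‖ ^ α * ‖u - w‖)) := by
          gcongr
          · exact hb v u (u - w)
          · exact hb v w (u - w)
      _ = _ := by ring

theorem continuous_nlForm {α : ℝ} (h : IsIntercritical d α) :
    Continuous fun q : Sob d × Sob d => nlForm α q.1 q.2 := by
  obtain ⟨C, hC, hb1, hb2⟩ := exists_nlForm_bounds h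
  rw [continuous_iff_continuousAt]
  rintro ⟨v₀, u₀⟩
  rw [ContinuousAt, tendsto_iff_norm_sub_tendsto_zero]
  have hbound : ∀ q : Sob d × Sob d, ‖nlForm α q.1 q.2 - nlForm α v₀ u₀‖ ≤
      C * (‖q.1 - v₀‖ * ‖q.2‖ ^ α * ‖q.2‖) +
      C * (‖v₀‖ * (‖q.2‖ ^ α + ‖u₀‖ ^ α) * ‖q.2 - u₀‖) := by
    intro q
    have e : nlForm α q.1 q.2 - nlForm α v₀ u₀ =
        nlForm α (q.1 - v₀) q.2 + (nlForm α v₀ q.2 - nlForm α v₀ u₀) := by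
      rw [nlForm_sub_left h]
      ring
    rw [e]
    exact (norm_add_le _ _).trans (add_le_add (hb1 _ _) (hb2 _ _ _))
  refine squeeze_zero (fun _ => norm_nonneg _) hbound ?_
  have hpow : Continuous fun q : Sob d × Sob d => ‖q.2‖ ^ α :=
    continuous_snd.norm.rpow_const fun _ => Or.inr h.pos.le
  have hc : Continuous fun q : Sob d × Sob d => C * (‖q.1 - v₀‖ * ‖q.2‖ ^ α * ‖q.2‖) +
      C * (‖v₀‖ * (‖q.2‖ ^ α + ‖u₀‖ ^ α) * ‖q.2 - u₀‖) := by
    fun_prop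
  simpa using hc.tendsto (v₀, u₀)

/-- The weak form of `i (Δ u + |u|^α u)`, tested against `v̄`. -/
def weakForm (α : ℝ) (v u : Sob d) : ℂ :=
  Complex.I * (-(∑ i, ⟪weakD i v, weakD i u⟫_ℂ) + nlForm α v u)

theorem continuous_weakForm {α : ℝ} (h : IsIntercritical d α) :
    Continuous fun q : Sob d × Sob d => weakForm α q.1 q.2 := by
  refine continuous_const.mul (Continuous.add (Continuous.neg
    (continuous_finsetSum _ fun i _ => ?_)) (continuous_nlForm h))
  exact ((weakD i).continuous.comp continuous_fst).inner ((weakD i).continuous.comp continuous_snd)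

theorem weakForm_zero_left (α : ℝ) (u : Sob d) : weakForm α 0 u = 0 := by
  have : nlForm α 0 u = 0 := by
    have := nlForm_smul_left (α := α) 0 (0 : Sob d) u
    simpa using this
  simp [weakForm, this]

theorem weakForm_add_left {α : ℝ} (h : IsIntercritical d α) (v w u : Sob d) :
    weakForm α (v + w) u = weakForm α v u + weakForm α w u := by
  simp only [weakForm, nlForm_add_left h, map_add, inner_add_left, Finset.sum_add_distrib]
  ring

theorem weakForm_def (α : ℝ) (v u : Sob d) : weakForm α v u =
    Complex.I * (-(∑ i, ⟪weakD i v, weakD i u⟫_ℂ) + nlForm α v u) := rfl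

theorem nlForm_def (α : ℝ) (v u : Sob d) :
    nlForm α v u = ∫ p, star (fnL v p) * nl α (fnL u p) := rfl

attribute [irreducible] weakForm nlForm

/-! ### Weak solutions and time derivatives of quadratic forms. -/

/-- A continuous `H¹`-valued weak solution of the equation. -/
structure IsWeakSolution (α : ℝ) (I : Set ℝ) (U : ℝ → Sob d) : Prop where
  isOpen : IsOpen I
  ordConnected : I.OrdConnected
  continuousOn : ContinuousOn U I
  weak : ∀ (φ : Guide d → ℂ) (h : IsTestFunction φ), ∀ t ∈ I,
    HasDerivAt (fun s => ⟪h.toL2, fnL (U s)⟫_ℂ) (weakForm α h.toSob (U t)) t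

namespace IsWeakSolution

variable {α : ℝ} {I : Set ℝ} {U : ℝ → Sob d}

theorem continuousAt (S : IsWeakSolution α I U) {t : ℝ} (ht : t ∈ I) : ContinuousAt U t :=
  S.continuousOn.continuousAt (S.isOpen.mem_nhds ht)

theorem uIcc_subset (S : IsWeakSolution α I U) {a b : ℝ} (ha : a ∈ I) (hb : b ∈ I) :
    uIcc a b ⊆ I := S.ordConnected.uIcc_subset ha hb

theorem continuousOn_weakForm (S : IsWeakSolution α I U) (h : IsIntercritical d α) (v : Sob d) :
    ContinuousOn (fun s => weakForm α v (U s)) I :=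
  (continuous_weakForm h).comp_continuousOn (f := fun s => (v, U s))
    (continuousOn_const.prodMk S.continuousOn)

/-- The equation is given for test functions only. In integrated form both sides are continuous in v
for the H¹ norm, so density of test functions extends it to the whole Sobolev space. -/
theorem inner_sub_eq (S : IsWeakSolution α I U) (h : IsIntercritical d α) {a b : ℝ}
    (ha : a ∈ I) (hb : b ∈ I) (v : Sob d) :
    ⟪fnL v, fnL (U b) - fnL (U a)⟫_ℂ = ∫ s in a..b, weakForm α v (U s) := by
  -- `U` is continuous only on I; freezing it outside the interval between a and b gives a globally
  -- continuous path, to which continuity of parametric integrals applies.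
  let V : ℝ → Sob d := fun s => U (projIcc (min a b) (max a b) min_le_max s)
  have hV : Continuous V := by
    have h1 : ContinuousOn U (Icc (min a b) (max a b)) :=
      S.continuousOn.mono (S.uIcc_subset ha hb)
    exact h1.domRestrict.comp continuous_projIcc
  have hVU : ∀ v, ∫ s in a..b, weakForm α v (U s) = ∫ s in a..b, weakForm α v (V s) := by
    intro v
    refine intervalIntegral.integral_congr fun s hs => ?_
    simp only [V]
    rw [projIcc_of_mem _ hs]
  have hcl : IsClosed {v : Sob d | ⟪fnL v, fnL (U b) - fnL (U a)⟫_ℂ =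
      ∫ s in a..b, weakForm α v (V s)} := by
    refine isClosed_eq (fnL.continuous.inner continuous_const) ?_
    refine intervalIntegral.continuous_parametric_intervalIntegral_of_continuous' ?_ a b
    exact (continuous_weakForm h).comp (g := fun q : Sob d × Sob d => weakForm α q.1 q.2)
      (f := fun q : Sob d × ℝ => (q.1, V q.2)) (continuous_fst.prodMk (hV.comp continuous_snd))
  have hall : v ∈ {v : Sob d | ⟪fnL v, fnL (U b) - fnL (U a)⟫_ℂ =
      ∫ s in a..b, weakForm α v (V s)} := by
    refine hcl.closure_subset_iff.2 ?_ (mem_closure_test v)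
    rintro _ ⟨φ, hφ, rfl⟩
    rw [mem_ofPred_eq, ← hVU, intervalIntegral.integral_eq_sub_of_hasDerivAt
      (fun s hs => S.weak φ hφ s (S.uIcc_subset ha hb hs)), fnL_toSob, inner_sub_right]
    exact ((S.continuousOn_weakForm h _).mono (S.uIcc_subset ha hb)).intervalIntegrable
  rw [hVU]
  exact hall

/-- The test function may move with time, with mere continuity in H¹ at t, because the weak form is
jointly continuous. This freedom replaces differentiability of `U` in L². -/
theorem inner_sub_isLittleO (S : IsWeakSolution α I U) (h : IsIntercritical d α) {t : ℝ}
    (ht : t ∈ I) {G : ℝ → Sob d} (hG : ContinuousAt G t) :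
    (fun t' => ⟪fnL (G t'), fnL (U t') - fnL (U t)⟫_ℂ - ((t' - t : ℝ) : ℂ) *
      weakForm α (G t) (U t)) =o[𝓝 t] fun t' => t' - t := by
  rw [Asymptotics.isLittleO_iff]
  intro ε hε
  have hc : ContinuousAt (fun q : ℝ × ℝ => weakForm α (G q.1) (U q.2)) (t, t) := by
    refine (continuous_weakForm h).continuousAt.comp (f := fun q : ℝ × ℝ => (G q.1, U q.2)) ?_
    exact (ContinuousAt.comp (f := Prod.fst) hG continuousAt_fst).prodMk
      (ContinuousAt.comp (f := Prod.snd) (S.continuousAt ht) continuousAt_snd)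
  obtain ⟨δ, hδ, hδ'⟩ := Metric.continuousAt_iff.1 hc ε hε
  have hmem : ∀ᶠ t' in 𝓝 t, t' ∈ I := S.isOpen.mem_nhds ht
  filter_upwards [hmem, Metric.ball_mem_nhds t hδ] with t' h1 h2
  have hint : IntervalIntegrable (fun s => weakForm α (G t') (U s)) volume t t' :=
    ((S.continuousOn_weakForm h _).mono (S.uIcc_subset ht h1)).intervalIntegrable
  have e : ⟪fnL (G t'), fnL (U t') - fnL (U t)⟫_ℂ - ((t' - t : ℝ) : ℂ) * weakForm α (G t) (U t) =
      ∫ s in t..t', (weakForm α (G t') (U s) - weakForm α (G t) (U t)) := by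
    rw [S.inner_sub_eq h ht h1, intervalIntegral.integral_sub hint
      intervalIntegrable_const, intervalIntegral.integral_const]
    simp
  rw [e]
  refine intervalIntegral.norm_integral_le_of_norm_le_const fun s hs => ?_
  have hs' : dist s t < δ := by
    have := uIoc_subset_uIcc hs
    have h3 := abs_sub_left_of_mem_uIcc this
    rw [Metric.mem_ball, Real.dist_eq] at h2
    rw [Real.dist_eq]
    exact h3.trans_lt h2
  have := hδ' (x := (t', s)) (by
    rw [Prod.dist_eq]
    exact max_lt h2 hs')
  rw [dist_eq_norm] at this
  exact this.le

/-- The time derivative of a symmetric quadratic form along the flow. -/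
theorem hasDerivAt_quadratic (S : IsWeakSolution α I U) (h : IsIntercritical d α)
    (L : Sob d →L[ℝ] Sob d)
    (hL : ∀ v w, (⟪fnL (L v), fnL w⟫_ℂ).re = (⟪fnL v, fnL (L w)⟫_ℂ).re) {t : ℝ} (ht : t ∈ I) :
    HasDerivAt (fun s => (⟪fnL (L (U s)), fnL (U s)⟫_ℂ).re)
      (2 * (weakForm α (L (U t)) (U t)).re) t := by
  rw [hasDerivAt_iff_isLittleO]
  -- Symmetry of L gives Re⟨L(U t' + U t), U t' - U t⟩ = Re⟨L(U t'), U t'⟩ - Re⟨L(U t), U t⟩. The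
  -- increment of the form is thus the increment of `U` tested against a moving function with limit
  -- 2L(U t).
  have hG : ContinuousAt (fun t' => L (U t') + L (U t)) t :=
    (L.continuous.continuousAt.comp (S.continuousAt ht)).add continuousAt_const
  have h1 := S.inner_sub_isLittleO h ht hG
  refine (Asymptotics.isBigO_of_le _ fun t' => ?_).trans_isLittleO h1
  have hre : (⟪fnL (L (U t') + L (U t)), fnL (U t') - fnL (U t)⟫_ℂ).re =
      (⟪fnL (L (U t')), fnL (U t')⟫_ℂ).re - (⟪fnL (L (U t)), fnL (U t)⟫_ℂ).re := by
    have e1 := hL (U t') (U t)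
    have e2 : (⟪fnL (U t'), fnL (L (U t))⟫_ℂ).re = (⟪fnL (L (U t)), fnL (U t')⟫_ℂ).re := by
      rw [← inner_conj_symm, Complex.conj_re]
    simp only [map_add, inner_add_left, inner_sub_right, Complex.add_re, Complex.sub_re]
    linarith
  rw [weakForm_add_left h]
  refine le_trans (le_of_eq ?_) (Complex.abs_re_le_norm _)
  rw [Complex.sub_re, hre, Complex.re_ofReal_mul, Complex.add_re, Real.norm_eq_abs, smul_eq_mul]
  congr 1
  ring

/-- The increment `U t' - U t` serves as its own moving test function; it vanishes at t, so the
leading term drops out. -/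
theorem norm_sub_sq_isLittleO (S : IsWeakSolution α I U) (h : IsIntercritical d α) {t : ℝ}
    (ht : t ∈ I) : (fun t' => ‖fnL (U t') - fnL (U t)‖ ^ 2) =o[𝓝 t] fun t' => t' - t := by
  have hG : ContinuousAt (fun t' => U t' - U t) t := (S.continuousAt ht).sub continuousAt_const
  have h1 := S.inner_sub_isLittleO h ht hG
  simp only [sub_self, weakForm_zero_left, mul_zero, sub_zero, map_sub] at h1
  refine (Asymptotics.isBigO_of_le _ fun t' => ?_).trans_isLittleO h1
  rw [inner_self_eq_norm_sq_to_K]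
  simp

end IsWeakSolution

/-! ### Translations and weights as operators on the Sobolev space. -/

theorem IsWeakDeriv.trans {i : Option (Fin d)} {f g : L2 d} (h : IsWeakDeriv i f g) (z : Guide d) :
    IsWeakDeriv i (Waveguide.trans z f) (Waveguide.trans z g) := by
  rw [isWeakDeriv_iff] at h ⊢
  intro φ hφ
  have e : ∀ {ψ : Guide d → ℂ} (hψ : IsTestFunction ψ) (f : L2 d),
      ⟪hψ.toL2, Waveguide.trans z f⟫_ℂ = ⟪(hψ.translate (-z)).toL2, f⟫_ℂ := by
    intro ψ hψ f
    rw [← trans_toL2, inner_trans_left, neg_neg]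
  rw [e hφ, e (hφ.pderiv i), ← h _ (hφ.translate (-z))]
  congr 1
  exact toL2_congr _ _ (funext fun p => (pderiv_translate i φ (-z) p).symm)

/-- Build a continuous linear map into the Sobolev space. -/
def sobMk (F : Sob d →L[ℂ] L2 d) (G : Option (Fin d) → Sob d →L[ℂ] L2 d)
    (h : ∀ u i, IsWeakDeriv i (F u) (G i u)) : Sob d →L[ℂ] Sob d :=
  (F.prod (ContinuousLinearMap.pi G)).codRestrict (Sob d) fun u i => h u i

@[simp] theorem weakD_sobMk (F : Sob d →L[ℂ] L2 d) (G : Option (Fin d) → Sob d →L[ℂ] L2 d)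
    (h : ∀ u i, IsWeakDeriv i (F u) (G i u)) (u : Sob d) (i : Option (Fin d)) :
    weakD i (sobMk F G h u) = G i u := rfl

/-- Translation on the Sobolev space. -/
def transSob (z : Guide d) : Sob d →L[ℂ] Sob d :=
  sobMk ((trans z).toContinuousLinearMap.comp fnL)
    (fun i => (trans z).toContinuousLinearMap.comp (weakD i))
    fun u i => (isWeakDeriv_weakD i u).trans z

@[simp] theorem fnL_transSob (z : Guide d) (u : Sob d) : fnL (transSob z u) = trans z (fnL u) := rfl

@[simp] theorem weakD_transSob (z : Guide d) (u : Sob d) (i : Option (Fin d)) :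
    weakD i (transSob z u) = trans z (weakD i u) := rfl

theorem norm_eq_of_sob {u v : Sob d} (h0 : ‖fnL u‖ = ‖fnL v‖) (h : ∀ i, ‖weakD i u‖ = ‖weakD i v‖) :
    ‖u‖ = ‖v‖ := by
  have key : ∀ u v : Sob d, ‖fnL u‖ = ‖fnL v‖ → (∀ i, ‖weakD i u‖ = ‖weakD i v‖) → ‖u‖ ≤ ‖v‖ := by
    intro u v h0 h
    refine norm_prod_le_iff.2 ⟨h0.le.trans (norm_fnL_le v), ?_⟩
    exact (pi_norm_le_iff_of_nonneg (norm_nonneg v)).2 fun i => (h i).le.trans (norm_weakD_le i v)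
  exact le_antisymm (key u v h0 h) (key v u h0.symm fun i => (h i).symm)

theorem norm_transSob (z : Guide d) (u : Sob d) : ‖transSob z u‖ = ‖u‖ :=
  norm_eq_of_sob ((trans z).norm_map _) fun _ => (trans z).norm_map _

theorem memLp_wmul (j : Fin d) (m : ℝ →ᵇ ℝ) (g : L2 d) :
    MemLp (fun p : Guide d => (m (p.1 j) : ℂ) * g p) 2 volume :=
  (Lp.memLp g).of_le_mul (c := ‖m‖) (by
      refine AEStronglyMeasurable.mul ?_ (Lp.aestronglyMeasurable g)
      refine Continuous.aestronglyMeasurable ?_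
      exact Complex.continuous_ofReal.comp (m.continuous.comp
        ((EuclideanSpace.proj (𝕜 := ℝ) j).continuous.comp continuous_fst)))
    (Eventually.of_forall fun p => by
      rw [norm_mul, Complex.norm_real]
      gcongr
      exact m.norm_coe_le_norm _)

/-- Multiplication by a bounded continuous function of `x_j`. -/
def wmul (j : Fin d) (m : ℝ →ᵇ ℝ) : L2 d →L[ℂ] L2 d :=
  have hm := memLp_wmul j m
  LinearMap.mkContinuous
    { toFun := fun g => (hm g).toLp _
      map_add' := by
        intro f g
        refine Lp.ext ?_
        filter_upwards [(hm (f + g)).coeFn_toLp, (hm f).coeFn_toLp, (hm g).coeFn_toLp,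
          Lp.coeFn_add f g, Lp.coeFn_add ((hm f).toLp _) ((hm g).toLp _)] with p h1 h2 h3 h4 h5
        rw [h1, h5, Pi.add_apply, h2, h3, h4, Pi.add_apply, mul_add]
      map_smul' := by
        intro c g
        refine Lp.ext ?_
        filter_upwards [(hm (c • g)).coeFn_toLp, (hm g).coeFn_toLp, Lp.coeFn_smul c g,
          Lp.coeFn_smul c ((hm g).toLp _)] with p h1 h2 h3 h4
        rw [h1, RingHom.id_apply, h4, Pi.smul_apply, h2, h3, Pi.smul_apply, smul_eq_mul, smul_eq_mul]
        ring }
    ‖m‖ fun g => by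
      refine Lp.norm_le_mul_norm_of_ae_le_mul ?_
      filter_upwards [(hm g).coeFn_toLp] with p h1
      change ‖(hm g).toLp _ p‖ ≤ _
      rw [h1, norm_mul, Complex.norm_real]
      gcongr
      exact m.norm_coe_le_norm _

theorem coeFn_wmul (j : Fin d) (m : ℝ →ᵇ ℝ) (g : L2 d) :
    wmul j m g =ᵐ[volume] fun p => (m (p.1 j) : ℂ) * g p :=
  MemLp.coeFn_toLp (memLp_wmul j m g)

theorem norm_wmul_le (j : Fin d) (m : ℝ →ᵇ ℝ) (g : L2 d) : ‖wmul j m g‖ ≤ ‖m‖ * ‖g‖ := by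
  refine Lp.norm_le_mul_norm_of_ae_le_mul ?_
  filter_upwards [coeFn_wmul j m g] with p h1
  rw [h1, norm_mul, Complex.norm_real]
  gcongr
  exact m.norm_coe_le_norm _

theorem inner_wmul_left (j : Fin d) (m : ℝ →ᵇ ℝ) (f g : L2 d) :
    ⟪wmul j m f, g⟫_ℂ = ⟪f, wmul j m g⟫_ℂ := by
  rw [inner_eq_integral, inner_eq_integral]
  refine integral_congr_ae ?_
  filter_upwards [coeFn_wmul j m f, coeFn_wmul j m g] with p h1 h2
  rw [h1, h2, star_mul', Complex.star_def, Complex.conj_ofReal]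
  ring

theorem isWeakDeriv_wmul {i : Option (Fin d)} {f g : L2 d} (h : IsWeakDeriv i f g) (j : Fin d)
    {m m' : ℝ →ᵇ ℝ} (hm : ContDiff ℝ ∞ m) (hm' : ∀ t, deriv m t = m' t) :
    IsWeakDeriv i (wmul j m f) (wmul j m g + if i = some j then wmul j m' f else 0) := by
  intro φ hφ
  have h1 := h _ (hφ.weight hm j)
  simp only [pderiv_weight hφ hm, hm'] at h1
  have int : ∀ (f : L2 d) {ψ : Guide d → ℂ}, IsTestFunction ψ → ∀ m : ℝ →ᵇ ℝ,
      Integrable fun p => (m (p.1 j) : ℂ) * f p * ψ p := by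
    intro f ψ hψ m
    have : Integrable fun p => wmul j m f p * ψ p := (Lp.memLp (wmul j m f)).integrable_mul (hψ.memLp 2)
    refine this.congr ?_
    filter_upwards [coeFn_wmul j m f] with p hp
    rw [hp]
  have e1 : ∫ p, wmul j m f p * pderiv i φ p = ∫ p, (m (p.1 j) : ℂ) * f p * pderiv i φ p := by
    refine integral_congr_ae ?_
    filter_upwards [coeFn_wmul j m f] with p hp
    rw [hp]
  by_cases hi : i = some j
  · simp only [hi, if_true] at h1 ⊢ e1
    have e2 : ∫ p, (wmul j m g + wmul j m' f) p * φ p =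
        ∫ p, ((m (p.1 j) : ℂ) * g p * φ p + (m' (p.1 j) : ℂ) * f p * φ p) := by
      refine integral_congr_ae ?_
      filter_upwards [coeFn_wmul j m g, coeFn_wmul j m' f,
        Lp.coeFn_add (wmul j m g) (wmul j m' f)] with p h1 h2 h3
      rw [h3, Pi.add_apply, h1, h2, add_mul]
    have e3 : ∫ p, f p * ((m (p.1 j) : ℂ) * pderiv (some j) φ p + (m' (p.1 j) : ℂ) * φ p) =
        (∫ p, (m (p.1 j) : ℂ) * f p * pderiv (some j) φ p) + ∫ p, (m' (p.1 j) : ℂ) * f p * φ p := by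
      rw [← integral_add (int f (hφ.pderiv _) m) (int f hφ m')]
      congr 1
      funext p
      ring
    have e4 : ∫ p, g p * ((m (p.1 j) : ℂ) * φ p) = ∫ p, (m (p.1 j) : ℂ) * g p * φ p := by
      congr 1
      funext p
      ring
    rw [e3, e4] at h1
    rw [e1, e2, integral_add (int g hφ m) (int f hφ m')]
    linear_combination h1
  · simp only [hi, if_false, add_zero] at h1 ⊢
    rw [e1]
    have e2 : ∫ p, wmul j m g p * φ p = ∫ p, g p * ((m (p.1 j) : ℂ) * φ p) := by
      refine integral_congr_ae ?_
      filter_upwards [coeFn_wmul j m g] with p hp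
      rw [hp]
      ring
    rw [e2, ← h1]
    congr 1
    funext p
    ring

/-- Multiplication by a smooth function of `x_j` on the Sobolev space. -/
def weightSob (j : Fin d) (m m' : ℝ →ᵇ ℝ) (hm : ContDiff ℝ ∞ m) (hm' : ∀ t, deriv m t = m' t) :
    Sob d →L[ℂ] Sob d :=
  sobMk ((wmul j m).comp fnL)
    (fun i => (wmul j m).comp (weakD i) + if i = some j then (wmul j m').comp fnL else 0)
    fun u i => by
      have := isWeakDeriv_wmul (isWeakDeriv_weakD i u) j hm hm'
      split_ifs at this ⊢ <;> exact this

theorem weakD_weightSob (j : Fin d) (m m' : ℝ →ᵇ ℝ) (hm : ContDiff ℝ ∞ m)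
    (hm' : ∀ t, deriv m t = m' t) (u : Sob d) (i : Option (Fin d)) :
    weakD i (weightSob j m m' hm hm' u) =
      wmul j m (weakD i u) + if i = some j then wmul j m' (fnL u) else 0 := by
  rw [weightSob, weakD_sobMk]
  split_ifs <;> rfl

/-! ### The potential energy and conservation of mass. -/

/-- `∫ |u|^{α+2}`. -/
def pot (α : ℝ) (u : Sob d) : ℝ := ∫ p, ‖fnL u p‖ ^ (α + 2)

theorem norm_rpow_add_two {α : ℝ} (hα : 0 < α) (z : ℂ) : ‖z‖ ^ (α + 2) = ‖z‖ * ‖z‖ ^ α * ‖z‖ := by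
  rw [Real.rpow_add' (norm_nonneg z) (by linarith), Real.rpow_two]
  ring

theorem star_mul_nl {α : ℝ} (hα : 0 < α) (z : ℂ) : star z * nl α z = ((‖z‖ ^ (α + 2) : ℝ) : ℂ) := by
  rw [norm_rpow_add_two hα, nl, Complex.star_def]
  have := Complex.conj_mul' z
  push_cast
  linear_combination ((‖z‖ ^ α : ℝ) : ℂ) * this

theorem integrable_pot {α : ℝ} (h : IsIntercritical d α) (u : Sob d) :
    Integrable fun p => ‖fnL u p‖ ^ (α + 2) := by
  simp only [norm_rpow_add_two h.pos]
  exact integrable_trilinear h u u u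

theorem nlForm_self {α : ℝ} (h : IsIntercritical d α) (u : Sob d) : nlForm α u u = (pot α u : ℂ) := by
  rw [nlForm_def, pot, ← integral_complex_ofReal]
  simp only [star_mul_nl h.pos]

theorem continuous_pot {α : ℝ} (h : IsIntercritical d α) : Continuous (pot α : Sob d → ℝ) := by
  have : (pot α : Sob d → ℝ) = fun u => (nlForm α u u).re := by
    funext u
    rw [nlForm_self h, Complex.ofReal_re]
  rw [this]
  exact Complex.continuous_re.comp ((continuous_nlForm h).comp (g := fun q : Sob d × Sob d =>
    nlForm α q.1 q.2) (f := fun u => (u, u)) (continuous_id.prodMk continuous_id))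

/-- The gradient and potential terms are both real, and the weak form carries a factor i; this is
why mass is conserved. -/
theorem weakForm_self_re {α : ℝ} (h : IsIntercritical d α) (u : Sob d) : (weakForm α u u).re = 0 := by
  rw [weakForm_def, nlForm_self h]
  simp [inner_self_eq_norm_sq_to_K, ← Complex.ofReal_pow]

namespace IsWeakSolution

variable {α : ℝ} {I : Set ℝ} {U : ℝ → Sob d}

theorem eqOn_of_deriv_zero (S : IsWeakSolution α I U) {g : ℝ → ℝ}
    (hg : ∀ t ∈ I, HasDerivAt g 0 t) {a b : ℝ} (ha : a ∈ I) (hb : b ∈ I) : g a = g b := by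
  refine S.isOpen.is_const_of_deriv_eq_zero S.ordConnected.isPreconnected
    (fun t ht => (hg t ht).differentiableAt.differentiableWithinAt) (fun t ht => ?_) ha hb
  exact (hg t ht).deriv

/-- Conservation of mass. -/
theorem norm_fnL_eq (S : IsWeakSolution α I U) (h : IsIntercritical d α) {a b : ℝ}
    (ha : a ∈ I) (hb : b ∈ I) : ‖fnL (U a)‖ ^ 2 = ‖fnL (U b)‖ ^ 2 := by
  refine S.eqOn_of_deriv_zero (g := fun t => ‖fnL (U t)‖ ^ 2) (fun t ht => ?_) ha hb
  have := S.hasDerivAt_quadratic h (ContinuousLinearMap.id ℝ (Sob d)) (fun v w => rfl) ht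
  simp only [ContinuousLinearMap.id_apply, weakForm_self_re h, mul_zero] at this
  refine this.congr_of_eventuallyEq (Eventually.of_forall fun s => ?_)
  simp [inner_self_eq_norm_sq_to_K, ← Complex.ofReal_pow]

end IsWeakSolution

/-! ### Solutions in `H1` as weak solutions in `Sob`. -/

/-- An element of `H1 d` as an element of the normed space `Sob d`. -/
def H1.toSob (u : H1 d) : Sob d :=
  ⟨(u.fn, fun i => i.elim u.dy u.dx), by
    rintro (_ | j) φ hφ
    · have := u.2.2 φ hφ
      rw [derivY_eq_pderiv] at this
      exact this
    · have := u.2.1 j φ hφ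
      rw [derivX_eq_pderiv] at this
      exact this⟩

@[simp] theorem H1.fnL_toSob (u : H1 d) : fnL u.toSob = u.fn := rfl

@[simp] theorem H1.weakD_toSob_some (u : H1 d) (j : Fin d) : weakD (some j) u.toSob = u.dx j := rfl

@[simp] theorem H1.weakD_toSob_none (u : H1 d) : weakD none u.toSob = u.dy := rfl

theorem H1.continuous_toSob : Continuous (H1.toSob (d := d)) := by
  refine Continuous.subtype_mk ?_ _
  refine (continuous_fst.comp continuous_subtype_val).prodMk (continuous_pi fun i => ?_)
  rcases i with _ | j
  · exact continuous_snd.comp (continuous_snd.comp continuous_subtype_val)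
  · exact (continuous_apply j).comp
      (continuous_fst.comp (continuous_snd.comp continuous_subtype_val))

/-- Testing with the conjugate of φ turns the bilinear pairing of the equation into the inner
product with φ in the first slot. -/
theorem IsSolution.isWeakSolution {α : ℝ} {I : Set ℝ} {u : ℝ → H1 d} (S : IsSolution α I u) :
    IsWeakSolution α I fun t => (u t).toSob where
  isOpen := S.isOpen
  ordConnected := S.ordConnected
  continuousOn := H1.continuous_toSob.comp_continuousOn S.continuousOn
  weak := by
    intro φ h t ht
    have h1 := S.equation _ h.conj t ht
    simp only [derivX_eq_pderiv, derivY_eq_pderiv, pderiv_conj] at h1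
    have e : ∀ {ψ : Guide d → ℂ} (hψ : IsTestFunction ψ) (f : L2 d),
        ⟪hψ.toL2, f⟫_ℂ = ∫ p, f p * star (ψ p) := by
      intro ψ hψ f
      rw [inner_toL2]
      simp only [mul_comm]
    have e2 : nlForm α h.toSob (u t).toSob =
        ∫ p, ((‖(u t).fn p‖ ^ α : ℝ) : ℂ) * (u t).fn p * star (φ p) := by
      rw [nlForm_def]
      refine integral_congr_ae ?_
      filter_upwards [h.coeFn_toL2] with p hp
      rw [Waveguide.fnL_toSob, hp, H1.fnL_toSob, nl]
      ring
    rw [weakForm_def, Fintype.sum_option, e2]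
    simp only [Waveguide.weakD_toSob, H1.weakD_toSob_some, H1.weakD_toSob_none, H1.fnL_toSob, e]
    convert! h1 using 2
    ring

/-! ### Local smoothing for difference quotients. -/

theorem sliceNorm_trans (r : ℝ≥0∞) (z : Guide d) (g : L2 d) : sliceNorm r (trans z g) = sliceNorm r g := by
  have h1 : ∀ᵐ x : Space d, ∀ᵐ y : Torus, trans z g (x, y) = g ((x, y) + z) :=
    Measure.ae_ae_of_ae_prod (coeFn_trans z g)
  have h2 : ∀ᵐ x : Space d, eLpNorm (fun y : Torus => trans z g (x, y)) 2 volume =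
      eLpNorm (fun y : Torus => g (x + z.1, y)) 2 volume := by
    filter_upwards [h1] with x hx
    rw [eLpNorm_congr_ae hx]
    have := (measurableEmbedding_addRight z.2).eLpNorm_map_measure (μ := (volume : Measure Torus))
      (g := fun y => g (x + z.1, y)) (p := 2)
    rw [map_add_right_eq_self] at this
    rw [this]
    rfl
  rw [sliceNorm, eLpNorm_congr_ae h2]
  have := (measurableEmbedding_addRight z.1).eLpNorm_map_measure (μ := (volume : Measure (Space d)))
    (g := fun x => eLpNorm (fun y : Torus => g (x, y)) 2 volume) (p := r)
  rw [map_add_right_eq_self] at this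
  rw [sliceNorm, this]
  rfl

/-- A weighted `L²` bound on all translates of a derivative passes to the difference quotients. -/
theorem lintegral_diffQ_le {W : Guide d → ℝ≥0∞} (hW : Measurable W) (hWt : ∀ p, W p ≠ ⊤)
    {i : Option (Fin d)} {f g : L2 d}
    (hfg : IsWeakDeriv i f g) {c : ℝ≥0∞}
    (hb : ∀ z, ∫⁻ p, W p * ‖trans z g p‖ₑ ^ (2 : ℝ) ≤ c) {s : ℝ} (hs : 0 < s) :
    ∫⁻ p, W p * ‖diffQ i s f p‖ₑ ^ (2 : ℝ) ≤ c := by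
  -- The difference quotient is the average over σ in (0, s] of translates of `g`. These lie in K, a
  -- ball of a weighted L² seminorm, which is convex, and closed in L² by Fatou; so the average lies
  -- in K too.
  let K : Set (L2 d) := {v | ∫⁻ p, W p * ‖v p‖ₑ ^ (2 : ℝ) ≤ c}
  have hsq : ∀ v : L2 d, ∫⁻ p, W p * ‖v p‖ₑ ^ (2 : ℝ) =
      eLpNorm v 2 (volume.withDensity W) ^ (2 : ℝ) := by
    intro v
    rw [eLpNorm_eq_lintegral_rpow_enorm_toReal (by simp) (by simp), ← ENNReal.rpow_mul,
      lintegral_withDensity_eq_lintegral_mul _ hW ((coeFn_enorm_measurable v).pow_const _)]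
    simp
  have hK : ∀ v : L2 d, v ∈ K ↔ eLpNorm v 2 (volume.withDensity W) ≤ c ^ (2⁻¹ : ℝ) := by
    intro v
    rw [ENNReal.le_rpow_inv_iff two_pos, ← hsq]
    rfl
  have hac : volume.withDensity W ≪ (volume : Measure (Guide d)) := withDensity_absolutelyContinuous _ _
  have hm : ∀ v : L2 d, AEStronglyMeasurable v (volume.withDensity W) := fun v =>
    (Lp.aestronglyMeasurable v).mono_ac hac
  have hconv : Convex ℝ K := by
    intro v hv w hw x y hx hy hxy
    rw [hK] at hv hw ⊢
    have e : (x • v + y • w : L2 d) =ᵐ[volume.withDensity W] x • (v : Guide d → ℂ) + y • (w : Guide d → ℂ) := by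
      refine hac.ae_le ?_
      filter_upwards [Lp.coeFn_add (x • v) (y • w), Lp.coeFn_smul x v, Lp.coeFn_smul y w] with p h1 h2 h3
      rw [h1, Pi.add_apply, h2, h3, Pi.add_apply]
    rw [eLpNorm_congr_ae e]
    refine (eLpNorm_add_le ((hm v).const_smul x) ((hm w).const_smul y) (by norm_num)).trans ?_
    rw [eLpNorm_const_smul, eLpNorm_const_smul]
    calc _ ≤ ‖x‖ₑ * c ^ (2⁻¹ : ℝ) + ‖y‖ₑ * c ^ (2⁻¹ : ℝ) := by gcongr
      _ = _ := by
        rw [← add_mul, Real.enorm_eq_ofReal hx, Real.enorm_eq_ofReal hy, ← ENNReal.ofReal_add hx hy, hxy]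
        simp
  have hcl : IsClosed K := by
    refine IsSeqClosed.isClosed fun v w hv hvw => ?_
    obtain ⟨n, -, hn⟩ := (tendstoInMeasure_of_tendsto_Lp hvw).exists_seq_tendsto_ae
    calc ∫⁻ p, W p * ‖w p‖ₑ ^ (2 : ℝ)
        ≤ ∫⁻ p, liminf (fun k => W p * ‖v (n k) p‖ₑ ^ (2 : ℝ)) atTop := by
          refine lintegral_mono_ae ?_
          filter_upwards [hn] with p hp
          have h2 : Tendsto (fun k => ‖v (n k) p‖ₑ ^ (2 : ℝ)) atTop (𝓝 (‖w p‖ₑ ^ (2 : ℝ))) :=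
            (ENNReal.continuous_rpow_const.tendsto _).comp ((continuous_enorm.tendsto _).comp hp)
          exact (ENNReal.Tendsto.const_mul h2 (Or.inr (hWt p))).liminf_eq.ge
      _ ≤ liminf (fun k => ∫⁻ p, W p * ‖v (n k) p‖ₑ ^ (2 : ℝ)) atTop :=
          lintegral_liminf_le fun k => hW.mul ((coeFn_enorm_measurable _).pow_const _)
      _ ≤ c := by
          refine liminf_le_of_frequently_le' (Frequently.of_forall fun k => hv _)
  have hc : Continuous fun σ : ℝ => trans (shift i σ) g := (continuous_trans g).comp (continuous_shift i)
  have havg : ⨍ σ in Ioc 0 s, trans (shift i σ) g ∈ K :=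
    hconv.set_average_mem hcl (by simp [hs]) (by simp) (ae_of_all _ fun σ => hb _)
      (hc.integrableOn_Ioc)
  have e : diffQ i s f = ⨍ σ in Ioc 0 s, trans (shift i σ) g := by
    rw [diffQ, trans_shift_sub hfg, setAverage_eq, intervalIntegral.integral_of_le hs.le, ← Complex.ofReal_inv]
    rw [Real.volume_real_Ioc_of_le hs.le, sub_zero]
    exact (RCLike.real_smul_eq_coe_smul (K := ℂ) _ _).symm
  rw [e]
  exact havg

/-- Local smoothing: difference quotients are locally in `L²` in time, in the weighted space
with weight `|u|^a`. -/
def HasSmoothing (a : ℝ) (I : Set ℝ) (U : ℝ → Sob d) : Prop :=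
  ∀ t₀ ∈ I, ∀ t₁ ∈ I, ∀ i, ∃ h : ℝ → ℝ≥0∞, ∫⁻ t in Icc t₀ t₁, h t ≠ ⊤ ∧ ∀ t ∈ Icc t₀ t₁, ∀ s > 0,
    ∫⁻ p, ‖fnL (U t) p‖ₑ ^ a * ‖diffQ i s (fnL (U t)) p‖ₑ ^ (2 : ℝ) ≤ h t ∧
    ∫⁻ p, ‖trans (shift i s) (fnL (U t)) p‖ₑ ^ a * ‖diffQ i s (fnL (U t)) p‖ₑ ^ (2 : ℝ) ≤ h t

theorem hasSmoothing_of_mixedNorm {a : ℝ} (h : IsIntercritical d a) {I : Set ℝ} {U : ℝ → Sob d}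
    (hI : I.OrdConnected) (hU : ContinuousOn U I)
    (hmix : ∀ t₀ ∈ I, ∀ t₁ ∈ I, ∀ q r : ℝ≥0∞, Admissible d q r → ∀ i,
      mixedNorm q r (Icc t₀ t₁) (fun t => weakD i (U t)) < ⊤) : HasSmoothing a I U := by
  intro t₀ h0 t₁ h1 i
  obtain ⟨q, r, hqr, hq, C, hC, hb⟩ := exists_weighted_admissible h.one_le h.lower h.upper
  obtain ⟨M, hM⟩ := (isCompact_Icc (a := t₀) (b := t₁)).exists_bound_of_continuousOn
    (hU.mono (hI.out h0 h1))
  -- The summands 1 keep D nonzero, so that the bound is trivial (its right-hand side is ∞) at times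
  -- where the slice norm is infinite.
  let D : ℝ≥0∞ := (C + 1) * (ENNReal.ofReal M + 1) ^ a
  have hD : D ≠ ⊤ := ENNReal.mul_ne_top (by simp [hC]) (ENNReal.rpow_ne_top_of_nonneg h.pos.le (by simp))
  have hD0 : D ≠ 0 := mul_ne_zero (by simp) (by
    rw [Ne, ENNReal.rpow_eq_zero_iff]
    simp)
  have hq0 : 2 ≤ q.toReal := by
    have := ENNReal.toReal_mono hq hqr.1
    simpa using this
  have hmem : ∀ w v : Sob d, ‖w‖ ≤ M → ∀ z,
      ∫⁻ p, ‖fnL w p‖ₑ ^ a * ‖trans z (weakD i v) p‖ₑ ^ (2 : ℝ) ≤ D * sliceNorm r (weakD i v) ^ (2 : ℝ) := by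
    intro w v hw z
    by_cases htop : sliceNorm r (weakD i v) = ⊤
    · rw [htop, ENNReal.top_rpow_of_pos (by norm_num), ENNReal.mul_top hD0]
      exact le_top
    · refine (hb w _ (by rwa [sliceNorm_trans])).trans ?_
      rw [sliceNorm_trans]
      have h3 : ‖w‖ₑ ≤ ENNReal.ofReal M + 1 := by
        rw [← ofReal_norm]
        exact (ENNReal.ofReal_le_ofReal hw).trans le_self_add
      exact mul_le_mul' (mul_le_mul' le_self_add (ENNReal.rpow_le_rpow h3 h.pos.le)) le_rfl
  refine ⟨fun t => D * sliceNorm r (weakD i (U t)) ^ (2 : ℝ), ?_, fun t ht s hs => ⟨?_, ?_⟩⟩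
  · rw [lintegral_const_mul' _ _ hD]
    refine ENNReal.mul_ne_top hD ?_
    have h2 := hmix t₀ h0 t₁ h1 q r hqr i
    rw [mixedNorm, eLpNorm_lt_top_iff_lintegral_rpow_enorm_lt_top (by
      rintro rfl
      simp at hq0
      linarith) hq] at h2
    have h3 : ∫⁻ t in Icc t₀ t₁, (1 + sliceNorm r (weakD i (U t)) ^ q.toReal) < ⊤ := by
      rw [lintegral_add_left measurable_const]
      exact ENNReal.add_lt_top.2 ⟨by simp, h2⟩
    -- On a bounded time interval L^q bounds L² for q ≥ 2: pointwise Y² ≤ 1 + Y^q.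
    refine (lt_of_le_of_lt (lintegral_mono fun t => ?_) h3).ne
    rcases le_total (sliceNorm r (weakD i (U t))) 1 with h4 | h4
    · exact (ENNReal.rpow_le_one h4 (by norm_num)).trans le_self_add
    · exact (ENNReal.rpow_le_rpow_of_exponent_le h4 hq0).trans le_add_self
  · exact lintegral_diffQ_le ((coeFn_enorm_measurable _).pow_const _)
      (fun p => ENNReal.rpow_ne_top_of_nonneg h.pos.le enorm_ne_top) (isWeakDeriv_weakD i _)
      (hmem _ _ (hM t ht)) hs
  -- Here the weight comes from a translate of `U t`, which has the same H¹ norm.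
  · exact lintegral_diffQ_le ((coeFn_enorm_measurable _).pow_const _)
      (fun p => ENNReal.rpow_ne_top_of_nonneg h.pos.le enorm_ne_top) (isWeakDeriv_weakD i _)
      (hmem (transSob (shift i s) (U t)) (U t) ((norm_transSob _ _).trans_le (hM t ht))) hs

theorem IsSolution.hasSmoothing {α a : ℝ} {I : Set ℝ} {u : ℝ → H1 d} (S : IsSolution α I u)
    (h : IsIntercritical d a) : HasSmoothing a I fun t => (u t).toSob := by
  refine hasSmoothing_of_mixedNorm h S.ordConnected S.isWeakSolution.continuousOn
    fun t₀ h0 t₁ h1 q r hqr i => ?_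
  obtain ⟨-, h2, h3⟩ := S.memXloc t₀ h0 t₁ h1 q r hqr
  rcases i with _ | j
  · exact h3
  · exact h2 j

/-! ### Pointwise inequalities for the nonlinearity and its truncation. -/

theorem rpow_add_two_eq {α A : ℝ} (hα : 0 < α) (hA : 0 ≤ A) : A ^ (α + 2) = A ^ α * A ^ 2 := by
  rw [Real.rpow_add' hA (by linarith), Real.rpow_two]

/-- Young's inequality in the form of a tangent bound for `r ↦ r^{(α+2)/α}`. -/
theorem sq_mul_rpow_sub_le {α A B : ℝ} (hα : 0 < α) (hA : 0 ≤ A) (hB : 0 ≤ B) :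
    A ^ 2 * (B ^ α - A ^ α) ≤ α / (α + 2) * (B ^ (α + 2) - A ^ (α + 2)) := by
  have h2 : 0 < α + 2 := by linarith
  have h := Real.geom_mean_le_arith_mean2_weighted (w₁ := α / (α + 2)) (w₂ := 2 / (α + 2))
    (p₁ := B ^ (α + 2)) (p₂ := A ^ (α + 2)) (by positivity) (by positivity) (by positivity)
    (by positivity) (by field_simp)
  rw [← Real.rpow_mul hB, ← Real.rpow_mul hA, mul_div_cancel₀ α h2.ne', mul_div_cancel₀ 2 h2.ne',
    Real.rpow_two] at h
  have e : 2 / (α + 2) = 1 - α / (α + 2) := by field_simp; ring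
  rw [e] at h
  have := rpow_add_two_eq hα hA
  nlinarith

theorem two_mul_re_star_mul (a b : ℂ) : 2 * (star a * b).re = ‖a‖ ^ 2 + ‖b‖ ^ 2 - ‖b - a‖ ^ 2 := by
  simp only [← Complex.normSq_eq_norm_sq, Complex.normSq_apply, Complex.star_def, Complex.mul_re,
    Complex.conj_re, Complex.conj_im, Complex.sub_re, Complex.sub_im]
  ring

theorem re_star_mul_le (a b : ℂ) : (star a * b).re ≤ ‖a‖ * ‖b‖ := by
  have := Complex.re_le_norm (star a * b)
  rwa [norm_mul, norm_star] at this

/-- The nonlinear virial density is an exact difference up to a quadratic error. -/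
theorem abs_re_star_mul_rpow_sub_le {α : ℝ} (hα : 0 < α) (a b : ℂ) :
    |(star a * b).re * (‖b‖ ^ α - ‖a‖ ^ α) - α / (α + 2) * (‖b‖ ^ (α + 2) - ‖a‖ ^ (α + 2))| ≤
      (2 + α) * (‖a‖ ^ α + ‖b‖ ^ α) * ‖b - a‖ ^ 2 := by
  have key : ∀ a b : ℂ, ‖a‖ ≤ ‖b‖ →
      |(star a * b).re * (‖b‖ ^ α - ‖a‖ ^ α) - α / (α + 2) * (‖b‖ ^ (α + 2) - ‖a‖ ^ (α + 2))| ≤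
      (2 + α) * (‖a‖ ^ α + ‖b‖ ^ α) * ‖b - a‖ ^ 2 := by
    intro a b hab
    -- The two tangent bounds place X between |a|²δ and |b|²δ, whose gap is of the order |b|^α |b -
    -- a|². Since Re(āb) is the mean of |a|² and |b|² minus |b - a|²/2, the product Re(āb)δ agrees
    -- with X up to such errors.
    have h1 := sq_mul_rpow_sub_le hα (norm_nonneg a) (norm_nonneg b)
    have h2 := sq_mul_rpow_sub_le hα (norm_nonneg b) (norm_nonneg a)
    have h3 := mul_rpow_sub_rpow_le hα (norm_nonneg a) hab
    have h4 := two_mul_re_star_mul a b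
    have h5 := norm_sub_norm_le b a
    have hA : 0 ≤ ‖a‖ ^ α := by positivity
    have hmono : ‖a‖ ^ α ≤ ‖b‖ ^ α := Real.rpow_le_rpow (norm_nonneg a) hab hα.le
    set δ := ‖b‖ ^ α - ‖a‖ ^ α with hδ
    have hδ0 : 0 ≤ δ := sub_nonneg.2 hmono
    have hδ1 : δ ≤ ‖b‖ ^ α := by linarith
    set X := α / (α + 2) * (‖b‖ ^ (α + 2) - ‖a‖ ^ (α + 2)) with hX
    have e1 : X ≤ ‖b‖ ^ 2 * δ := by
      have : α / (α + 2) * (‖a‖ ^ (α + 2) - ‖b‖ ^ (α + 2)) = -X := by ring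
      rw [this, ← neg_sub (‖b‖ ^ α)] at h2
      linarith
    have hgap : (‖b‖ ^ 2 - ‖a‖ ^ 2) * δ ≤ 2 * (1 + α) * ‖b‖ ^ α * ‖b - a‖ ^ 2 := by
      have hba : 0 ≤ ‖b‖ - ‖a‖ := sub_nonneg.2 hab
      calc (‖b‖ ^ 2 - ‖a‖ ^ 2) * δ = (‖b‖ - ‖a‖) * ((‖b‖ + ‖a‖) * δ) := by ring
        _ ≤ (‖b‖ - ‖a‖) * ((‖b‖ + ‖b‖) * δ) := by gcongr
        _ = 2 * ((‖b‖ - ‖a‖) * (‖b‖ * δ)) := by ring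
        _ ≤ 2 * ((‖b‖ - ‖a‖) * ((1 + α) * ‖b‖ ^ α * (‖b‖ - ‖a‖))) := by gcongr
        _ = 2 * (1 + α) * ‖b‖ ^ α * (‖b‖ - ‖a‖) ^ 2 := by ring
        _ ≤ _ := by gcongr
    have e2 : (star a * b).re * δ = (‖a‖ ^ 2 + ‖b‖ ^ 2) / 2 * δ - ‖b - a‖ ^ 2 / 2 * δ := by
      rw [← sub_mul]
      congr 1
      linarith
    have e3 : ‖b - a‖ ^ 2 / 2 * δ ≤ ‖b - a‖ ^ 2 / 2 * ‖b‖ ^ α := by gcongr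
    have e4 : 0 ≤ ‖b - a‖ ^ 2 / 2 * δ := by positivity
    have e5 : 0 ≤ ‖a‖ ^ α * ‖b - a‖ ^ 2 := by positivity
    have e6 : 0 ≤ ‖b‖ ^ α * ‖b - a‖ ^ 2 := by positivity
    rw [e2, abs_le]
    constructor <;> nlinarith
  rcases le_total ‖a‖ ‖b‖ with h | h
  · exact key a b h
  · have := key b a h
    have e : (star b * a).re = (star a * b).re := by
      simp only [Complex.star_def, Complex.mul_re, Complex.conj_re, Complex.conj_im]
      ring
    rw [e, norm_sub_rev a b, add_comm (‖b‖ ^ α), ← abs_neg] at this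
    convert this using 2
    ring

/-- The nonlinearity, truncated at height `k`. -/
def truncNl (α k : ℝ) (z : ℂ) : ℂ := (((min ‖z‖ k) ^ α : ℝ) : ℂ) * z

/-- A primitive of the truncated nonlinearity. -/
def truncDens (α k : ℝ) (z : ℂ) : ℝ :=
  1 / 2 * (min ‖z‖ k) ^ α * ‖z‖ ^ 2 - α / (α + 2) / 2 * (min ‖z‖ k) ^ (α + 2)

theorem norm_truncNl_sub_le {α k : ℝ} (hα : 0 < α) (hk : 0 ≤ k) (a b : ℂ) :
    ‖truncNl α k b - truncNl α k a‖ ≤ (2 + α) * k ^ α * ‖b - a‖ := by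
  have hmin : ∀ r : ℝ, 0 ≤ r → 0 ≤ min r k := fun r hr => le_min hr hk
  have hle : ∀ r : ℝ, 0 ≤ r → (min r k) ^ α ≤ k ^ α := fun r hr =>
    Real.rpow_le_rpow (hmin r hr) (min_le_right _ _) hα.le
  have h := norm_weighted_sub_le (θ := fun r => (min r k) ^ α) (c := k ^ α)
    (K := (1 + α) * k ^ α) (a := a) (b := b) (fun r hr => Real.rpow_nonneg (hmin r hr) _)
    (hle _ (le_max_of_le_left (norm_nonneg a))) fun A B hA hAB _ => by
      have hmono : min A k ≤ min B k := min_le_min_right k hAB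
      rw [abs_of_nonneg (sub_nonneg.2 (Real.rpow_le_rpow (hmin A hA) hmono hα.le))]
      rcases le_total A k with h1 | h1
      · have h2 := mul_rpow_sub_rpow_le hα (hmin A hA) hmono
        have h3 : min A k = A := min_eq_left h1
        rw [h3] at h2 hmono ⊢
        have h4 := Real.rpow_le_rpow hA hmono hα.le
        calc A * ((min B k) ^ α - A ^ α) ≤ min B k * ((min B k) ^ α - A ^ α) := by gcongr
          _ ≤ (1 + α) * (min B k) ^ α * (min B k - A) := h2
          _ ≤ (1 + α) * k ^ α * (B - A) := by
              have := hle B (hA.trans hAB)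
              have := hmin B (hA.trans hAB)
              gcongr
              exact min_le_left _ _
      · rw [min_eq_right h1, min_eq_right (h1.trans hAB), sub_self, mul_zero]
        have := sub_nonneg.2 hAB
        positivity
  refine h.trans (le_of_eq ?_)
  ring

theorem truncNl_zero (α k : ℝ) : truncNl α k 0 = 0 := by simp [truncNl]

theorem lipschitzWith_truncNl {α k : ℝ} (hα : 0 < α) (hk : 0 ≤ k) :
    LipschitzWith (((2 + α) * k ^ α).toNNReal) (truncNl α k) :=
  LipschitzWith.of_dist_le_mul fun b a => by
    rw [dist_eq_norm, dist_eq_norm, Real.coe_toNNReal _ (by positivity)]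
    exact norm_truncNl_sub_le hα hk a b

/-- `truncDens` is a convex radial function with gradient `truncNl`, and this is its subgradient
inequality. Bounding Re(āb) by (|a|² + |b|²)/2 reduces it to a radial statement, which is Young's
inequality, supplemented by monotonicity of the truncated power when |b| > k. -/
theorem re_truncNl_mul_sub_le {α k : ℝ} (hα : 0 < α) (hk : 0 ≤ k) (a b : ℂ) :
    (star (truncNl α k a) * (b - a)).re ≤ truncDens α k b - truncDens α k a := by
  have e : (star (truncNl α k a) * (b - a)).re =
      (min ‖a‖ k) ^ α * ((star a * b).re - ‖a‖ ^ 2) := by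
    rw [truncNl, star_mul', Complex.star_def, Complex.conj_ofReal, mul_assoc, Complex.re_ofReal_mul,
      mul_sub, Complex.sub_re, Complex.conj_mul', ← Complex.ofReal_pow, Complex.ofReal_re]
  have hA0 : 0 ≤ min ‖a‖ k := le_min (norm_nonneg a) hk
  have hB0 : 0 ≤ min ‖b‖ k := le_min (norm_nonneg b) hk
  have h1 : (star a * b).re - ‖a‖ ^ 2 ≤ (‖b‖ ^ 2 - ‖a‖ ^ 2) / 2 := by
    have := two_mul_re_star_mul a b
    nlinarith [sq_nonneg ‖b - a‖]
  have hθ : 0 ≤ (min ‖a‖ k) ^ α := by positivity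
  suffices h : α / (α + 2) * ((min ‖b‖ k) ^ (α + 2) - (min ‖a‖ k) ^ (α + 2)) ≤
      ((min ‖b‖ k) ^ α - (min ‖a‖ k) ^ α) * ‖b‖ ^ 2 by
    rw [e, truncDens, truncDens]
    nlinarith
  have hy := sq_mul_rpow_sub_le hα hB0 hA0
  rcases le_total ‖b‖ k with hbk | hbk
  · rw [min_eq_left hbk] at hy ⊢
    nlinarith
  · rw [min_eq_right hbk] at hy ⊢
    have h2 : (min ‖a‖ k) ^ α ≤ k ^ α := Real.rpow_le_rpow hA0 (min_le_right _ _) hα.le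
    have h3 : k ^ 2 ≤ ‖b‖ ^ 2 := by gcongr
    nlinarith

/-- Convexity makes the first-order remainder nonnegative. Adding the tangent inequality at the
other endpoint and using the Lipschitz bound for `truncNl` controls it from above. -/
theorem abs_truncDens_sub_le {α k : ℝ} (hα : 0 < α) (hk : 0 ≤ k) (a b : ℂ) :
    |truncDens α k b - truncDens α k a - (star (truncNl α k a) * (b - a)).re| ≤
      (2 + α) * k ^ α * ‖b - a‖ ^ 2 := by
  have h1 := re_truncNl_mul_sub_le hα hk a b
  have h2 := re_truncNl_mul_sub_le hα hk b a
  rw [abs_of_nonneg (by linarith)]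
  have h3 : (star (truncNl α k b - truncNl α k a) * (b - a)).re ≤
      (2 + α) * k ^ α * ‖b - a‖ * ‖b - a‖ :=
    (re_star_mul_le _ _).trans (by gcongr; exact norm_truncNl_sub_le hα hk a b)
  have h4 : (star (truncNl α k b - truncNl α k a) * (b - a)).re =
      -(star (truncNl α k b) * (a - b)).re - (star (truncNl α k a) * (b - a)).re := by
    rw [star_sub, ← neg_sub b a, mul_neg, Complex.neg_re, sub_mul, Complex.sub_re]
    ring
  nlinarith

theorem truncDens_nonneg {α k : ℝ} (hα : 0 < α) (hk : 0 ≤ k) (z : ℂ) : 0 ≤ truncDens α k z := by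
  have h := re_truncNl_mul_sub_le hα hk 0 z
  have h0 : truncDens α k 0 = 0 := by
    simp [truncDens, min_eq_left hk, Real.zero_rpow (by linarith : α + 2 ≠ 0)]
  simp only [truncNl_zero, star_zero, zero_mul, Complex.zero_re, h0, sub_zero] at h
  exact h

theorem truncDens_le {α k : ℝ} (hα : 0 < α) (hk : 0 ≤ k) (z : ℂ) :
    truncDens α k z ≤ ‖z‖ ^ (α + 2) / (α + 2) := by
  have hA0 : 0 ≤ min ‖z‖ k := le_min (norm_nonneg z) hk
  have hy := sq_mul_rpow_sub_le hα (norm_nonneg z) hA0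
  have h1 := rpow_add_two_eq hα (norm_nonneg z)
  have h2 : ‖z‖ ^ (α + 2) / (α + 2) = 1 / 2 * (‖z‖ ^ (α + 2) - α / (α + 2) * ‖z‖ ^ (α + 2)) := by
    field_simp
    ring
  rw [h2, truncDens]
  nlinarith

theorem truncDens_le_sq {α k : ℝ} (hα : 0 < α) (hk : 0 ≤ k) (z : ℂ) :
    truncDens α k z ≤ k ^ α * ‖z‖ ^ 2 := by
  have hA0 : 0 ≤ min ‖z‖ k := le_min (norm_nonneg z) hk
  have h1 : (min ‖z‖ k) ^ α ≤ k ^ α := Real.rpow_le_rpow hA0 (min_le_right _ _) hα.le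
  have h2 : 0 ≤ α / (α + 2) / 2 * (min ‖z‖ k) ^ (α + 2) := by positivity
  have h3 : (min ‖z‖ k) ^ α * ‖z‖ ^ 2 ≤ k ^ α * ‖z‖ ^ 2 := by gcongr
  have h4 : 0 ≤ (min ‖z‖ k) ^ α * ‖z‖ ^ 2 := by positivity
  rw [truncDens]
  linarith

theorem truncDens_eq {α k : ℝ} (hα : 0 < α) {z : ℂ} (hz : ‖z‖ ≤ k) :
    truncDens α k z = ‖z‖ ^ (α + 2) / (α + 2) := by
  rw [truncDens, min_eq_left hz, rpow_add_two_eq hα (norm_nonneg z)]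
  field_simp
  ring

theorem continuous_truncDens {α k : ℝ} (hα : 0 < α) : Continuous (truncDens α k) := by
  have h : Continuous fun z : ℂ => min ‖z‖ k := continuous_norm.min continuous_const
  exact ((continuous_const.mul (h.rpow_const fun _ => Or.inr hα.le)).mul (continuous_norm.pow 2)).sub
    (continuous_const.mul (h.rpow_const fun _ => Or.inr (by linarith)))

theorem rpow_le_rpow_neg_mul {α δ k B : ℝ} (hk : 0 < k) (hδ : 0 ≤ δ) (hB : k ≤ B) :
    B ^ α ≤ k ^ (-δ) * B ^ (α + δ) := by
  have hB0 : 0 < B := hk.trans_le hB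
  rw [Real.rpow_add hB0, Real.rpow_neg hk.le, ← mul_assoc, mul_comm _ (B ^ α), mul_assoc]
  refine le_mul_of_one_le_right (by positivity) ?_
  rw [← div_eq_inv_mul, one_le_div (by positivity)]
  exact Real.rpow_le_rpow hk.le hB hδ

/-- The two nonlinearities agree where |z| ≤ k, and B^α ≤ k^{-δ} B^{α+δ} for B ≥ k. Removing the
truncation therefore gains k^{-δ} at the price of a slightly larger exponent. -/
theorem norm_nl_sub_truncNl_sub_le {α δ k : ℝ} (hα : 0 < α) (hδ : 0 ≤ δ) (hk : 0 < k) (a b : ℂ) :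
    ‖(nl α b - nl α a) - (truncNl α k b - truncNl α k a)‖ ≤
      (2 + α) * k ^ (-δ) * (‖a‖ ^ (α + δ) + ‖b‖ ^ (α + δ)) * ‖b - a‖ := by
  set c := k ^ (-δ) * (‖a‖ ^ (α + δ) + ‖b‖ ^ (α + δ)) with hc
  have hc0 : 0 ≤ c := by positivity
  have hmin : ∀ r : ℝ, 0 ≤ r → 0 ≤ min r k := fun r hr => le_min hr hk.le
  have hmaxc : ∀ B, k ≤ B → B ≤ max ‖a‖ ‖b‖ → B ^ α ≤ c := by
    intro B h1 h2
    refine (rpow_le_rpow_neg_mul hk hδ h1).trans ?_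
    rw [hc]
    gcongr
    refine (Real.rpow_le_rpow (hk.le.trans h1) h2 (by linarith)).trans ?_
    rcases max_choice ‖a‖ ‖b‖ with h | h <;> rw [h]
    · exact le_add_of_nonneg_right (by positivity)
    · exact le_add_of_nonneg_left (by positivity)
  have h := norm_weighted_sub_le (θ := fun r => r ^ α - (min r k) ^ α) (c := c)
    (K := (1 + α) * c) (a := a) (b := b)
    (fun r hr => sub_nonneg.2 (Real.rpow_le_rpow (hmin r hr) (min_le_left _ _) hα.le)) ?_ ?_
  · calc _ = ‖(((‖b‖ ^ α - (min ‖b‖ k) ^ α : ℝ)) : ℂ) * b - ((‖a‖ ^ α - (min ‖a‖ k) ^ α : ℝ) : ℂ) * a‖ := by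
          congr 1
          simp only [nl, truncNl]
          push_cast
          ring
      _ ≤ (c + (1 + α) * c) * ‖b - a‖ := h
      _ = _ := by rw [hc]; ring
  · rcases le_total (max ‖a‖ ‖b‖) k with h | h
    · simpa only [min_eq_left h, sub_self] using hc0
    · refine (sub_le_self _ (Real.rpow_nonneg (hmin _ (hk.le.trans h)) _)).trans (hmaxc _ h le_rfl)
  · intro A B hA hAB hB
    rcases le_total B k with h | h
    · simp only [min_eq_left h, min_eq_left (hAB.trans h), sub_self, abs_zero, mul_zero]
      have := sub_nonneg.2 hAB
      positivity
    · have h1 : |B ^ α - (min B k) ^ α - (A ^ α - (min A k) ^ α)| ≤ B ^ α - A ^ α := by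
        rw [min_eq_right h]
        have h2 : (min A k) ^ α ≤ k ^ α := Real.rpow_le_rpow (hmin A hA) (min_le_right _ _) hα.le
        have h3 : k ^ α ≤ B ^ α := Real.rpow_le_rpow hk.le h hα.le
        have h4 : A ^ α ≤ B ^ α := Real.rpow_le_rpow hA hAB hα.le
        rw [abs_le]
        constructor
        · rcases le_total A k with h5 | h5
          · rw [min_eq_left h5]
            linarith
          · rw [min_eq_right h5]
            linarith
        · linarith
      calc A * |B ^ α - (min B k) ^ α - (A ^ α - (min A k) ^ α)| ≤ B * (B ^ α - A ^ α) :=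
            mul_le_mul hAB h1 (abs_nonneg _) (hA.trans hAB)
        _ ≤ (1 + α) * B ^ α * (B - A) := mul_rpow_sub_rpow_le hα hA hAB
        _ ≤ _ := by
            have := sub_nonneg.2 hAB
            gcongr
            exact hmaxc B h hB

/-! ### Conservation of energy. -/

theorem integral_trans_neg_left {E : Type*} [NormedAddCommGroup E] [NormedSpace ℝ E] (F : ℂ → ℂ → E)
    (z : Guide d) (f g : L2 d) :
    ∫ p, F (trans (-z) f p) (g p) = ∫ p, F (f p) (trans z g p) := by
  rw [← integral_add_right_eq_self _ z]
  refine integral_congr_ae ?_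
  filter_upwards [coeFn_trans z g, ae_translate (coeFn_trans (-z) f) z] with p h1 h2
  rw [h1, h2, add_neg_cancel_right]

theorem nlForm_transSob_neg {α : ℝ} (z : Guide d) (u v : Sob d) :
    nlForm α (transSob (-z) u) v = nlForm α u (transSob z v) := by
  rw [nlForm_def, nlForm_def]
  exact integral_trans_neg_left (fun a b => star a * nl α b) z _ _

/-- Minus the symmetric second difference along `z`. -/
def secDiff (z : Guide d) : Sob d →L[ℂ] Sob d :=
  (ContinuousLinearMap.id ℂ _ - transSob z) + (ContinuousLinearMap.id ℂ _ - transSob (-z))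

theorem secDiff_apply (z : Guide d) (u : Sob d) :
    secDiff z u = (u - transSob z u) + (u - transSob (-z) u) := rfl

theorem inner_secDiff_left (z : Guide d) (f g : L2 d) :
    ⟪(f - trans z f) + (f - trans (-z) f), g⟫_ℂ = ⟪f, (g - trans z g) + (g - trans (-z) g)⟫_ℂ := by
  simp only [inner_add_left, inner_add_right, inner_sub_left, inner_sub_right, inner_trans_left,
    neg_neg]
  ring

theorem inner_secDiff_self (z : Guide d) (f : L2 d) :
    ⟪(f - trans z f) + (f - trans (-z) f), f⟫_ℂ = ((‖trans z f - f‖ ^ 2 : ℝ) : ℂ) := by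
  have h : ⟪trans z f - f, trans z f - f⟫_ℂ = ((‖trans z f - f‖ ^ 2 : ℝ) : ℂ) := by
    rw [inner_self_eq_norm_sq_to_K]
    simp
  have h2 : ⟪trans z f, f⟫_ℂ = ⟪f, trans (-z) f⟫_ℂ := inner_trans_left z f f
  have h3 : ⟪trans (-z) f, f⟫_ℂ = ⟪f, trans z f⟫_ℂ := by rw [inner_trans_left, neg_neg]
  rw [← h]
  simp only [inner_add_left, inner_sub_left, inner_sub_right, (trans z).inner_map_map, h3]
  ring

theorem integrable_incr {α : ℝ} (h : IsIntercritical d α) (v u : Sob d) :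
    Integrable fun p => star (fnL v p - fnL u p) * (nl α (fnL v p) - nl α (fnL u p)) := by
  have := ((integrable_nlForm h v v).sub (integrable_nlForm h u v)).sub
    ((integrable_nlForm h v u).sub (integrable_nlForm h u u))
  refine this.congr (Eventually.of_forall fun p => ?_)
  simp only [Pi.sub_apply, star_sub]
  ring

theorem integral_incr {α : ℝ} (h : IsIntercritical d α) (v u : Sob d) :
    ∫ p, star (fnL v p - fnL u p) * (nl α (fnL v p) - nl α (fnL u p)) =
      nlForm α v v - nlForm α u v - (nlForm α v u - nlForm α u u) := by
  simp only [nlForm_def]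
  have i : ∀ w : Sob d, Integrable fun p =>
      star (fnL v p) * nl α (fnL w p) - star (fnL u p) * nl α (fnL w p) := fun w =>
    (integrable_nlForm h v w).sub (integrable_nlForm h u w)
  rw [← integral_sub (integrable_nlForm h v v) (integrable_nlForm h u v),
    ← integral_sub (integrable_nlForm h v u) (integrable_nlForm h u u), ← integral_sub (i v) (i u)]
  congr 1
  funext p
  simp only [star_sub]
  ring

/-- The gradient terms of a second difference are real and disappear behind the factor i.
Translation invariance of the nonlinear form sums the rest by parts into an integral of products of
two increments, the shape that local smoothing controls. -/
theorem weakForm_secDiff_re {α : ℝ} (h : IsIntercritical d α) (z : Guide d) (u : Sob d) :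
    (weakForm α (secDiff z u) u).re = -(∫ p, star (trans z (fnL u) p - fnL u p) *
      (nl α (trans z (fnL u) p) - nl α (fnL u p))).im := by
  have h1 := integral_incr h (transSob z u) u
  rw [fnL_transSob] at h1
  have h2 : nlForm α (transSob z u) (transSob z u) = nlForm α u u := by
    rw [← nlForm_transSob_neg]
    congr 1
    refine Subtype.ext (Prod.ext ?_ (funext fun i => ?_))
    · change trans (-z) (trans z (fnL u)) = fnL u
      rw [trans_trans, neg_add_cancel, trans_zero]
    · change trans (-z) (trans z (weakD i u)) = weakD i u
      rw [trans_trans, neg_add_cancel, trans_zero]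
  have h3 : (∑ i, ⟪weakD i (secDiff z u), weakD i u⟫_ℂ).im = 0 := by
    rw [Complex.im_sum]
    refine Finset.sum_eq_zero fun i _ => ?_
    simp only [secDiff_apply, map_add, map_sub, weakD_transSob]
    rw [inner_secDiff_self, Complex.ofReal_im]
  rw [h1, h2, weakForm_def, Complex.I_mul_re, Complex.add_im, Complex.neg_im, h3, secDiff_apply,
    nlForm_add_left h, nlForm_sub_left h, nlForm_sub_left h, nlForm_transSob_neg]
  simp only [Complex.add_im, Complex.sub_im]
  ring

/-- The truncated nonlinearity acting on `L²`. -/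
def truncL2 {α k : ℝ} (hα : 0 < α) (hk : 0 ≤ k) (f : L2 d) : L2 d :=
  (lipschitzWith_truncNl hα hk).compLp (truncNl_zero α k) f

section Trunc

variable {α k : ℝ} (hα : 0 < α) (hk : 0 ≤ k)

theorem coeFn_truncL2 (f : L2 d) : truncL2 hα hk f =ᵐ[volume] fun p => truncNl α k (f p) :=
  (lipschitzWith_truncNl hα hk).coeFn_compLp _ f

theorem continuous_truncL2 : Continuous (truncL2 hα hk : L2 d → L2 d) :=
  (lipschitzWith_truncNl hα hk).continuous_compLp (truncNl_zero α k)

theorem trans_truncL2 (z : Guide d) (f : L2 d) :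
    trans z (truncL2 hα hk f) = truncL2 hα hk (trans z f) := trans_compLp _ _ _ _

theorem norm_truncL2_sub_le (f g : L2 d) :
    ‖truncL2 hα hk f - truncL2 hα hk g‖ ≤ (2 + α) * k ^ α * ‖f - g‖ := by
  have := (lipschitzWith_truncNl hα hk).norm_compLp_sub_le (truncNl_zero α k) f g
  rwa [Real.coe_toNNReal _ (by positivity)] at this

theorem exists_sob_truncL2 (u : Sob d) : ∃ v : Sob d, fnL v = truncL2 hα hk (fnL u) :=
  exists_sob_compLp _ _ u

theorem norm_diffQ_truncL2_le (i : Option (Fin d)) (s : ℝ) (f : L2 d) :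
    ‖diffQ i s (truncL2 hα hk f)‖ ≤ (2 + α) * k ^ α * ‖diffQ i s f‖ := by
  rw [diffQ, diffQ, norm_smul, norm_smul, trans_truncL2, mul_left_comm]
  gcongr
  exact norm_truncL2_sub_le hα hk _ _

include hα hk in
theorem integrable_truncDens (f : L2 d) : Integrable fun p => truncDens α k (f p) := by
  have h2 : Integrable fun p => ‖f p‖ ^ 2 := (Lp.memLp f).integrable_norm_pow (by norm_num)
  refine (h2.const_mul (k ^ α)).mono' ((continuous_truncDens hα).comp_aestronglyMeasurable
    (Lp.aestronglyMeasurable f)) (Eventually.of_forall fun p => ?_)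
  rw [Real.norm_eq_abs, abs_of_nonneg (truncDens_nonneg hα hk _)]
  exact truncDens_le_sq hα hk _

theorem abs_integral_truncDens_sub_le (f g : L2 d) :
    |(∫ p, truncDens α k (g p)) - (∫ p, truncDens α k (f p)) - (⟪truncL2 hα hk f, g - f⟫_ℂ).re| ≤
      (2 + α) * k ^ α * ‖g - f‖ ^ 2 := by
  have hi : Integrable fun p => star (truncL2 hα hk f p) * (g - f) p := by
    have := L2.integrable_inner (𝕜 := ℂ) (truncL2 hα hk f) (g - f)
    refine this.congr (Eventually.of_forall fun p => ?_)
    simp only [RCLike.inner_apply, mul_comm]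
    rfl
  have e : (⟪truncL2 hα hk f, g - f⟫_ℂ).re =
      ∫ p, (star (truncNl α k (f p)) * (g p - f p)).re := by
    rw [inner_eq_integral, ← RCLike.re_eq_complex_re, ← integral_re hi]
    refine integral_congr_ae ?_
    filter_upwards [coeFn_truncL2 hα hk f, Lp.coeFn_sub g f] with p h1 h2
    rw [h1, h2]
    rfl
  have hi' : Integrable fun p => (star (truncNl α k (f p)) * (g p - f p)).re := by
    refine hi.re.congr ?_
    filter_upwards [coeFn_truncL2 hα hk f, Lp.coeFn_sub g f] with p h1 h2
    rw [h1, h2]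
    rfl
  have h2 : ∫ p, ‖g p - f p‖ ^ 2 = ‖g - f‖ ^ 2 := by
    have h3 : ⟪g - f, g - f⟫_ℂ = ((‖g - f‖ ^ 2 : ℝ) : ℂ) := by
      rw [inner_self_eq_norm_sq_to_K]
      simp
    have h4 : ((∫ p, ‖g p - f p‖ ^ 2 : ℝ) : ℂ) = ((‖g - f‖ ^ 2 : ℝ) : ℂ) := by
      rw [← h3, inner_eq_integral, ← integral_complex_ofReal]
      refine integral_congr_ae ?_
      filter_upwards [Lp.coeFn_sub g f] with p hp
      rw [hp, Pi.sub_apply, Complex.star_def, Complex.conj_mul']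
      push_cast
      rfl
    exact_mod_cast h4
  have hi2 : Integrable fun p => ‖g p - f p‖ ^ 2 := by
    refine ((Lp.memLp (g - f)).integrable_norm_pow (by norm_num)).congr ?_
    filter_upwards [Lp.coeFn_sub g f] with p hp
    rw [hp]
    rfl
  have hd : Integrable fun p => truncDens α k (g p) - truncDens α k (f p) :=
    (integrable_truncDens hα hk g).sub (integrable_truncDens hα hk f)
  rw [e, ← integral_sub (integrable_truncDens hα hk g) (integrable_truncDens hα hk f),
    ← integral_sub hd hi', ← h2, ← integral_const_mul, ← Real.norm_eq_abs]
  refine norm_integral_le_of_norm_le (hi2.const_mul _) (Eventually.of_forall fun p => ?_)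
  exact abs_truncDens_sub_le hα hk _ _

end Trunc

/-- The truncated nonlinearity is a real multiple of `u` pointwise, so the nonlinear form is real
and only the gradient terms survive. -/
theorem weakForm_re_of_trunc {α k : ℝ} (h : IsIntercritical d α) (hk : 0 ≤ k) {u v : Sob d}
    (hv : fnL v = truncL2 h.pos hk (fnL u)) :
    (weakForm α v u).re = ∑ i, (⟪weakD i v, weakD i u⟫_ℂ).im := by
  have hn : (nlForm α v u).im = 0 := by
    have e : nlForm α v u =
        ∫ p, (((min ‖fnL u p‖ k) ^ α * ‖fnL u p‖ ^ (α + 2) : ℝ) : ℂ) := by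
      rw [nlForm_def, hv]
      refine integral_congr_ae ?_
      filter_upwards [coeFn_truncL2 h.pos hk (fnL u)] with p hp
      rw [hp, truncNl, star_mul', Complex.star_def, Complex.conj_ofReal, mul_assoc,
        ← Complex.star_def, star_mul_nl h.pos, Complex.ofReal_mul]
    rw [e, integral_complex_ofReal, Complex.ofReal_im]
  rw [weakForm_def, Complex.I_mul_re, Complex.add_im, Complex.neg_im, hn, Complex.im_sum]
  ring

/-- Both difference quotients converge strongly in L² to weak derivatives; the sign comes from
exchanging the slots of the inner product. -/
theorem tendsto_inner_diffQ_trunc {α k : ℝ} (h : IsIntercritical d α) (hk : 0 ≤ k) {u v : Sob d}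
    (hv : fnL v = truncL2 h.pos hk (fnL u)) :
    Tendsto (fun s => ∑ i, -(⟪diffQ i s (fnL u), diffQ i s (truncL2 h.pos hk (fnL u))⟫_ℂ).im)
      (𝓝[>] 0) (𝓝 (weakForm α v u).re) := by
  rw [weakForm_re_of_trunc h hk hv, ← hv]
  refine tendsto_finsetSum _ fun i _ => ?_
  have h1 := (tendsto_diffQ (isWeakDeriv_weakD i u)).inner (𝕜 := ℂ)
    (tendsto_diffQ (isWeakDeriv_weakD i v))
  have h2 := ((Complex.continuous_im.tendsto _).comp h1).neg
  rw [← inner_conj_symm, Complex.conj_im, neg_neg] at h2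
  exact h2.mono_left (nhdsWithin_mono _ fun s hs => ne_of_gt hs)

/-- The first-order term is the equation tested with the truncated nonlinearity v of `U t`, frozen
in time; it lies in H¹ because truncation makes the nonlinearity Lipschitz. The remainder is
quadratic in the L² increment of `U`, hence o(t' - t). -/
theorem IsWeakSolution.hasDerivAt_truncDens {α k : ℝ} {I : Set ℝ} {U : ℝ → Sob d}
    (S : IsWeakSolution α I U) (h : IsIntercritical d α) (hk : 0 ≤ k) {t : ℝ} (ht : t ∈ I)
    {v : Sob d} (hv : fnL v = truncL2 h.pos hk (fnL (U t))) :
    HasDerivAt (fun s => ∫ p, truncDens α k (fnL (U s) p)) (weakForm α v (U t)).re t := by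
  have hα := h.pos
  have h1 := S.inner_sub_isLittleO h ht (G := fun _ => v) continuousAt_const
  have h2 := (S.norm_sub_sq_isLittleO h ht).const_mul_left ((2 + α) * k ^ α)
  rw [hasDerivAt_iff_isLittleO]
  have h3 := (h1.norm_left).add h2
  refine (Asymptotics.isBigO_of_le _ fun t' => ?_).trans_isLittleO h3
  have h4 := abs_integral_truncDens_sub_le h.pos hk (fnL (U t)) (fnL (U t'))
  rw [← hv] at h4
  have h5 := Complex.abs_re_le_norm (⟪fnL v, fnL (U t') - fnL (U t)⟫_ℂ -
    ((t' - t : ℝ) : ℂ) * weakForm α v (U t))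
  rw [Complex.sub_re, Complex.re_ofReal_mul] at h5
  rw [Real.norm_eq_abs, smul_eq_mul, Real.norm_of_nonneg (by positivity)]
  refine le_trans ?_ (add_le_add h5 h4)
  rw [add_comm]
  refine le_trans (le_of_eq ?_) (abs_add_le _ _)
  congr 1
  ring

/-- The upper condition on α is strict; the room δ pays for removing the truncation. -/
theorem IsIntercritical.exists_add {α : ℝ} (h : IsIntercritical d α) :
    ∃ δ > 0, IsIntercritical d (α + δ) := by
  rcases Nat.lt_or_ge d 2 with h2 | h2
  · exact ⟨1, one_pos, h.one_le, by linarith [h.lower], fun h3 => absurd h3 (by omega)⟩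
  · have h3 := h.upper h2
    exact ⟨(4 / ((d : ℝ) - 1) - α) / 2, by linarith, h.one_le, by linarith [h.lower],
      fun _ => by linarith⟩

/-- An increment which is quadratic with weight `|u|^β` is controlled by the weighted norm of the
difference quotient. -/
theorem enorm_integral_le_of_incr {E : Type*} [NormedAddCommGroup E] [NormedSpace ℝ E]
    {Φ : Guide d → E} {i : Option (Fin d)} {s β c : ℝ} {f : L2 d}
    {η : ℝ≥0∞} (hs : 0 < s) (hβ : 0 ≤ β) (hc : 0 ≤ c)
    (h1 : ∫⁻ p, ‖f p‖ₑ ^ β * ‖diffQ i s f p‖ₑ ^ (2 : ℝ) ≤ η)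
    (h2 : ∫⁻ p, ‖trans (shift i s) f p‖ₑ ^ β * ‖diffQ i s f p‖ₑ ^ (2 : ℝ) ≤ η)
    (hΦ : ∀ᵐ p, ‖Φ p‖ ≤ c * (‖f p‖ ^ β + ‖trans (shift i s) f p‖ ^ β) *
      ‖trans (shift i s) f p - f p‖ ^ 2) :
    ‖∫ p, Φ p‖ₑ ≤ ENNReal.ofReal (2 * c * s ^ 2) * η := by
  have hm : ∀ g : L2 d, Measurable fun p => ‖g p‖ₑ ^ β * ‖diffQ i s f p‖ₑ ^ (2 : ℝ) := fun g =>
    ((coeFn_enorm_measurable g).pow_const _).mul ((coeFn_enorm_measurable _).pow_const _)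
  calc ‖∫ p, Φ p‖ₑ ≤ ∫⁻ p, ‖Φ p‖ₑ := enorm_integral_le_lintegral_enorm _
    _ ≤ ∫⁻ p, ENNReal.ofReal (c * s ^ 2) * (‖f p‖ₑ ^ β * ‖diffQ i s f p‖ₑ ^ (2 : ℝ) +
          ‖trans (shift i s) f p‖ₑ ^ β * ‖diffQ i s f p‖ₑ ^ (2 : ℝ)) := by
        refine lintegral_mono_ae ?_
        filter_upwards [hΦ, Lp.coeFn_smul (s⁻¹ : ℂ) (trans (shift i s) f - f),
          Lp.coeFn_sub (trans (shift i s) f) f] with p hp e1 e2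
        have e3 : ‖diffQ i s f p‖ = s⁻¹ * ‖trans (shift i s) f p - f p‖ := by
          rw [diffQ, e1, Pi.smul_apply, e2, Pi.sub_apply, norm_smul, norm_inv, Complex.norm_real,
            Real.norm_of_nonneg hs.le]
        rw [← add_mul, ← mul_assoc, ← ofReal_norm, ← ofReal_norm (f p), ← ofReal_norm (trans _ f p),
          ← ofReal_norm (diffQ i s f p), ENNReal.ofReal_rpow_of_nonneg (norm_nonneg _) hβ,
          ENNReal.ofReal_rpow_of_nonneg (norm_nonneg _) hβ,
          ENNReal.ofReal_rpow_of_nonneg (norm_nonneg _) zero_le_two,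
          ← ENNReal.ofReal_add (by positivity) (by positivity),
          ← ENNReal.ofReal_mul (by positivity), ← ENNReal.ofReal_mul (by positivity)]
        refine ENNReal.ofReal_le_ofReal (hp.trans (le_of_eq ?_))
        rw [e3, Real.rpow_two]
        field_simp
    _ ≤ ENNReal.ofReal (c * s ^ 2) * (η + η) := by
        rw [lintegral_const_mul' _ _ ENNReal.ofReal_ne_top, lintegral_add_left (hm _)]
        gcongr
    _ = _ := by
        rw [← two_mul, ← mul_assoc]
        congr 1
        rw [← ENNReal.ofReal_ofNat 2, ← ENNReal.ofReal_mul (by positivity)]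
        congr 1
        ring

theorem abs_intervalIntegral_le_of_enorm_le {X : ℝ → ℝ} {a b c : ℝ} (hab : a ≤ b) (hc : 0 ≤ c)
    {h : ℝ → ℝ≥0∞} (hh : ∫⁻ t in Icc a b, h t ≠ ⊤)
    (hX : ∀ t ∈ Icc a b, ‖X t‖ₑ ≤ ENNReal.ofReal c * h t) :
    |∫ t in a..b, X t| ≤ c * (∫⁻ t in Icc a b, h t).toReal := by
  rw [intervalIntegral.integral_of_le hab, ← Real.norm_eq_abs]
  have h1 : ‖∫ t in Ioc a b, X t‖ₑ ≤ ENNReal.ofReal c * ∫⁻ t in Icc a b, h t := by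
    rw [← lintegral_const_mul' _ _ ENNReal.ofReal_ne_top]
    calc _ ≤ ∫⁻ t in Ioc a b, ‖X t‖ₑ := enorm_integral_le_lintegral_enorm _
      _ ≤ ∫⁻ t in Icc a b, ‖X t‖ₑ := lintegral_mono_set Ioc_subset_Icc_self
      _ ≤ _ := setLIntegral_mono' measurableSet_Icc hX
  have h2 := ENNReal.toReal_mono (ENNReal.mul_ne_top ENNReal.ofReal_ne_top hh) h1
  rwa [toReal_enorm, ENNReal.toReal_mul, ENNReal.toReal_ofReal hc] at h2

/-- `‖∇_{x,y} u‖₂²`. -/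
def gradSq (u : Sob d) : ℝ := ∑ i, ‖weakD i u‖ ^ 2

/-- The energy on the Sobolev space. -/
def energyS (α : ℝ) (u : Sob d) : ℝ := 1 / 2 * gradSq u - pot α u / (α + 2)

theorem continuous_diffQ (i : Option (Fin d)) (s : ℝ) : Continuous (diffQ i s : L2 d → L2 d) :=
  Continuous.const_smul (g := fun f : L2 d => trans (shift i s) f - f)
    ((trans (shift i s)).continuous.sub continuous_id) (s⁻¹ : ℂ)

theorem norm_diffQ_sq (i : Option (Fin d)) (s : ℝ) (f : L2 d) :
    ‖diffQ i s f‖ ^ 2 = (s ^ 2)⁻¹ * ‖trans (shift i s) f - f‖ ^ 2 := by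
  rw [diffQ, norm_smul, mul_pow, norm_inv, Complex.norm_real, inv_pow, Real.norm_eq_abs, sq_abs]

theorem inner_diffQ_diffQ (i : Option (Fin d)) (s : ℝ) (f g : L2 d) :
    ⟪diffQ i s f, diffQ i s g⟫_ℂ =
      ((s ^ 2)⁻¹ : ℝ) * ⟪trans (shift i s) f - f, trans (shift i s) g - g⟫_ℂ := by
  rw [diffQ, diffQ, inner_smul_left, inner_smul_right, ← mul_assoc, map_inv₀, Complex.conj_ofReal,
    ← mul_inv, ← sq]
  push_cast
  rfl

theorem abs_inner_diffQ_trunc_le {α k : ℝ} (hα : 0 < α) (hk : 0 ≤ k) (i : Option (Fin d)) (s : ℝ)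
    (u : Sob d) : |-(⟪diffQ i s (fnL u), diffQ i s (truncL2 hα hk (fnL u))⟫_ℂ).im| ≤
      (2 + α) * k ^ α * ‖u‖ ^ 2 := by
  rw [abs_neg]
  have h1 : ‖diffQ i s (fnL u)‖ ≤ ‖u‖ :=
    (norm_diffQ_le (isWeakDeriv_weakD i u) s).trans (norm_weakD_le i u)
  calc _ ≤ ‖⟪diffQ i s (fnL u), diffQ i s (truncL2 hα hk (fnL u))⟫_ℂ‖ := Complex.abs_im_le_norm _
    _ ≤ ‖diffQ i s (fnL u)‖ * ‖diffQ i s (truncL2 hα hk (fnL u))‖ := norm_inner_le_norm _ _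
    _ ≤ ‖u‖ * ((2 + α) * k ^ α * ‖u‖) := by
        gcongr
        exact (norm_diffQ_truncL2_le hα hk i s _).trans (by gcongr)
    _ = _ := by ring

/-- The second difference yields increments of the full nonlinearity and the inner product those of
the truncated one. What remains is an integral of increments of their difference, of size k^{-δ}
with weight |u|^{α+δ}; the two increments absorb the factor s⁻². -/
theorem enorm_secDiff_add_le {α : ℝ} (h : IsIntercritical d α) {δ k : ℝ} (hδ : 0 ≤ δ) (hk : 0 < k)
    {i : Option (Fin d)} {η : ℝ≥0∞} {s : ℝ} (hs : 0 < s) {u : Sob d}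
    (h1 : ∫⁻ p, ‖fnL u p‖ₑ ^ (α + δ) * ‖diffQ i s (fnL u) p‖ₑ ^ (2 : ℝ) ≤ η)
    (h2 : ∫⁻ p, ‖trans (shift i s) (fnL u) p‖ₑ ^ (α + δ) * ‖diffQ i s (fnL u) p‖ₑ ^ (2 : ℝ) ≤ η) :
    ‖(s ^ 2)⁻¹ * (weakForm α (secDiff (shift i s) u) u).re -
      -(⟪diffQ i s (fnL u), diffQ i s (truncL2 h.pos hk.le (fnL u))⟫_ℂ).im‖ₑ ≤
      ENNReal.ofReal (2 * ((2 + α) * k ^ (-δ))) * η := by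
  have hα := h.pos
  obtain ⟨f, hf⟩ : ∃ f, f = fnL u := ⟨_, rfl⟩
  rw [← hf] at h1 h2 ⊢
  obtain ⟨z, hz⟩ : ∃ z, z = shift i s := ⟨_, rfl⟩
  obtain ⟨Φ, hΦ⟩ : ∃ Φ : Guide d → ℂ, Φ = fun p => star (trans z f p - f p) *
    ((nl α (trans z f p) - nl α (f p)) - (truncNl α k (trans z f p) - truncNl α k (f p))) := ⟨_, rfl⟩
  have hbound : ∀ p, ‖Φ p‖ ≤ (2 + α) * k ^ (-δ) * (‖f p‖ ^ (α + δ) + ‖trans z f p‖ ^ (α + δ)) *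
      ‖trans z f p - f p‖ ^ 2 := by
    intro p
    rw [hΦ]
    simp only []
    rw [norm_mul, norm_star]
    calc _ ≤ ‖trans z f p - f p‖ * ((2 + α) * k ^ (-δ) *
          (‖f p‖ ^ (α + δ) + ‖trans z f p‖ ^ (α + δ)) * ‖trans z f p - f p‖) := by
          gcongr
          exact norm_nl_sub_truncNl_sub_le hα hδ hk _ _
      _ = _ := by ring
  have h3 := enorm_integral_le_of_incr (Φ := Φ) hs (by linarith) (by positivity) h1 h2
    (ae_of_all _ (hz ▸ hbound))
  have hint : Integrable fun p => star (trans z f p - f p) * (nl α (trans z f p) - nl α (f p)) := by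
    rw [hf]
    exact integrable_incr h (transSob z u) u
  have hae : (fun p => star ((trans z f - f) p) *
      (trans z (truncL2 hα hk.le f) - truncL2 hα hk.le f) p) =ᵐ[volume]
      fun p => star (trans z f p - f p) * (truncNl α k (trans z f p) - truncNl α k (f p)) := by
    rw [trans_truncL2]
    filter_upwards [Lp.coeFn_sub (trans z f) f, coeFn_truncL2 hα hk.le f,
      coeFn_truncL2 hα hk.le (trans z f), Lp.coeFn_sub (truncL2 hα hk.le (trans z f))
        (truncL2 hα hk.le f)] with p e1 e2 e3 e4
    rw [e1, e4, Pi.sub_apply, Pi.sub_apply, e2, e3]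
  have hint2 : Integrable fun p => star (trans z f p - f p) *
      (truncNl α k (trans z f p) - truncNl α k (f p)) := by
    refine Integrable.congr ?_ hae
    refine (L2.integrable_inner (𝕜 := ℂ) (trans z f - f)
      (trans z (truncL2 hα hk.le f) - truncL2 hα hk.le f)).congr (Eventually.of_forall fun p => ?_)
    simp only [RCLike.inner_apply]
    exact mul_comm _ _
  have e : (s ^ 2)⁻¹ * (weakForm α (secDiff z u) u).re -
      -(⟪diffQ i s f, diffQ i s (truncL2 hα hk.le f)⟫_ℂ).im =
      -((s ^ 2)⁻¹ * (∫ p, Φ p).im) := by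
    rw [weakForm_secDiff_re h, ← hf, inner_diffQ_diffQ, ← hz, Complex.im_ofReal_mul, inner_eq_integral,
      integral_congr_ae hae]
    have : ∫ p, Φ p = (∫ p, star (trans z f p - f p) * (nl α (trans z f p) - nl α (f p))) -
        ∫ p, star (trans z f p - f p) * (truncNl α k (trans z f p) - truncNl α k (f p)) := by
      rw [← integral_sub hint hint2]
      congr 1
      funext p
      rw [hΦ]
      ring
    rw [this, Complex.sub_im]
    ring
  rw [← hz, e, enorm_neg, enorm_mul, Real.enorm_of_nonneg (by positivity)]
  calc _ ≤ ENNReal.ofReal (s ^ 2)⁻¹ * ‖∫ p, Φ p‖ₑ := by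
        gcongr
        rw [← ofReal_norm, ← ofReal_norm]
        exact ENNReal.ofReal_le_ofReal (Complex.abs_im_le_norm _)
    _ ≤ ENNReal.ofReal (s ^ 2)⁻¹ * (ENNReal.ofReal (2 * ((2 + α) * k ^ (-δ)) * s ^ 2) * η) := by
        gcongr
    _ = _ := by
        rw [← mul_assoc, ← ENNReal.ofReal_mul (by positivity)]
        congr 2
        field_simp

namespace IsWeakSolution

variable {α : ℝ} {I : Set ℝ} {U : ℝ → Sob d}

/-- The squared norm of an increment is the quadratic form of the second difference, which is
bounded on H¹ and symmetric. -/
theorem hasDerivAt_norm_diffQ_sq (S : IsWeakSolution α I U) (h : IsIntercritical d α)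
    (i : Option (Fin d)) (s : ℝ) {t : ℝ} (ht : t ∈ I) :
    HasDerivAt (fun t => 1 / 2 * ‖diffQ i s (fnL (U t))‖ ^ 2)
      ((s ^ 2)⁻¹ * (weakForm α (secDiff (shift i s) (U t)) (U t)).re) t := by
  have h1 := S.hasDerivAt_quadratic h ((secDiff (shift i s)).restrictScalars ℝ) (fun v w => by
    simp only [ContinuousLinearMap.coe_restrictScalars', secDiff_apply, map_add, map_sub,
      fnL_transSob]
    rw [inner_secDiff_left]) ht
  have h2 := h1.const_mul (1 / 2 * (s ^ 2)⁻¹)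
  refine (h2.congr_of_eventuallyEq (Eventually.of_forall fun t' => ?_)).congr_deriv ?_
  · simp only [ContinuousLinearMap.coe_restrictScalars', secDiff_apply, map_add, map_sub,
      fnL_transSob]
    rw [inner_secDiff_self, Complex.ofReal_re, norm_diffQ_sq]
    ring
  · simp only [ContinuousLinearMap.coe_restrictScalars']
    ring

theorem continuousOn_weakForm_clm (S : IsWeakSolution α I U) (h : IsIntercritical d α)
    (L : Sob d →L[ℝ] Sob d) : ContinuousOn (fun t => (weakForm α (L (U t)) (U t)).re) I :=
  Complex.continuous_re.comp_continuousOn ((continuous_weakForm h).comp_continuousOn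
    (f := fun t => (L (U t), U t)) ((L.continuous.comp_continuousOn S.continuousOn).prodMk
      S.continuousOn))

/-- The bound is uniform in s, so that s → 0 can be taken at fixed k. -/
theorem abs_norm_diffQ_sq_sub_le (S : IsWeakSolution α I U) (h : IsIntercritical d α) {δ k : ℝ}
    (hδ : 0 ≤ δ) (hk : 0 < k) {a b : ℝ} (ha : a ∈ I) (hb : b ∈ I) (hab : a ≤ b) {i : Option (Fin d)}
    {η : ℝ → ℝ≥0∞} (hη : ∫⁻ t in Icc a b, η t ≠ ⊤) {s : ℝ} (hs : 0 < s)
    (hη1 : ∀ t ∈ Icc a b, ∫⁻ p, ‖fnL (U t) p‖ₑ ^ (α + δ) *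
      ‖diffQ i s (fnL (U t)) p‖ₑ ^ (2 : ℝ) ≤ η t)
    (hη2 : ∀ t ∈ Icc a b, ∫⁻ p, ‖trans (shift i s) (fnL (U t)) p‖ₑ ^ (α + δ) *
      ‖diffQ i s (fnL (U t)) p‖ₑ ^ (2 : ℝ) ≤ η t) :
    |1 / 2 * ‖diffQ i s (fnL (U b))‖ ^ 2 - 1 / 2 * ‖diffQ i s (fnL (U a))‖ ^ 2 -
      ∫ t in a..b, -(⟪diffQ i s (fnL (U t)), diffQ i s (truncL2 h.pos hk.le (fnL (U t)))⟫_ℂ).im| ≤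
      k ^ (-δ) * (2 * (2 + α) * (∫⁻ t in Icc a b, η t).toReal) := by
  have hα := h.pos
  have hsub : uIcc a b ⊆ I := S.uIcc_subset ha hb
  have hc1 : ContinuousOn (fun t => (s ^ 2)⁻¹ * (weakForm α (secDiff (shift i s) (U t)) (U t)).re) I :=
    continuousOn_const.mul (S.continuousOn_weakForm_clm h ((secDiff (shift i s)).restrictScalars ℝ))
  have hc2 : ContinuousOn (fun t => -(⟪diffQ i s (fnL (U t)),
      diffQ i s (truncL2 h.pos hk.le (fnL (U t)))⟫_ℂ).im) I := by
    have h1 : Continuous fun u : Sob d => -(⟪diffQ i s (fnL u),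
        diffQ i s (truncL2 h.pos hk.le (fnL u))⟫_ℂ).im :=
      (Complex.continuous_im.comp (((continuous_diffQ i s).comp fnL.continuous).inner
        ((continuous_diffQ i s).comp ((continuous_truncL2 _ _).comp fnL.continuous)))).neg
    exact h1.comp_continuousOn S.continuousOn
  have hi1 := (hc1.mono hsub).intervalIntegrable (μ := volume)
  have hi2 := (hc2.mono hsub).intervalIntegrable (μ := volume)
  rw [← intervalIntegral.integral_eq_sub_of_hasDerivAt
    (fun t ht => S.hasDerivAt_norm_diffQ_sq h i s (hsub ht)) hi1,
    ← intervalIntegral.integral_sub hi1 hi2]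
  refine (abs_intervalIntegral_le_of_enorm_le hab (c := 2 * ((2 + α) * k ^ (-δ))) (by positivity) hη
    fun t ht => ?_).trans (le_of_eq (by ring))
  exact enorm_secDiff_add_le h hδ hk hs (hη1 t ht) (hη2 t ht)

/-- At each time the sum tends to the derivative of G(t) = ∫ truncDens(U t), with bounds uniform in
s and t; dominated convergence and the fundamental theorem of calculus conclude. -/
theorem tendsto_integral_inner_diffQ_trunc (S : IsWeakSolution α I U) (h : IsIntercritical d α)
    {k : ℝ} (hk : 0 ≤ k) {a b : ℝ} (ha : a ∈ I) (hb : b ∈ I) :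
    Tendsto (fun s => ∑ i, ∫ t in a..b, -(⟪diffQ i s (fnL (U t)),
      diffQ i s (truncL2 h.pos hk (fnL (U t)))⟫_ℂ).im) (𝓝[>] 0)
      (𝓝 ((∫ p, truncDens α k (fnL (U b) p)) - ∫ p, truncDens α k (fnL (U a) p))) := by
  have hα := h.pos
  have hsub : uIcc a b ⊆ I := S.uIcc_subset ha hb
  obtain ⟨M, hM⟩ := (isCompact_uIcc (a := a) (b := b)).exists_bound_of_continuousOn
    (S.continuousOn.mono hsub)
  let G : ℝ → ℝ := fun t => ∫ p, truncDens α k (fnL (U t) p)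
  let Y : Option (Fin d) → ℝ → ℝ → ℝ := fun i s t => -(⟪diffQ i s (fnL (U t)),
      diffQ i s (truncL2 h.pos hk (fnL (U t)))⟫_ℂ).im
  have hYc : ∀ i s, ContinuousOn (Y i s) I := by
    intro i s
    have h1 : Continuous fun u : Sob d => -(⟪diffQ i s (fnL u),
        diffQ i s (truncL2 h.pos hk (fnL u))⟫_ℂ).im :=
      (Complex.continuous_im.comp (((continuous_diffQ i s).comp fnL.continuous).inner
        ((continuous_diffQ i s).comp ((continuous_truncL2 _ _).comp fnL.continuous)))).neg
    exact h1.comp_continuousOn S.continuousOn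
  have hG : ∀ t ∈ I, HasDerivAt G (deriv G t) t ∧
      Tendsto (fun s => ∑ i, Y i s t) (𝓝[>] 0) (𝓝 (deriv G t)) := by
    intro t ht
    obtain ⟨v, hv⟩ := exists_sob_truncL2 h.pos hk (U t)
    have h1 := S.hasDerivAt_truncDens h hk ht hv
    have h2 := tendsto_inner_diffQ_trunc h hk hv
    have e : deriv G t = (weakForm α v (U t)).re := h1.deriv
    rw [e]
    exact ⟨h1, h2⟩
  let B : ℝ := ∑ _i : Option (Fin d), (2 + α) * k ^ α * M ^ 2
  have hYB : ∀ s, ∀ t ∈ uIcc a b, ‖∑ i, Y i s t‖ ≤ B := by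
    intro s t ht
    refine (norm_sum_le _ _).trans (Finset.sum_le_sum fun i _ => ?_)
    refine (abs_inner_diffQ_trunc_le hα hk i s (U t)).trans ?_
    have := hM t ht
    gcongr
  have hGB : ∀ t ∈ uIcc a b, ‖deriv G t‖ ≤ B := fun t ht =>
    le_of_tendsto (hG t (hsub ht)).2.norm (Eventually.of_forall fun s => hYB s t ht)
  -- Continuity of `deriv G` is not established; it is measurable as a derivative, and bounded as a
  -- pointwise limit of bounded functions.
  have hGi : IntervalIntegrable (deriv G) volume a b := by
    rw [intervalIntegrable_iff]
    refine Measure.integrableOn_of_bounded (M := B) (by simp [uIoc])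
      (measurable_deriv G).aestronglyMeasurable ?_
    refine (ae_restrict_iff' measurableSet_uIoc).2 (ae_of_all _ fun t ht => ?_)
    exact hGB t (uIoc_subset_uIcc ht)
  have hGint := intervalIntegral.integral_eq_sub_of_hasDerivAt (fun t ht => (hG t (hsub ht)).1) hGi
  change Tendsto _ _ (𝓝 (G b - G a))
  rw [← hGint]
  have hsum : ∀ s, ∑ i, ∫ t in a..b, Y i s t = ∫ t in a..b, ∑ i, Y i s t := fun s =>
    (intervalIntegral.integral_finsetSum fun i _ => ((hYc i s).mono hsub).intervalIntegrable).symm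
  change Tendsto (fun s => ∑ i, ∫ t in a..b, Y i s t) _ _
  simp only [hsum]
  refine intervalIntegral.tendsto_integral_filter_of_dominated_convergence (fun _ => B)
    (Eventually.of_forall fun s => ?_) (Eventually.of_forall fun s => ae_of_all _ fun t ht => ?_)
    intervalIntegrable_const (ae_of_all _ fun t ht => ?_)
  · exact ((continuousOn_finsetSum _ fun i _ => (hYc i s).mono
      (uIoc_subset_uIcc.trans hsub))).aestronglyMeasurable measurableSet_uIoc
  · exact hYB s t (uIoc_subset_uIcc ht)
  · exact (hG t (hsub (uIoc_subset_uIcc ht))).2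

theorem tendsto_integral_truncDens (h : IsIntercritical d α) (u : Sob d) :
    Tendsto (fun n : ℕ => ∫ p, truncDens α (n + 1 : ℝ) (fnL u p)) atTop (𝓝 (pot α u / (α + 2))) := by
  have hα := h.pos
  have e : pot α u / (α + 2) = ∫ p, ‖fnL u p‖ ^ (α + 2) / (α + 2) := by
    rw [integral_div]
    rfl
  rw [e]
  refine tendsto_integral_of_dominated_convergence (fun p => ‖fnL u p‖ ^ (α + 2) / (α + 2))
    (fun n => (continuous_truncDens hα).comp_aestronglyMeasurable (Lp.aestronglyMeasurable _))
    ((integrable_pot h u).div_const _) (fun n => ae_of_all _ fun p => ?_) (ae_of_all _ fun p => ?_)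
  · rw [Real.norm_of_nonneg (truncDens_nonneg hα (by positivity) _)]
    exact truncDens_le hα (by positivity) _
  · refine tendsto_const_nhds.congr' ?_
    filter_upwards [eventually_ge_atTop ⌈‖fnL u p‖⌉₊] with n hn
    refine (truncDens_eq hα ((Nat.le_ceil _).trans ?_)).symm
    exact (Nat.cast_le.2 hn).trans (by linarith)

/-- Conservation of energy. -/
theorem energyS_eq (S : IsWeakSolution α I U) (h : IsIntercritical d α)
    (hs : ∀ β, IsIntercritical d β → HasSmoothing β I U) {a b : ℝ} (ha : a ∈ I) (hb : b ∈ I) :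
    energyS α (U a) = energyS α (U b) := by
  wlog hab : a ≤ b generalizing a b
  · exact (this hb ha (le_of_not_ge hab)).symm
  -- Smoothing is invoked at the exponent α + δ, which is why it is assumed for every exponent of
  -- the range.
  obtain ⟨δ, hδ, hδ'⟩ := h.exists_add
  choose η hη1 hη2 using hs _ hδ' a ha b hb
  let C : ℝ := ∑ i, 2 * (2 + α) * (∫⁻ t in Icc a b, η i t).toReal
  -- The limit s → 0 at fixed k: the energy with truncated potential is conserved up to k^{-δ}C,
  -- with C independent of k.
  have hk : ∀ k : ℝ, 0 < k → |1 / 2 * gradSq (U b) - 1 / 2 * gradSq (U a) -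
      ((∫ p, truncDens α k (fnL (U b) p)) - ∫ p, truncDens α k (fnL (U a) p))| ≤ k ^ (-δ) * C := by
    intro k hk
    have l1 : ∀ u : Sob d, Tendsto (fun s => ∑ i, 1 / 2 * ‖diffQ i s (fnL u)‖ ^ 2) (𝓝[>] 0)
        (𝓝 (1 / 2 * gradSq u)) := by
      intro u
      rw [gradSq, Finset.mul_sum]
      refine tendsto_finsetSum _ fun i _ => ?_
      exact (((tendsto_diffQ (isWeakDeriv_weakD i u)).norm.pow 2).const_mul _).mono_left
        (nhdsWithin_mono _ fun s hs => ne_of_gt hs)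
    have l2 := (((l1 (U b)).sub (l1 (U a))).sub
      (S.tendsto_integral_inner_diffQ_trunc h hk.le ha hb)).abs
    refine le_of_tendsto l2 ?_
    filter_upwards [self_mem_nhdsWithin] with s hs
    rw [← Finset.sum_sub_distrib, ← Finset.sum_sub_distrib, Finset.mul_sum]
    refine (Finset.abs_sum_le_sum_abs _ _).trans (Finset.sum_le_sum fun i _ => ?_)
    exact S.abs_norm_diffQ_sq_sub_le h hδ.le hk ha hb hab (hη1 i) hs
      (fun t ht => (hη2 i t ht s hs).1) fun t ht => (hη2 i t ht s hs).2
  -- Then k = n + 1 → ∞: the truncated potentials converge to the true ones and k^{-δ}C tends to 0.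
  have l3 : Tendsto (fun n : ℕ => |1 / 2 * gradSq (U b) - 1 / 2 * gradSq (U a) -
      ((∫ p, truncDens α (n + 1 : ℝ) (fnL (U b) p)) -
        ∫ p, truncDens α (n + 1 : ℝ) (fnL (U a) p))|) atTop
      (𝓝 |1 / 2 * gradSq (U b) - 1 / 2 * gradSq (U a) -
        (pot α (U b) / (α + 2) - pot α (U a) / (α + 2))|) :=
    (tendsto_const_nhds.sub ((tendsto_integral_truncDens h (U b)).sub
      (tendsto_integral_truncDens h (U a)))).abs
  have l4 : Tendsto (fun n : ℕ => ((n : ℝ) + 1) ^ (-δ) * C) atTop (𝓝 (0 * C)) := by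
    refine Tendsto.mul_const C ((tendsto_rpow_neg_atTop hδ).comp ?_)
    exact tendsto_atTop_add_const_right _ _ tendsto_natCast_atTop_atTop
  rw [zero_mul] at l4
  have h5 := le_of_tendsto_of_tendsto' l3 l4 fun n => hk (n + 1) (by positivity)
  have h6 := abs_eq_zero.1 (le_antisymm h5 (abs_nonneg _))
  rw [energyS, energyS]
  linarith

end IsWeakSolution

/-! ### Weighted mass, weighted momentum and their time derivatives. -/

/-- `m` is a smooth bounded primitive of the bounded function `m'`. -/
structure IsPrimitive (m m' : ℝ →ᵇ ℝ) : Prop where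
  contDiff : ContDiff ℝ ∞ m
  deriv : ∀ t, deriv m t = m' t

/-- Multiplication by a smooth bounded weight in `x_j`, on the Sobolev space. -/
def wSob (j : Fin d) {m m' : ℝ →ᵇ ℝ} (h : IsPrimitive m m') : Sob d →L[ℂ] Sob d :=
  weightSob j m m' h.contDiff h.deriv

theorem fnL_wSob (j : Fin d) {m m' : ℝ →ᵇ ℝ} (h : IsPrimitive m m') (u : Sob d) :
    fnL (wSob j h u) = wmul j m (fnL u) := rfl

theorem weakD_wSob (j : Fin d) {m m' : ℝ →ᵇ ℝ} (h : IsPrimitive m m') (u : Sob d)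
    (i : Option (Fin d)) : weakD i (wSob j h u) =
      wmul j m (weakD i u) + if i = some j then wmul j m' (fnL u) else 0 :=
  weakD_weightSob ..

/-- The weighted potential `∫ m(x_j) |u|^{α+2}`. -/
def wpot (α : ℝ) (j : Fin d) (m : ℝ →ᵇ ℝ) (u : Sob d) : ℝ := ∫ p, m (p.1 j) * ‖fnL u p‖ ^ (α + 2)

theorem nlForm_wSob_self {α : ℝ} (h : IsIntercritical d α) (j : Fin d) {m m' : ℝ →ᵇ ℝ}
    (hm : IsPrimitive m m') (u : Sob d) : nlForm α (wSob j hm u) u = (wpot α j m u : ℂ) := by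
  rw [nlForm_def, wpot, ← integral_complex_ofReal]
  refine integral_congr_ae ?_
  rw [fnL_wSob]
  filter_upwards [coeFn_wmul j m (fnL u)] with p hp
  rw [hp, star_mul', Complex.star_def, Complex.conj_ofReal, ← Complex.star_def, mul_assoc,
    star_mul_nl h.pos, Complex.ofReal_mul]

theorem continuous_wpot {α : ℝ} (h : IsIntercritical d α) (j : Fin d) {m m' : ℝ →ᵇ ℝ}
    (hm : IsPrimitive m m') : Continuous (wpot α j m : Sob d → ℝ) := by
  have : (wpot α j m : Sob d → ℝ) = fun u => (nlForm α (wSob j hm u) u).re := by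
    funext u
    rw [nlForm_wSob_self h, Complex.ofReal_re]
  rw [this]
  exact Complex.continuous_re.comp ((continuous_nlForm h).comp (g := fun q : Sob d × Sob d =>
    nlForm α q.1 q.2) (f := fun u => (wSob j hm u, u))
    ((wSob j hm).continuous.prodMk continuous_id))

theorem aestronglyMeasurable_weight (j : Fin d) (m : ℝ →ᵇ ℝ) :
    AEStronglyMeasurable (fun p : Guide d => m (p.1 j)) volume :=
  (m.continuous.comp ((EuclideanSpace.proj (𝕜 := ℝ) j).continuous.comp
    continuous_fst)).aestronglyMeasurable

theorem integrable_wpot {α : ℝ} (h : IsIntercritical d α) (j : Fin d) (m : ℝ →ᵇ ℝ) (u : Sob d) :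
    Integrable fun p => m (p.1 j) * ‖fnL u p‖ ^ (α + 2) :=
  (integrable_pot h u).bdd_mul (aestronglyMeasurable_weight j m)
    (ae_of_all _ fun p => m.norm_coe_le_norm (p.1 j))

theorem abs_wpot_le {α : ℝ} (h : IsIntercritical d α) (j : Fin d) (m : ℝ →ᵇ ℝ) (u : Sob d) :
    |wpot α j m u| ≤ ‖m‖ * pot α u := by
  rw [wpot, pot, ← integral_const_mul, ← Real.norm_eq_abs]
  refine norm_integral_le_of_norm_le ((integrable_pot h u).const_mul _) (ae_of_all _ fun p => ?_)
  rw [norm_mul, Real.norm_of_nonneg (by positivity : 0 ≤ ‖fnL u p‖ ^ (α + 2))]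
  gcongr
  exact m.norm_coe_le_norm _

theorem weakForm_smul_left {α : ℝ} (c : ℂ) (v u : Sob d) :
    weakForm α (c • v) u = star c * weakForm α v u := by
  simp only [weakForm_def, nlForm_smul_left, map_smul, inner_smul_left, Complex.star_def]
  rw [← Finset.mul_sum]
  ring

theorem shift_fst_apply (j : Fin d) (s : ℝ) (p : Guide d) : (p + shift (some j) s).1 j = p.1 j + s := by
  simp [shift, cover, basisDir]

/-- The potential part of the derivative of the momentum, up to a quadratic error. -/
def potIncr (α : ℝ) (j : Fin d) (m : ℝ →ᵇ ℝ) (s : ℝ) (u : Sob d) : ℝ :=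
  s⁻¹ * (wpot α j m (transSob (shift (some j) s) u) - wpot α j m u)

theorem IsPrimitive.abs_sub_le {m m' : ℝ →ᵇ ℝ} (hm : IsPrimitive m m') (x y : ℝ) :
    |m y - m x| ≤ ‖m'‖ * |y - x| := by
  have := Convex.norm_image_sub_le_of_norm_deriv_le (f := m) (C := ‖m'‖) (s := univ) (x := x) (y := y)
    (fun t _ => hm.contDiff.differentiable (by simp) t)
    (fun t _ => by rw [hm.deriv]; exact m'.norm_coe_le_norm t) convex_univ (mem_univ _) (mem_univ _)
  simpa [Real.norm_eq_abs] using this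

/-- A change of variables moves the translation from `u` to the weight, so that only a smooth
function is differenced. -/
theorem potIncr_eq {α : ℝ} (h : IsIntercritical d α) (j : Fin d) (m : ℝ →ᵇ ℝ) (s : ℝ) (u : Sob d) :
    potIncr α j m s u = ∫ p, (s⁻¹ * (m (p.1 j - s) - m (p.1 j))) * ‖fnL u p‖ ^ (α + 2) := by
  have e1 : wpot α j m (transSob (shift (some j) s) u) =
      ∫ p, m (p.1 j - s) * ‖fnL u p‖ ^ (α + 2) := by
    rw [wpot, fnL_transSob]
    rw [← integral_add_right_eq_self (fun p : Guide d => m (p.1 j - s) * ‖fnL u p‖ ^ (α + 2))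
      (shift (some j) s)]
    refine integral_congr_ae ?_
    filter_upwards [coeFn_trans (shift (some j) s) (fnL u)] with p hp
    rw [hp, shift_fst_apply, add_sub_cancel_right]
  have hi : Integrable fun p : Guide d => m (p.1 j - s) * ‖fnL u p‖ ^ (α + 2) :=
    (integrable_pot h u).bdd_mul ((m.continuous.comp (((EuclideanSpace.proj (𝕜 := ℝ) j).continuous.comp
      continuous_fst).sub continuous_const)).aestronglyMeasurable)
      (ae_of_all _ fun p => m.norm_coe_le_norm (p.1 j - s))
  rw [potIncr, e1, wpot, ← integral_sub hi (integrable_wpot h j m u), ← integral_const_mul]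
  congr 1
  funext p
  ring

theorem norm_potIncr_integrand_le {α : ℝ} {m m' : ℝ →ᵇ ℝ} (hm : IsPrimitive m m') (s x A : ℝ)
    (hA : 0 ≤ A) :
    ‖(s⁻¹ * (m (x - s) - m x)) * A ^ (α + 2)‖ ≤ ‖m'‖ * A ^ (α + 2) := by
  have h1 := hm.abs_sub_le x (x - s)
  rw [sub_sub_cancel_left, abs_neg] at h1
  rw [norm_mul, norm_mul, norm_inv, Real.norm_eq_abs, Real.norm_eq_abs,
    Real.norm_of_nonneg (by positivity : 0 ≤ A ^ (α + 2))]
  gcongr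
  rcases eq_or_ne s 0 with rfl | hs
  · simp
  · rw [inv_mul_le_iff₀ (abs_pos.2 hs), mul_comm]
    exact h1

theorem abs_potIncr_le {α : ℝ} (h : IsIntercritical d α) (j : Fin d) {m m' : ℝ →ᵇ ℝ}
    (hm : IsPrimitive m m') (s : ℝ) (u : Sob d) : |potIncr α j m s u| ≤ ‖m'‖ * pot α u := by
  rw [potIncr_eq h, pot, ← integral_const_mul, ← Real.norm_eq_abs]
  exact norm_integral_le_of_norm_le ((integrable_pot h u).const_mul _)
    (ae_of_all _ fun p => norm_potIncr_integrand_le hm s _ _ (norm_nonneg _))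

/-- After the change of variables the weight is shifted by -s, whence the minus sign in the limit.
-/
theorem tendsto_potIncr {α : ℝ} (h : IsIntercritical d α) (j : Fin d) {m m' : ℝ →ᵇ ℝ}
    (hm : IsPrimitive m m') (u : Sob d) :
    Tendsto (fun s => potIncr α j m s u) (𝓝[>] 0) (𝓝 (-wpot α j m' u)) := by
  simp only [potIncr_eq h]
  rw [wpot, ← integral_neg]
  refine tendsto_integral_filter_of_dominated_convergence (fun p => ‖m'‖ * ‖fnL u p‖ ^ (α + 2))
    (Eventually.of_forall fun s => ?_) (Eventually.of_forall fun s => ae_of_all _ fun p =>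
      norm_potIncr_integrand_le hm s _ _ (norm_nonneg _))
    ((integrable_pot h u).const_mul _) (ae_of_all _ fun p => ?_)
  · refine AEStronglyMeasurable.mul (Continuous.aestronglyMeasurable ?_)
      (integrable_pot h u).aestronglyMeasurable
    have : Continuous fun p : Guide d => p.1 j :=
      (EuclideanSpace.proj (𝕜 := ℝ) j).continuous.comp continuous_fst
    exact continuous_const.mul ((m.continuous.comp (this.sub continuous_const)).sub
      (m.continuous.comp this))
  · have h1 : HasDerivAt m (m' (p.1 j)) (p.1 j) := by
      rw [← hm.deriv]
      exact (hm.contDiff.differentiable (by simp) _).hasDerivAt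
    have h2 := (hasDerivAt_iff_tendsto_slope_zero.1 h1)
    have h3 : Tendsto (fun s : ℝ => -s) (𝓝[>] 0) (𝓝[≠] 0) := by
      refine tendsto_nhdsWithin_of_tendsto_nhds_of_eventually_within _ ?_ ?_
      · have := (continuous_neg (G := ℝ)).tendsto 0
        rw [neg_zero] at this
        exact this.mono_left nhdsWithin_le_nhds
      · filter_upwards [self_mem_nhdsWithin] with s hs
        have : (0 : ℝ) < s := hs
        exact fun h => by
          have : -s = 0 := h
          linarith
    have h4 := ((h2.comp h3).neg).mul_const (‖fnL u p‖ ^ (α + 2))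
    rw [← neg_mul]
    refine h4.congr fun s => ?_
    simp only [Function.comp_apply, smul_eq_mul, inv_neg, sub_eq_add_neg (p.1 j) s]
    ring

/-- The linear part of the derivative of the momentum. -/
def linPart (j : Fin d) (m : ℝ →ᵇ ℝ) (s : ℝ) (u : Sob d) : ℝ :=
  (⟪wmul j m (diffQ (some j) s (fnL u)), weakD (some j) u⟫_ℂ).re +
    (⟪diffQ (some j) (-s) (wmul j m (fnL u)), weakD (some j) u⟫_ℂ).re

theorem linPart_eq (j : Fin d) (m : ℝ →ᵇ ℝ) (s : ℝ) (u : Sob d) : linPart j m s u =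
    s⁻¹ * ((⟪wmul j m (trans (shift (some j) s) (fnL u)), weakD (some j) u⟫_ℂ).re -
      (⟪wmul j m (fnL u), trans (shift (some j) s) (weakD (some j) u)⟫_ℂ).re) := by
  rw [linPart, inner_diffQ_left, neg_neg, diffQ, diffQ, map_smul, map_sub, inner_smul_left,
    inner_smul_right, inner_sub_left, inner_sub_right, map_inv₀, Complex.conj_ofReal,
    ← Complex.ofReal_inv, Complex.neg_re, Complex.re_ofReal_mul, Complex.re_ofReal_mul,
    Complex.sub_re, Complex.sub_re]
  ring

theorem abs_linPart_le (j : Fin d) {m m' : ℝ →ᵇ ℝ} (hm : IsPrimitive m m') (s : ℝ) (u : Sob d) :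
    |linPart j m s u| ≤ (‖m‖ + ‖wSob j hm‖) * ‖u‖ ^ 2 := by
  have h0 := norm_weakD_le (some j) u
  have h1 : ‖diffQ (some j) s (fnL u)‖ ≤ ‖u‖ := (norm_diffQ_le (isWeakDeriv_weakD _ u) s).trans h0
  have h2 : ‖diffQ (some j) (-s) (wmul j m (fnL u))‖ ≤ ‖wSob j hm‖ * ‖u‖ :=
    (norm_diffQ_le (isWeakDeriv_weakD (some j) (wSob j hm u)) (-s)).trans
      ((norm_weakD_le _ _).trans ((wSob j hm).le_opNorm u))
  have h3 : ‖⟪wmul j m (diffQ (some j) s (fnL u)), weakD (some j) u⟫_ℂ‖ ≤ ‖m‖ * ‖u‖ * ‖u‖ :=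
    (norm_inner_le_norm _ _).trans (mul_le_mul ((norm_wmul_le _ _ _).trans (by gcongr)) h0
      (norm_nonneg _) (by positivity))
  have h4 : ‖⟪diffQ (some j) (-s) (wmul j m (fnL u)), weakD (some j) u⟫_ℂ‖ ≤
      ‖wSob j hm‖ * ‖u‖ * ‖u‖ :=
    (norm_inner_le_norm _ _).trans (mul_le_mul h2 h0 (norm_nonneg _) (by positivity))
  rw [linPart]
  refine (abs_add_le _ _).trans (((add_le_add (Complex.abs_re_le_norm _)
    (Complex.abs_re_le_norm _)).trans (add_le_add h3 h4)).trans (le_of_eq (by ring)))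

/-- The second term tends to the pairing of ∂_j(mu) = m ∂_j u + m'u with ∂_j u, which doubles the
first term and adds the one with m'. -/
theorem tendsto_linPart (j : Fin d) {m m' : ℝ →ᵇ ℝ} (hm : IsPrimitive m m') (u : Sob d) :
    Tendsto (fun s => linPart j m s u) (𝓝[>] 0)
      (𝓝 (2 * (⟪wmul j m (weakD (some j) u), weakD (some j) u⟫_ℂ).re +
        (⟪wmul j m' (fnL u), weakD (some j) u⟫_ℂ).re)) := by
  have l1 := (tendsto_diffQ (isWeakDeriv_weakD (some j) u)).mono_left
    (nhdsWithin_mono (0 : ℝ) fun s (hs : 0 < s) => (ne_of_gt hs : s ≠ 0))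
  have l2 : Tendsto (fun s => diffQ (some j) (-s) (wmul j m (fnL u))) (𝓝[>] 0)
      (𝓝 (weakD (some j) (wSob j hm u))) := by
    refine (tendsto_diffQ (isWeakDeriv_weakD (some j) (wSob j hm u))).comp ?_
    refine tendsto_nhdsWithin_of_tendsto_nhds_of_eventually_within _ ?_ ?_
    · have := (continuous_neg (G := ℝ)).tendsto 0
      rw [neg_zero] at this
      exact this.mono_left nhdsWithin_le_nhds
    · filter_upwards [self_mem_nhdsWithin] with s hs
      exact neg_ne_zero.2 (ne_of_gt hs)
  have l3 := ((Complex.continuous_re.tendsto _).comp ((((wmul j m).continuous.tendsto _).comp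
    l1).inner (𝕜 := ℂ) (tendsto_const_nhds (x := weakD (some j) u)))).add
    ((Complex.continuous_re.tendsto _).comp (l2.inner (𝕜 := ℂ)
      (tendsto_const_nhds (x := weakD (some j) u))))
  rw [weakD_wSob, if_pos rfl, inner_add_left, Complex.add_re, ← add_assoc, ← two_mul] at l3
  exact l3

theorem continuous_linPart (j : Fin d) (m : ℝ →ᵇ ℝ) (s : ℝ) :
    Continuous (linPart j m s : Sob d → ℝ) := by
  have h1 := (weakD (d := d) (some j)).continuous
  have h2 := (fnL (d := d)).continuous
  exact (Complex.continuous_re.comp (((wmul j m).continuous.comp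
    ((continuous_diffQ _ _).comp h2)).inner h1)).add (Complex.continuous_re.comp
    (((continuous_diffQ _ _).comp ((wmul j m).continuous.comp h2)).inner h1))

theorem continuous_potIncr {α : ℝ} (h : IsIntercritical d α) (j : Fin d) {m m' : ℝ →ᵇ ℝ}
    (hm : IsPrimitive m m') (s : ℝ) : Continuous (potIncr α j m s : Sob d → ℝ) :=
  continuous_const.mul (((continuous_wpot h j hm).comp (transSob _).continuous).sub
    (continuous_wpot h j hm))

/-- The momentum density form with a difference quotient in place of the derivative. -/
def momQ (j : Fin d) (m : ℝ →ᵇ ℝ) (s : ℝ) (u : Sob d) : ℝ :=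
  (⟪wmul j m (fnL u), diffQ (some j) s (fnL u)⟫_ℂ).im

/-- The weighted momentum `Im ∫ m(x_j) ū ∂_j u`. -/
def mom (j : Fin d) (m : ℝ →ᵇ ℝ) (u : Sob d) : ℝ :=
  (⟪wmul j m (fnL u), weakD (some j) u⟫_ℂ).im

/-- The time derivative of the weighted momentum, for a weight with derivatives `m'` and `m''`. -/
def force (α : ℝ) (j : Fin d) (m' m'' : ℝ →ᵇ ℝ) (u : Sob d) : ℝ :=
  2 * (⟪wmul j m' (weakD (some j) u), weakD (some j) u⟫_ℂ).re +
    (⟪wmul j m'' (fnL u), weakD (some j) u⟫_ℂ).re - α / (α + 2) * wpot α j m' u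

theorem inner_wmul_self_im (j : Fin d) (m : ℝ →ᵇ ℝ) (f : L2 d) : (⟪wmul j m f, f⟫_ℂ).im = 0 := by
  have h1 := inner_wmul_left j m f f
  have h2 := inner_conj_symm (𝕜 := ℂ) (wmul j m f) f
  rw [← h1] at h2
  exact Complex.conj_eq_iff_im.1 h2

theorem momQ_eq (j : Fin d) (m : ℝ →ᵇ ℝ) (s : ℝ) (u : Sob d) :
    momQ j m s u = s⁻¹ * (⟪wmul j m (fnL u), trans (shift (some j) s) (fnL u)⟫_ℂ).im := by
  rw [momQ, diffQ, inner_smul_right, inner_sub_right, ← Complex.ofReal_inv, Complex.im_ofReal_mul,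
    Complex.sub_im, inner_wmul_self_im, sub_zero]

theorem tendsto_momQ (j : Fin d) (m : ℝ →ᵇ ℝ) (u : Sob d) :
    Tendsto (fun s => momQ j m s u) (𝓝[>] 0) (𝓝 (mom j m u)) :=
  ((Complex.continuous_im.tendsto _).comp (tendsto_const_nhds.inner (𝕜 := ℂ)
    (tendsto_diffQ (isWeakDeriv_weakD (some j) u)))).mono_left
      (nhdsWithin_mono _ fun _ hs => ne_of_gt hs)

/-- The commutator of a translation and a weight. -/
def transComm (j : Fin d) {m m' : ℝ →ᵇ ℝ} (hm : IsPrimitive m m') (z : Guide d) :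
    Sob d →L[ℂ] Sob d :=
  (transSob (-z)).comp (wSob j hm) - (wSob j hm).comp (transSob z)

theorem transComm_apply (j : Fin d) {m m' : ℝ →ᵇ ℝ} (hm : IsPrimitive m m') (z : Guide d)
    (u : Sob d) : transComm j hm z u = transSob (-z) (wSob j hm u) - wSob j hm (transSob z u) := rfl

theorem fnL_transComm (j : Fin d) {m m' : ℝ →ᵇ ℝ} (hm : IsPrimitive m m') (z : Guide d)
    (u : Sob d) : fnL (transComm j hm z u) =
      trans (-z) (wmul j m (fnL u)) - wmul j m (trans z (fnL u)) := rfl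

/-- The weight depends on x_j alone: in the other directions the two halves of the commutator have
equal real parts, and for i = j only the terms where the derivative falls on the weight remain. -/
theorem sum_inner_transComm_re (j : Fin d) {m m' : ℝ →ᵇ ℝ} (hm : IsPrimitive m m') (z : Guide d)
    (u : Sob d) : (∑ i, ⟪weakD i (transComm j hm z u), weakD i u⟫_ℂ).re =
      (⟪wmul j m' (fnL u), trans z (weakD (some j) u)⟫_ℂ).re -
        (⟪wmul j m' (trans z (fnL u)), weakD (some j) u⟫_ℂ).re := by
  have hsymm : ∀ f : L2 d, (⟪trans (-z) (wmul j m f), f⟫_ℂ).re = (⟪wmul j m (trans z f), f⟫_ℂ).re := by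
    intro f
    rw [inner_trans_left, neg_neg, inner_wmul_left, ← inner_conj_symm, Complex.conj_re]
  rw [Complex.re_sum, Finset.sum_eq_single (some j)]
  · rw [transComm_apply, map_sub, weakD_transSob, weakD_wSob, weakD_wSob, if_pos rfl, if_pos rfl,
      weakD_transSob, fnL_transSob, map_add, inner_sub_left, inner_add_left, inner_add_left,
      Complex.sub_re, Complex.add_re, Complex.add_re, hsymm, inner_trans_left, neg_neg]
    ring
  · intro i _ hi
    rw [transComm_apply, map_sub, weakD_transSob, weakD_wSob, weakD_wSob, if_neg hi, if_neg hi,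
      weakD_transSob, add_zero, add_zero, inner_sub_left, Complex.sub_re, hsymm, sub_self]
  · intro h
    exact absurd (Finset.mem_univ _) h

/-- With v the translate of `u`, the nonlinear term is the integral of m(x_j) Re(ūv)(|v|^α - |u|^α).
By `abs_re_star_mul_rpow_sub_le` this density is an increment of α/(α+2)|·|^{α+2} up to a quadratic
error. Two increments contribute s² against the factor s⁻¹, leaving O(s). -/
theorem enorm_nonlinear_sub_potIncr_le {α : ℝ} (h : IsIntercritical d α) (j : Fin d)
    {m m' : ℝ →ᵇ ℝ} (hm : IsPrimitive m m') {η : ℝ≥0∞} {s : ℝ} (hs : 0 < s) {u : Sob d}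
    (h1 : ∫⁻ p, ‖fnL u p‖ₑ ^ α * ‖diffQ (some j) s (fnL u) p‖ₑ ^ (2 : ℝ) ≤ η)
    (h2 : ∫⁻ p, ‖trans (shift (some j) s) (fnL u) p‖ₑ ^ α *
      ‖diffQ (some j) s (fnL u) p‖ₑ ^ (2 : ℝ) ≤ η) :
    ‖s⁻¹ * (nlForm α (transComm j hm (shift (some j) s) u) u).re -
      α / (α + 2) * potIncr α j m s u‖ₑ ≤ ENNReal.ofReal (s * (2 * (‖m‖ * (2 + α)))) * η := by
  have hα := h.pos
  obtain ⟨z, hz⟩ : ∃ z, z = shift (some j) s := ⟨_, rfl⟩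
  obtain ⟨v, hv⟩ : ∃ v, v = transSob z u := ⟨_, rfl⟩
  have hvf : trans z (fnL u) = fnL v := by rw [hv, fnL_transSob]
  have e0 : nlForm α (transComm j hm z u) u = nlForm α (wSob j hm u) v - nlForm α (wSob j hm v) u := by
    rw [transComm_apply, nlForm_sub_left h, nlForm_transSob_neg, hv]
  let Φ : Guide d → ℝ := fun p => m (p.1 j) * ((star (fnL u p) * fnL v p).re *
    (‖fnL v p‖ ^ α - ‖fnL u p‖ ^ α) - α / (α + 2) * (‖fnL v p‖ ^ (α + 2) - ‖fnL u p‖ ^ (α + 2)))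
  have i1 := integrable_nlForm h (wSob j hm u) v
  have i2 := integrable_nlForm h (wSob j hm v) u
  have i3 := integrable_wpot h j m v
  have i4 := integrable_wpot h j m u
  have e1 : (nlForm α (wSob j hm u) v).re - (nlForm α (wSob j hm v) u).re -
      α / (α + 2) * (wpot α j m v - wpot α j m u) = ∫ p, Φ p := by
    have r1 : (nlForm α (wSob j hm u) v).re = ∫ p, (star (fnL (wSob j hm u) p) * nl α (fnL v p)).re := by
      rw [nlForm_def]
      exact (integral_re i1).symm
    have r2 : (nlForm α (wSob j hm v) u).re = ∫ p, (star (fnL (wSob j hm v) p) * nl α (fnL u p)).re := by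
      rw [nlForm_def]
      exact (integral_re i2).symm
    have j1 : Integrable fun p => (star (fnL (wSob j hm u) p) * nl α (fnL v p)).re := i1.re
    have j2 : Integrable fun p => (star (fnL (wSob j hm v) p) * nl α (fnL u p)).re := i2.re
    have i5 : Integrable fun p => (star (fnL (wSob j hm u) p) * nl α (fnL v p)).re -
        (star (fnL (wSob j hm v) p) * nl α (fnL u p)).re := j1.sub j2
    have i6 : Integrable fun p => α / (α + 2) * (m (p.1 j) * ‖fnL v p‖ ^ (α + 2) -
        m (p.1 j) * ‖fnL u p‖ ^ (α + 2)) := (i3.sub i4).const_mul _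
    rw [r1, r2, wpot, wpot, ← integral_sub i3 i4, ← integral_sub j1 j2, ← integral_const_mul]
    refine (integral_sub i5 i6).symm.trans (integral_congr_ae ?_)
    rw [fnL_wSob, fnL_wSob]
    filter_upwards [coeFn_wmul j m (fnL u), coeFn_wmul j m (fnL v)] with p p1 p2
    have q : ∀ a b : ℂ, (star ((m (p.1 j) : ℂ) * a) * nl α b).re =
        m (p.1 j) * (‖b‖ ^ α * (star a * b).re) := by
      intro a b
      rw [star_mul', Complex.star_def, Complex.conj_ofReal, mul_assoc, Complex.re_ofReal_mul, nl,
        mul_left_comm, Complex.re_ofReal_mul]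
    have q2 : (star (fnL v p) * fnL u p).re = (star (fnL u p) * fnL v p).re := by
      simp only [Complex.star_def, Complex.mul_re, Complex.conj_re, Complex.conj_im]
      ring
    simp only [p1, p2, q, q2, Φ]
    ring
  have e2 : s⁻¹ * (nlForm α (transComm j hm z u) u).re - α / (α + 2) * potIncr α j m s u =
      s⁻¹ * ∫ p, Φ p := by
    rw [e0, Complex.sub_re, ← e1, potIncr, ← hz, ← hv]
    ring
  rw [← hz, hvf] at h2
  rw [← hz, e2, enorm_mul, Real.enorm_of_nonneg (by positivity : 0 ≤ s⁻¹)]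
  have hb := enorm_integral_le_of_incr (Φ := Φ) (c := ‖m‖ * (2 + α)) hs hα.le (by positivity) h1
    (by rwa [← hz, hvf]) (ae_of_all _ fun p => by
      rw [← hz, hvf]
      have := abs_re_star_mul_rpow_sub_le hα (fnL u p) (fnL v p)
      calc ‖Φ p‖ ≤ ‖m‖ * ((2 + α) * (‖fnL u p‖ ^ α + ‖fnL v p‖ ^ α) * ‖fnL v p - fnL u p‖ ^ 2) := by
            rw [norm_mul]
            exact mul_le_mul (m.norm_coe_le_norm _) this (norm_nonneg _) (norm_nonneg _)
        _ = _ := by ring)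
  calc _ ≤ ENNReal.ofReal s⁻¹ * (ENNReal.ofReal (2 * (‖m‖ * (2 + α)) * s ^ 2) * η) := by gcongr
    _ = _ := by
        rw [← mul_assoc, ← ENNReal.ofReal_mul (by positivity)]
        congr 2
        field_simp

namespace IsWeakSolution

variable {α : ℝ} {I : Set ℝ} {U : ℝ → Sob d}

/-- The commutator τ_{-z}m - mτ_z is antisymmetric, so i/2 times it is symmetric; s⁻¹ times its
quadratic form is the momentum built with a difference quotient. -/
theorem hasDerivAt_momQ (S : IsWeakSolution α I U) (h : IsIntercritical d α) (j : Fin d)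
    {m m' : ℝ →ᵇ ℝ} (hm : IsPrimitive m m') (s : ℝ) {t : ℝ} (ht : t ∈ I) :
    HasDerivAt (fun t => momQ j m s (U t)) (linPart j m' s (U t) +
      s⁻¹ * (nlForm α (transComm j hm (shift (some j) s) (U t)) (U t)).re) t := by
  obtain ⟨z, hz⟩ : ∃ z, z = shift (some j) s := ⟨_, rfl⟩
  let L : Sob d →L[ℝ] Sob d := ((Complex.I / 2) • transComm j hm z).restrictScalars ℝ
  have hLapp : ∀ v, L v = (Complex.I / 2) • transComm j hm z v := fun v => rfl
  have hconj : (starRingEnd ℂ) (Complex.I / 2) = -(Complex.I / 2) := by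
    rw [map_div₀, Complex.conj_I, Complex.conj_ofNat, neg_div]
  have hL : ∀ v w, (⟪fnL (L v), fnL w⟫_ℂ).re = (⟪fnL v, fnL (L w)⟫_ℂ).re := by
    intro v w
    rw [hLapp, hLapp, map_smul, map_smul, fnL_transComm, fnL_transComm, inner_smul_left,
      inner_smul_right, hconj, inner_sub_left, inner_sub_right, inner_trans_left, neg_neg,
      ← inner_trans_left, inner_wmul_left, inner_wmul_left, ← inner_wmul_left j m (fnL v),
      inner_trans_left]
    congr 1
    rw [inner_wmul_left]
    ring
  have h1 := S.hasDerivAt_quadratic h L hL ht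
  have h2 := h1.const_mul s⁻¹
  refine (h2.congr_of_eventuallyEq (Eventually.of_forall fun t' => ?_)).congr_deriv ?_
  · have e : ∀ f : L2 d, ⟪trans (-z) (wmul j m f) - wmul j m (trans z f), f⟫_ℂ =
        ⟪wmul j m f, trans z f⟫_ℂ - (starRingEnd ℂ) ⟪wmul j m f, trans z f⟫_ℂ := by
      intro f
      rw [inner_sub_left, inner_trans_left, neg_neg, inner_wmul_left j m (trans z f), inner_conj_symm]
    simp only [hLapp, map_smul, fnL_transComm]
    rw [inner_smul_left, e, hconj, Complex.sub_conj, momQ_eq, ← hz]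
    congr 1
    have : -(Complex.I / 2) * (((2 * (⟪wmul j m (fnL (U t')), trans z (fnL (U t'))⟫_ℂ).im : ℝ) : ℂ) *
        Complex.I) = (((⟪wmul j m (fnL (U t')), trans z (fnL (U t'))⟫_ℂ).im : ℝ) : ℂ) := by
      push_cast
      linear_combination (-(⟪wmul j m (fnL (U t')), trans z (fnL (U t'))⟫_ℂ).im : ℂ) * Complex.I_sq
    rw [this, Complex.ofReal_re]
  · have e := sum_inner_transComm_re j hm z (U t)
    rw [hLapp, weakForm_smul_left, Complex.star_def, hconj, weakForm_def, linPart_eq, ← hz]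
    have e3 : ∀ X : ℂ, (-(Complex.I / 2) * (Complex.I * X)) = ((1 / 2 : ℝ) : ℂ) * X := by
      intro X
      push_cast
      linear_combination (-(1 / 2) * X) * Complex.I_sq
    rw [e3, Complex.re_ofReal_mul, Complex.add_re, Complex.neg_re, e]
    ring

/-- Tested against the weighted solution, every pairing in the weak form is real except the one
where ∂_j falls on the weight. -/
theorem hasDerivAt_wmul (S : IsWeakSolution α I U) (h : IsIntercritical d α) (j : Fin d)
    {m m' : ℝ →ᵇ ℝ} (hm : IsPrimitive m m') {t : ℝ} (ht : t ∈ I) :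
    HasDerivAt (fun t => (⟪wmul j m (fnL (U t)), fnL (U t)⟫_ℂ).re) (2 * mom j m' (U t)) t := by
  have h1 := S.hasDerivAt_quadratic h ((wSob j hm).restrictScalars ℝ) (fun v w => by
    simp only [ContinuousLinearMap.coe_restrictScalars', fnL_wSob]
    rw [inner_wmul_left]) ht
  refine h1.congr_deriv ?_
  simp only [ContinuousLinearMap.coe_restrictScalars']
  congr 1
  rw [weakForm_def, nlForm_wSob_self h, Complex.I_mul_re, Complex.add_im, Complex.ofReal_im,
    Complex.neg_im, Complex.im_sum, Finset.sum_eq_single (some j)]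
  · rw [weakD_wSob, if_pos rfl, inner_add_left, Complex.add_im, inner_wmul_self_im, mom]
    ring
  · intro i _ hi
    rw [weakD_wSob, if_neg hi, add_zero, inner_wmul_self_im]
  · intro h
    exact absurd (Finset.mem_univ _) h

theorem abs_momQ_sub_le (S : IsWeakSolution α I U) (h : IsIntercritical d α) (j : Fin d)
    {m m' : ℝ →ᵇ ℝ} (hm : IsPrimitive m m') {a b : ℝ} (ha : a ∈ I) (hb : b ∈ I)
    (hab : a ≤ b) {η : ℝ → ℝ≥0∞} (hη : ∫⁻ t in Icc a b, η t ≠ ⊤) {s : ℝ} (hs : 0 < s)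
    (hη1 : ∀ t ∈ Icc a b, ∫⁻ p, ‖fnL (U t) p‖ₑ ^ α *
      ‖diffQ (some j) s (fnL (U t)) p‖ₑ ^ (2 : ℝ) ≤ η t)
    (hη2 : ∀ t ∈ Icc a b, ∫⁻ p, ‖trans (shift (some j) s) (fnL (U t)) p‖ₑ ^ α *
      ‖diffQ (some j) s (fnL (U t)) p‖ₑ ^ (2 : ℝ) ≤ η t) :
    |momQ j m s (U b) - momQ j m s (U a) -
      ∫ t in a..b, (linPart j m' s (U t) + α / (α + 2) * potIncr α j m s (U t))| ≤
      s * ((2 * (‖m‖ * (2 + α))) * (∫⁻ t in Icc a b, η t).toReal) := by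
  have hα := h.pos
  have hsub : uIcc a b ⊆ I := S.uIcc_subset ha hb
  have hc1 : ContinuousOn (fun t => linPart j m' s (U t) +
      s⁻¹ * (nlForm α (transComm j hm (shift (some j) s) (U t)) (U t)).re) I := by
    refine ((continuous_linPart j m' s).comp_continuousOn S.continuousOn).add
      (continuousOn_const.mul (Complex.continuous_re.comp_continuousOn
        ((continuous_nlForm h).comp_continuousOn (f := fun t =>
          (transComm j hm (shift (some j) s) (U t), U t)) ?_)))
    exact ((transComm j hm _).continuous.comp_continuousOn S.continuousOn).prodMk S.continuousOn
  have hc2 : ContinuousOn (fun t => linPart j m' s (U t) + α / (α + 2) * potIncr α j m s (U t)) I :=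
    ((continuous_linPart j m' s).comp_continuousOn S.continuousOn).add
      (continuousOn_const.mul ((continuous_potIncr h j hm s).comp_continuousOn S.continuousOn))
  have hi1 := (hc1.mono hsub).intervalIntegrable (μ := volume)
  have hi2 := (hc2.mono hsub).intervalIntegrable (μ := volume)
  rw [← intervalIntegral.integral_eq_sub_of_hasDerivAt
    (fun t ht => S.hasDerivAt_momQ h j hm s (hsub ht)) hi1, ← intervalIntegral.integral_sub hi1 hi2]
  refine (abs_intervalIntegral_le_of_enorm_le hab (c := s * (2 * (‖m‖ * (2 + α)))) (by positivity) hη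
    fun t ht => ?_).trans (le_of_eq (by ring))
  rw [add_sub_add_left_eq_sub]
  exact enorm_nonlinear_sub_potIncr_le h j hm hs (hη1 t ht) (hη2 t ht)

theorem continuousOn_force (S : IsWeakSolution α I U) (h : IsIntercritical d α) (j : Fin d)
    {m' m'' : ℝ →ᵇ ℝ} (hm' : IsPrimitive m' m'') :
    ContinuousOn (fun t => force α j m' m'' (U t)) I := by
  have h1 := (weakD (d := d) (some j)).continuous
  have h2 := (fnL (d := d)).continuous
  have h3 : Continuous (force α j m' m'' : Sob d → ℝ) :=
    ((continuous_const.mul (Complex.continuous_re.comp (((wmul j m').continuous.comp h1).inner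
      h1))).add (Complex.continuous_re.comp (((wmul j m'').continuous.comp h2).inner h1))).sub
      (continuous_const.mul (continuous_wpot h j hm'))
  exact h3.comp_continuousOn S.continuousOn

/-- Integrated in time, the identity for difference quotients holds up to O(s). As s → 0 its
integrand converges pointwise and is dominated, uniformly in s, by a continuous function of time. -/
theorem mom_sub_eq (S : IsWeakSolution α I U) (h : IsIntercritical d α) (hs : HasSmoothing α I U)
    (j : Fin d) {m m' m'' : ℝ →ᵇ ℝ} (hm : IsPrimitive m m') (hm' : IsPrimitive m' m'') {a b : ℝ}
    (ha : a ∈ I) (hb : b ∈ I) :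
    mom j m (U b) - mom j m (U a) = ∫ t in a..b, force α j m' m'' (U t) := by
  wlog hab : a ≤ b generalizing a b
  · rw [intervalIntegral.integral_symm, ← this hb ha (le_of_not_ge hab)]
    ring
  have hα := h.pos
  have hsub : uIcc a b ⊆ I := S.uIcc_subset ha hb
  obtain ⟨η, hη, hη'⟩ := hs a ha b hb (some j)
  have l1 : Tendsto (fun s => ∫ t in a..b, (linPart j m' s (U t) +
      α / (α + 2) * potIncr α j m s (U t))) (𝓝[>] 0) (𝓝 (∫ t in a..b, force α j m' m'' (U t))) := by
    have hB : ContinuousOn (fun t => (‖m'‖ + ‖wSob j hm'‖) * ‖U t‖ ^ 2 +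
        α / (α + 2) * (‖m'‖ * pot α (U t))) I :=
      (continuousOn_const.mul (S.continuousOn.norm.pow 2)).add (continuousOn_const.mul
        (continuousOn_const.mul ((continuous_pot h).comp_continuousOn S.continuousOn)))
    refine intervalIntegral.tendsto_integral_filter_of_dominated_convergence _
      (Eventually.of_forall fun s => ?_) (Eventually.of_forall fun s => ae_of_all _ fun t ht => ?_)
      (hB.mono hsub).intervalIntegrable (ae_of_all _ fun t ht => ?_)
    · refine ContinuousOn.aestronglyMeasurable ?_ measurableSet_uIoc
      exact (((continuous_linPart j m' s).comp_continuousOn S.continuousOn).add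
        (continuousOn_const.mul ((continuous_potIncr h j hm s).comp_continuousOn
          S.continuousOn))).mono (uIoc_subset_uIcc.trans hsub)
    · refine (norm_add_le _ _).trans (add_le_add (abs_linPart_le j hm' s (U t)) ?_)
      rw [norm_mul, Real.norm_of_nonneg (by positivity : 0 ≤ α / (α + 2))]
      gcongr
      exact abs_potIncr_le h j hm s (U t)
    · have := (tendsto_linPart j hm' (U t)).add ((tendsto_potIncr h j hm (U t)).const_mul (α / (α + 2)))
      rwa [mul_neg, ← sub_eq_add_neg] at this
  have l2 := (((tendsto_momQ j m (U b)).sub (tendsto_momQ j m (U a))).sub l1).abs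
  have l3 : Tendsto (fun s : ℝ => s * ((2 * (‖m‖ * (2 + α))) * (∫⁻ t in Icc a b, η t).toReal))
      (𝓝[>] 0) (𝓝 0) := by
    have : Continuous fun s : ℝ => s * ((2 * (‖m‖ * (2 + α))) * (∫⁻ t in Icc a b, η t).toReal) := by
      fun_prop
    have h0 := this.tendsto 0
    rw [zero_mul] at h0
    exact h0.mono_left nhdsWithin_le_nhds
  have l4 := le_of_tendsto_of_tendsto l2 l3 (by
    filter_upwards [self_mem_nhdsWithin] with s hs
    exact S.abs_momQ_sub_le h j hm ha hb hab hη hs (fun t ht => (hη' t ht s hs).1)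
      fun t ht => (hη' t ht s hs).2)
  exact sub_eq_zero.1 (abs_eq_zero.1 (le_antisymm l4 (abs_nonneg _)))

theorem hasDerivAt_mom (S : IsWeakSolution α I U) (h : IsIntercritical d α) (hs : HasSmoothing α I U)
    (j : Fin d) {m m' m'' : ℝ →ᵇ ℝ} (hm : IsPrimitive m m') (hm' : IsPrimitive m' m'') {t : ℝ}
    (ht : t ∈ I) : HasDerivAt (fun t => mom j m (U t)) (force α j m' m'' (U t)) t := by
  have hc := S.continuousOn_force h j hm'
  have h1 := intervalIntegral.integral_hasDerivAt_right (f := fun t => force α j m' m'' (U t))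
    (a := t) (b := t) IntervalIntegrable.refl (hc.stronglyMeasurableAtFilter S.isOpen _ ht)
    (hc.continuousAt (S.isOpen.mem_nhds ht))
  refine (h1.add_const (mom j m (U t))).congr_of_eventuallyEq ?_
  filter_upwards [S.isOpen.mem_nhds ht] with t' ht'
  rw [← S.mom_sub_eq h hs j hm hm' ht ht', sub_add_cancel]

end IsWeakSolution

/-! ### The virial identity and the bound on the lifespan. -/

/-- A bounded weight which increases to `x²` as `ρ → 0`. -/
def virWeight (ρ : ℝ) : ℝ →ᵇ ℝ :=
  BoundedContinuousFunction.ofNormedAddCommGroup (fun x => 2 / ρ ^ 2 * (1 - Real.cos (ρ * x)))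
    (by fun_prop) (2 / ρ ^ 2 * 2) fun x => by
      have h1 := Real.cos_le_one (ρ * x)
      have h2 := Real.neg_one_le_cos (ρ * x)
      rw [norm_mul, Real.norm_of_nonneg (by positivity : 0 ≤ 2 / ρ ^ 2), Real.norm_of_nonneg (by linarith)]
      gcongr
      linarith

/-- The derivative of `virWeight ρ`. -/
def virWeight₁ (ρ : ℝ) : ℝ →ᵇ ℝ :=
  BoundedContinuousFunction.ofNormedAddCommGroup (fun x => 2 / ρ * Real.sin (ρ * x))
    (by fun_prop) |2 / ρ| fun x => by
      rw [norm_mul, Real.norm_eq_abs, Real.norm_eq_abs]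
      exact mul_le_of_le_one_right (abs_nonneg _) (Real.abs_sin_le_one _)

/-- The second derivative of `virWeight ρ`. -/
def virWeight₂ (ρ : ℝ) : ℝ →ᵇ ℝ :=
  BoundedContinuousFunction.ofNormedAddCommGroup (fun x => 2 * Real.cos (ρ * x))
    (by fun_prop) 2 fun x => by
      rw [norm_mul, Real.norm_eq_abs, Real.norm_eq_abs, abs_two]
      exact mul_le_of_le_one_right zero_le_two (Real.abs_cos_le_one _)

/-- The third derivative of `virWeight ρ`. -/
def virWeight₃ (ρ : ℝ) : ℝ →ᵇ ℝ :=
  BoundedContinuousFunction.ofNormedAddCommGroup (fun x => -(2 * ρ) * Real.sin (ρ * x))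
    (by fun_prop) (2 * |ρ|) fun x => by
      rw [norm_mul, Real.norm_eq_abs, Real.norm_eq_abs, abs_neg, abs_mul, abs_two]
      exact mul_le_of_le_one_right (by positivity) (Real.abs_sin_le_one _)

theorem virWeight_apply (ρ x : ℝ) : virWeight ρ x = 2 / ρ ^ 2 * (1 - Real.cos (ρ * x)) := rfl
theorem virWeight₁_apply (ρ x : ℝ) : virWeight₁ ρ x = 2 / ρ * Real.sin (ρ * x) := rfl
theorem virWeight₂_apply (ρ x : ℝ) : virWeight₂ ρ x = 2 * Real.cos (ρ * x) := rfl

theorem norm_virWeight₂_le (ρ : ℝ) : ‖virWeight₂ ρ‖ ≤ 2 :=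
  BoundedContinuousFunction.norm_ofNormedAddCommGroup_le _ zero_le_two _

theorem norm_virWeight₃_le (ρ : ℝ) : ‖virWeight₃ ρ‖ ≤ 2 * |ρ| :=
  BoundedContinuousFunction.norm_ofNormedAddCommGroup_le _ (by positivity) _

theorem hasDerivAt_mul_left_id (ρ x : ℝ) : HasDerivAt (fun x : ℝ => ρ * x) ρ x := by
  simpa using (hasDerivAt_id x).const_mul ρ

theorem isPrimitive_virWeight {ρ : ℝ} (hρ : ρ ≠ 0) : IsPrimitive (virWeight ρ) (virWeight₁ ρ) where
  contDiff := contDiff_const.mul (contDiff_const.sub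
    (Real.contDiff_cos.comp (contDiff_const.mul contDiff_id)))
  deriv x := by
    have h := ((hasDerivAt_mul_left_id ρ x).cos.const_sub 1).const_mul (2 / ρ ^ 2)
    refine h.deriv.trans ?_
    rw [virWeight₁_apply]
    field_simp

theorem isPrimitive_virWeight₁ {ρ : ℝ} (hρ : ρ ≠ 0) : IsPrimitive (virWeight₁ ρ) (virWeight₂ ρ) where
  contDiff := contDiff_const.mul (Real.contDiff_sin.comp (contDiff_const.mul contDiff_id))
  deriv x := by
    have h := (hasDerivAt_mul_left_id ρ x).sin.const_mul (2 / ρ)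
    refine h.deriv.trans ?_
    rw [virWeight₂_apply]
    field_simp

theorem isPrimitive_virWeight₂ (ρ : ℝ) : IsPrimitive (virWeight₂ ρ) (virWeight₃ ρ) where
  contDiff := contDiff_const.mul (Real.contDiff_cos.comp (contDiff_const.mul contDiff_id))
  deriv x := by
    have h := (hasDerivAt_mul_left_id ρ x).cos.const_mul 2
    refine h.deriv.trans ?_
    change _ = -(2 * ρ) * Real.sin (ρ * x)
    ring

theorem virWeight_nonneg (ρ x : ℝ) : 0 ≤ virWeight ρ x := by
  have h1 := Real.cos_le_one (ρ * x)
  exact mul_nonneg (by positivity) (by linarith)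

theorem virWeight_le {ρ : ℝ} (hρ : ρ ≠ 0) (x : ℝ) : virWeight ρ x ≤ x ^ 2 := by
  have h1 := Real.one_sub_sq_div_two_le_cos (x := ρ * x)
  rw [virWeight_apply]
  calc 2 / ρ ^ 2 * (1 - Real.cos (ρ * x)) ≤ 2 / ρ ^ 2 * ((ρ * x) ^ 2 / 2) := by gcongr; linarith
    _ = x ^ 2 := by field_simp

theorem abs_virWeight₁_le {ρ : ℝ} (hρ : ρ ≠ 0) (x : ℝ) : |virWeight₁ ρ x| ≤ 2 * |x| := by
  rw [virWeight₁_apply, abs_mul]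
  have : |Real.sin (ρ * x)| ≤ |ρ * x| := Real.abs_sin_le_abs
  calc |2 / ρ| * |Real.sin (ρ * x)| ≤ |2 / ρ| * |ρ * x| := by gcongr
    _ = 2 * |x| := by
      rw [← abs_mul, ← abs_two, ← abs_mul, abs_two]
      congr 1
      field_simp

theorem integrable_norm_sq (f : L2 d) : Integrable fun p => ‖f p‖ ^ 2 :=
  (Lp.memLp f).integrable_norm_pow (by norm_num)

theorem re_inner_wmul_self (j : Fin d) (m : ℝ →ᵇ ℝ) (f : L2 d) :
    (⟪wmul j m f, f⟫_ℂ).re = ∫ p, m (p.1 j) * ‖f p‖ ^ 2 := by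
  have : ⟪wmul j m f, f⟫_ℂ = ((∫ p, m (p.1 j) * ‖f p‖ ^ 2 : ℝ) : ℂ) := by
    rw [inner_eq_integral, ← integral_complex_ofReal]
    refine integral_congr_ae ?_
    filter_upwards [coeFn_wmul j m f] with p hp
    rw [hp, star_mul', Complex.star_def, Complex.conj_ofReal, mul_assoc, Complex.conj_mul']
    push_cast
    rfl
  rw [this, Complex.ofReal_re]

theorem norm_sq_eq_integral (f : L2 d) : ‖f‖ ^ 2 = ∫ p, ‖f p‖ ^ 2 := by
  have h1 : ⟪f, f⟫_ℂ = ((‖f‖ ^ 2 : ℝ) : ℂ) := by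
    rw [inner_self_eq_norm_sq_to_K]
    simp
  have h2 : ⟪f, f⟫_ℂ = ((∫ p, ‖f p‖ ^ 2 : ℝ) : ℂ) := by
    rw [inner_eq_integral, ← integral_complex_ofReal]
    congr 1
    funext p
    rw [Complex.star_def, Complex.conj_mul']
    push_cast
    rfl
  exact_mod_cast h1.symm.trans h2

theorem tendsto_integral_virWeight₂ (j : Fin d) {f : Guide d → ℝ} (hf : Integrable f) :
    Tendsto (fun ρ => ∫ p, virWeight₂ ρ (p.1 j) * f p) (𝓝[>] 0) (𝓝 (2 * ∫ p, f p)) := by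
  rw [← integral_const_mul]
  refine tendsto_integral_filter_of_dominated_convergence (fun p => 2 * ‖f p‖)
    (Eventually.of_forall fun ρ => (aestronglyMeasurable_weight j _).mul hf.aestronglyMeasurable)
    (Eventually.of_forall fun ρ => ae_of_all _ fun p => ?_) (hf.norm.const_mul 2)
    (ae_of_all _ fun p => ?_)
  · rw [norm_mul]
    gcongr
    exact ((virWeight₂ ρ).norm_coe_le_norm _).trans (norm_virWeight₂_le ρ)
  · have : Continuous fun ρ : ℝ => virWeight₂ ρ (p.1 j) * f p := by
      simp only [virWeight₂_apply]
      fun_prop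
    have h0 := this.tendsto 0
    rw [virWeight₂_apply, zero_mul, Real.cos_zero, mul_one] at h0
    exact h0.mono_left nhdsWithin_le_nhds

/-- The contribution of `x_j` to the virial identity. -/
def virTerm (α : ℝ) (j : Fin d) (u : Sob d) : ℝ :=
  4 * ‖weakD (some j) u‖ ^ 2 - 2 * (α / (α + 2)) * pot α u

theorem norm_inner_wmul_weakD_le (j : Fin d) (m : ℝ →ᵇ ℝ) {f : L2 d} {u : Sob d} (hf : ‖f‖ ≤ ‖u‖) :
    |(⟪wmul j m f, weakD (some j) u⟫_ℂ).re| ≤ ‖m‖ * ‖u‖ ^ 2 := by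
  have h0 := norm_weakD_le (some j) u
  calc _ ≤ ‖⟪wmul j m f, weakD (some j) u⟫_ℂ‖ := Complex.abs_re_le_norm _
    _ ≤ ‖wmul j m f‖ * ‖weakD (some j) u‖ := norm_inner_le_norm _ _
    _ ≤ (‖m‖ * ‖u‖) * ‖u‖ := mul_le_mul ((norm_wmul_le _ _ _).trans (by gcongr)) h0
        (norm_nonneg _) (by positivity)
    _ = _ := by ring

theorem tendsto_force {α : ℝ} (h : IsIntercritical d α) (j : Fin d) (u : Sob d) :
    Tendsto (fun ρ => force α j (virWeight₂ ρ) (virWeight₃ ρ) u) (𝓝[>] 0) (𝓝 (virTerm α j u)) := by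
  have l1 := (tendsto_integral_virWeight₂ j (integrable_norm_sq (weakD (some j) u))).const_mul 2
  have l2 := (tendsto_integral_virWeight₂ j (integrable_pot h u)).const_mul (α / (α + 2))
  have l3 : Tendsto (fun ρ => (⟪wmul j (virWeight₃ ρ) (fnL u), weakD (some j) u⟫_ℂ).re) (𝓝[>] 0)
      (𝓝 0) := by
    refine squeeze_zero_norm (a := fun ρ => 2 * |ρ| * ‖u‖ ^ 2) (fun ρ => ?_) ?_
    · refine (norm_inner_wmul_weakD_le j _ (norm_fnL_le u)).trans ?_
      gcongr
      exact norm_virWeight₃_le ρ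
    · have : Continuous fun ρ : ℝ => 2 * |ρ| * ‖u‖ ^ 2 := by fun_prop
      have h0 := this.tendsto 0
      rw [abs_zero, mul_zero, zero_mul] at h0
      exact h0.mono_left nhdsWithin_le_nhds
  have l4 := (l1.add l3).sub l2
  have e : virTerm α j u = 2 * (2 * ∫ p, ‖weakD (some j) u p‖ ^ 2) + 0 -
      α / (α + 2) * (2 * ∫ p, ‖fnL u p‖ ^ (α + 2)) := by
    rw [virTerm, norm_sq_eq_integral, pot]
    ring
  rw [e]
  refine l4.congr fun ρ => ?_
  rw [force, re_inner_wmul_self, wpot]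

/-- The bound is uniform for ρ in [0, 1] and provides the dominating function for ρ → 0. -/
theorem abs_force_le {α : ℝ} (h : IsIntercritical d α) (j : Fin d) {ρ : ℝ} (hρ : 0 ≤ ρ) (hρ1 : ρ ≤ 1)
    (u : Sob d) : |force α j (virWeight₂ ρ) (virWeight₃ ρ) u| ≤
      6 * ‖u‖ ^ 2 + 2 * (α / (α + 2)) * pot α u := by
  have hα := h.pos
  have h1 := norm_inner_wmul_weakD_le j (virWeight₂ ρ) (norm_weakD_le (some j) u)
  have h2 := norm_inner_wmul_weakD_le j (virWeight₃ ρ) (norm_fnL_le u)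
  have h3 := abs_wpot_le h j (virWeight₂ ρ) u
  have hp : 0 ≤ pot α u := integral_nonneg fun p => by positivity
  have h1' : ‖virWeight₂ ρ‖ * ‖u‖ ^ 2 ≤ 2 * ‖u‖ ^ 2 := by
    gcongr
    exact norm_virWeight₂_le ρ
  have h2' : ‖virWeight₃ ρ‖ * ‖u‖ ^ 2 ≤ 2 * ‖u‖ ^ 2 := by
    gcongr
    refine (norm_virWeight₃_le ρ).trans ?_
    rw [abs_of_nonneg hρ]
    linarith
  have h3' : ‖virWeight₂ ρ‖ * pot α u ≤ 2 * pot α u := by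
    gcongr
    exact norm_virWeight₂_le ρ
  have h4 : |α / (α + 2) * wpot α j (virWeight₂ ρ) u| ≤ α / (α + 2) * (2 * pot α u) := by
    rw [abs_mul, abs_of_nonneg (by positivity : 0 ≤ α / (α + 2))]
    gcongr
    exact h3.trans h3'
  rw [abs_le] at h1 h2 h4
  rw [force, abs_le]
  constructor <;> linarith

/-- The semivirial on the Sobolev space. -/
def virS (α : ℝ) (u : Sob d) : ℝ :=
  ∑ j, ‖weakD (some j) u‖ ^ 2 - α * d / (2 * (α + 2)) * pot α u

/-- With the factor 2 relating the derivative of the weighted mass to the momentum, this is V'' =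
8Q. -/
theorem sum_virTerm {α : ℝ} (hα : 0 < α) (u : Sob d) : ∑ j, virTerm α j u = 4 * virS α u := by
  simp only [virTerm, virS]
  rw [Finset.sum_sub_distrib, ← Finset.mul_sum, Finset.sum_const, Finset.card_univ, Fintype.card_fin,
    nsmul_eq_mul]
  field_simp
  ring

section InitialData

variable {u : Sob d} (hx : MemLp (fun p : Guide d => (‖p.1‖ : ℂ) * fnL u p) 2 volume)
include hx

theorem re_inner_virWeight_le {ρ : ℝ} (hρ : ρ ≠ 0) (j : Fin d) :
    (⟪wmul j (virWeight ρ) (fnL u), fnL u⟫_ℂ).re ≤ ‖hx.toLp‖ ^ 2 := by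
  rw [re_inner_wmul_self, norm_sq_eq_integral]
  refine integral_mono_ae ((integrable_norm_sq _).bdd_mul (aestronglyMeasurable_weight j _)
    (ae_of_all _ fun p => (virWeight ρ).norm_coe_le_norm (p.1 j))) (integrable_norm_sq _) ?_
  filter_upwards [hx.coeFn_toLp] with p hp
  rw [hp, norm_mul, mul_pow, Complex.norm_real, norm_norm]
  gcongr
  refine (virWeight_le hρ _).trans ?_
  rw [← sq_abs]
  gcongr
  exact PiLp.norm_apply_le p.1 j

theorem abs_mom_virWeight₁_le {ρ : ℝ} (hρ : ρ ≠ 0) (j : Fin d) :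
    |mom j (virWeight₁ ρ) u| ≤ 2 * ‖hx.toLp‖ * ‖u‖ := by
  have h1 : ‖wmul j (virWeight₁ ρ) (fnL u)‖ ≤ 2 * ‖hx.toLp‖ := by
    refine Lp.norm_le_mul_norm_of_ae_le_mul ?_
    filter_upwards [hx.coeFn_toLp, coeFn_wmul j (virWeight₁ ρ) (fnL u)] with p hp hp2
    rw [hp, hp2, norm_mul, norm_mul, Complex.norm_real, Complex.norm_real, norm_norm, ← mul_assoc]
    gcongr
    refine (abs_virWeight₁_le hρ _).trans ?_
    gcongr
    exact PiLp.norm_apply_le p.1 j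
  calc _ ≤ ‖⟪wmul j (virWeight₁ ρ) (fnL u), weakD (some j) u⟫_ℂ‖ := Complex.abs_im_le_norm _
    _ ≤ ‖wmul j (virWeight₁ ρ) (fnL u)‖ * ‖weakD (some j) u‖ := norm_inner_le_norm _ _
    _ ≤ _ := mul_le_mul h1 (norm_weakD_le _ _) (norm_nonneg _) (by positivity)

end InitialData

namespace IsWeakSolution

variable {α : ℝ} {I : Set ℝ} {U : ℝ → Sob d}

theorem continuousOn_virTerm (S : IsWeakSolution α I U) (h : IsIntercritical d α) (j : Fin d) :
    ContinuousOn (fun t => virTerm α j (U t)) I := by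
  have : Continuous (virTerm α j : Sob d → ℝ) :=
    (continuous_const.mul ((weakD (some j)).continuous.norm.pow 2)).sub
      (continuous_const.mul (continuous_pot h))
  exact this.comp_continuousOn S.continuousOn

/-- Taylor's formula with integral remainder: for V' = 2M, the derivative of V(t) + 2(T - t)M(t)
retains only the force term. -/
theorem virial_identity (S : IsWeakSolution α I U) (h : IsIntercritical d α)
    (hs : HasSmoothing α I U) (j : Fin d) {ρ : ℝ} (hρ : ρ ≠ 0) (h0 : 0 ∈ I) {T : ℝ} (hT : T ∈ I) :
    (⟪wmul j (virWeight ρ) (fnL (U T)), fnL (U T)⟫_ℂ).re =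
      (⟪wmul j (virWeight ρ) (fnL (U 0)), fnL (U 0)⟫_ℂ).re + 2 * T * mom j (virWeight₁ ρ) (U 0) +
      ∫ t in (0 : ℝ)..T, 2 * (T - t) * force α j (virWeight₂ ρ) (virWeight₃ ρ) (U t) := by
  have hsub : uIcc 0 T ⊆ I := S.uIcc_subset h0 hT
  have hd : ∀ t ∈ uIcc 0 T, HasDerivAt (fun t => (⟪wmul j (virWeight ρ) (fnL (U t)), fnL (U t)⟫_ℂ).re +
      2 * (T - t) * mom j (virWeight₁ ρ) (U t))
      (2 * (T - t) * force α j (virWeight₂ ρ) (virWeight₃ ρ) (U t)) t := by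
    intro t ht
    have h1 := S.hasDerivAt_wmul h j (isPrimitive_virWeight hρ) (hsub ht)
    have h2 := S.hasDerivAt_mom h hs j (isPrimitive_virWeight₁ hρ) (isPrimitive_virWeight₂ ρ) (hsub ht)
    have h3 := (((hasDerivAt_id t).const_sub T).const_mul 2).mul h2
    refine (h1.add h3).congr_deriv ?_
    simp only [id]
    ring
  have hc : ContinuousOn (fun t => 2 * (T - t) * force α j (virWeight₂ ρ) (virWeight₃ ρ) (U t)) I :=
    (by fun_prop : Continuous fun t : ℝ => 2 * (T - t)).continuousOn.mul
      (S.continuousOn_force h j (isPrimitive_virWeight₂ ρ))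
  rw [intervalIntegral.integral_eq_sub_of_hasDerivAt hd (hc.mono hsub).intervalIntegrable]
  ring

/-- Finite variance is required at time 0 only. At time T the bounded weights are meaningful for any
L² function, and all that is kept of that term is its nonnegativity, which survives ρ → 0. -/
theorem virial_nonneg (S : IsWeakSolution α I U) (h : IsIntercritical d α)
    (hs : HasSmoothing α I U) (j : Fin d) (h0 : 0 ∈ I)
    (hx : MemLp (fun p : Guide d => (‖p.1‖ : ℂ) * fnL (U 0) p) 2 volume) {T : ℝ} (hT : T ∈ I) :
    0 ≤ ‖hx.toLp‖ ^ 2 + 4 * |T| * (‖hx.toLp‖ * ‖U 0‖) +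
      ∫ t in (0 : ℝ)..T, 2 * (T - t) * virTerm α j (U t) := by
  have hsub : uIcc 0 T ⊆ I := S.uIcc_subset h0 hT
  have hlin : Continuous fun t : ℝ => 2 * (T - t) := by fun_prop
  have l1 : Tendsto (fun ρ => ∫ t in (0 : ℝ)..T, 2 * (T - t) *
      force α j (virWeight₂ ρ) (virWeight₃ ρ) (U t)) (𝓝[>] 0)
      (𝓝 (∫ t in (0 : ℝ)..T, 2 * (T - t) * virTerm α j (U t))) := by
    have hB : ContinuousOn (fun t => |2 * (T - t)| * (6 * ‖U t‖ ^ 2 +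
        2 * (α / (α + 2)) * pot α (U t))) I :=
      hlin.abs.continuousOn.mul ((continuousOn_const.mul (S.continuousOn.norm.pow 2)).add
        (continuousOn_const.mul ((continuous_pot h).comp_continuousOn S.continuousOn)))
    refine intervalIntegral.tendsto_integral_filter_of_dominated_convergence _
      (Eventually.of_forall fun ρ => ?_) ?_ (hB.mono hsub).intervalIntegrable
      (ae_of_all _ fun t ht => (tendsto_force h j (U t)).const_mul _)
    · refine ContinuousOn.aestronglyMeasurable ?_ measurableSet_uIoc
      exact (hlin.continuousOn.mul (S.continuousOn_force h j (isPrimitive_virWeight₂ ρ))).mono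
        (uIoc_subset_uIcc.trans hsub)
    · filter_upwards [Ioo_mem_nhdsGT (zero_lt_one (α := ℝ))] with ρ hρ
      refine ae_of_all _ fun t ht => ?_
      rw [norm_mul]
      exact mul_le_mul_of_nonneg_left (abs_force_le h j hρ.1.le hρ.2.le (U t)) (abs_nonneg _)
  refine ge_of_tendsto (l1.const_add (‖hx.toLp‖ ^ 2 + 4 * |T| * (‖hx.toLp‖ * ‖U 0‖))) ?_
  filter_upwards [self_mem_nhdsWithin] with ρ hρ
  have hρ' : ρ ≠ 0 := ne_of_gt hρ
  have e := S.virial_identity h hs j hρ' h0 hT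
  have h1 : 0 ≤ (⟪wmul j (virWeight ρ) (fnL (U T)), fnL (U T)⟫_ℂ).re := by
    rw [re_inner_wmul_self]
    exact integral_nonneg fun p => mul_nonneg (virWeight_nonneg _ _) (by positivity)
  have h2 := re_inner_virWeight_le hx hρ' j
  have h3 : 2 * T * mom j (virWeight₁ ρ) (U 0) ≤ 4 * |T| * (‖hx.toLp‖ * ‖U 0‖) := by
    refine (le_abs_self _).trans ?_
    rw [abs_mul, abs_mul, abs_two]
    calc 2 * |T| * |mom j (virWeight₁ ρ) (U 0)| ≤ 2 * |T| * (2 * ‖hx.toLp‖ * ‖U 0‖) := by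
          gcongr
          exact abs_mom_virWeight₁_le hx hρ' j
      _ = _ := by ring
  rw [e] at h1
  linarith

/-- The virial argument: a solution of finite variance with semivirial bounded away from zero from
above has a bounded lifespan. -/
theorem exists_abs_le (S : IsWeakSolution α I U) (h : IsIntercritical d α)
    (hs : HasSmoothing α I U) (h0 : 0 ∈ I)
    (hx : MemLp (fun p : Guide d => (‖p.1‖ : ℂ) * fnL (U 0) p) 2 volume) {η : ℝ} (hη : 0 < η)
    (hQ : ∀ t ∈ I, virS α (U t) ≤ -η) : ∃ K, ∀ T ∈ I, |T| ≤ K := by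
  obtain ⟨A, hA⟩ : ∃ A, A = d * ‖hx.toLp‖ ^ 2 := ⟨_, rfl⟩
  obtain ⟨B, hB⟩ : ∃ B, B = d * (4 * (‖hx.toLp‖ * ‖U 0‖)) := ⟨_, rfl⟩
  have hA0 : 0 ≤ A := by rw [hA]; positivity
  have hB0 : 0 ≤ B := by rw [hB]; positivity
  have main : ∀ T ∈ I, 4 * η * |T| ^ 2 ≤ A + B * |T| := by
    intro T hT
    have hsub : uIcc 0 T ⊆ I := S.uIcc_subset h0 hT
    have hlin : Continuous fun t : ℝ => 2 * (T - t) := by fun_prop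
    have hii : ∀ j, IntervalIntegrable (fun t => 2 * (T - t) * virTerm α j (U t)) volume 0 T :=
      fun j => ((hlin.continuousOn.mul (S.continuousOn_virTerm h j)).mono hsub).intervalIntegrable
    have h1 := Finset.sum_nonneg fun j (_ : j ∈ Finset.univ) => S.virial_nonneg h hs j h0 hx hT
    rw [Finset.sum_add_distrib, Finset.sum_const, Finset.card_univ, Fintype.card_fin, nsmul_eq_mul,
      ← intervalIntegral.integral_finsetSum fun j _ => hii j] at h1
    have hi : ∀ t ∈ uIcc 0 T, ∑ j, 2 * (T - t) * virTerm α j (U t) =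
        8 * (T - t) * (virS α (U t) + η) - 8 * η * (T - t) := by
      intro t _
      rw [← Finset.mul_sum, sum_virTerm h.pos]
      ring
    have hv : ContinuousOn (fun t => 8 * (T - t) * (virS α (U t) + η)) I := by
      have hc : ContinuousOn (fun t => virS α (U t)) I := by
        have := continuousOn_finsetSum (Finset.univ : Finset (Fin d))
          fun j _ => S.continuousOn_virTerm h j
        simp only [sum_virTerm h.pos] at this
        refine (this.const_mul (1 / 4)).congr fun t _ => ?_
        ring
      exact (by fun_prop : Continuous fun t : ℝ => 8 * (T - t)).continuousOn.mul
        (hc.add continuousOn_const)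
    rw [intervalIntegral.integral_congr hi, intervalIntegral.integral_sub
      (hv.mono hsub).intervalIntegrable
      ((by fun_prop : Continuous fun t : ℝ => 8 * η * (T - t)).intervalIntegrable _ _)] at h1
    have e1 : ∫ t in (0 : ℝ)..T, 8 * η * (T - t) = 4 * η * |T| ^ 2 := by
      rw [intervalIntegral.integral_const_mul, intervalIntegral.integral_sub
        intervalIntegrable_const intervalIntegral.intervalIntegrable_id,
        intervalIntegral.integral_const, integral_id, sq_abs, smul_eq_mul]
      ring
    -- For T < 0 both T - t and the orientation of the integral change sign, so the contribution is
    -- nonpositive in either direction.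
    have e2 : ∫ t in (0 : ℝ)..T, 8 * (T - t) * (virS α (U t) + η) ≤ 0 := by
      rcases le_total 0 T with hT0 | hT0
      · rw [← neg_nonneg, ← intervalIntegral.integral_neg]
        refine intervalIntegral.integral_nonneg hT0 fun t ht => neg_nonneg.2 ?_
        have := hQ t (hsub (by rwa [uIcc_of_le hT0]))
        exact mul_nonpos_of_nonneg_of_nonpos (by linarith [ht.2]) (by linarith)
      · rw [intervalIntegral.integral_symm, neg_nonpos]
        refine intervalIntegral.integral_nonneg hT0 fun t ht => ?_
        have := hQ t (hsub (by rwa [uIcc_of_ge hT0]))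
        exact mul_nonneg_of_nonpos_of_nonpos (by linarith [ht.1]) (by linarith)
    have e3 : (d : ℝ) * (‖hx.toLp‖ ^ 2 + 4 * |T| * (‖hx.toLp‖ * ‖U 0‖)) = A + B * |T| := by
      rw [hA, hB]
      ring
    rw [e1, e3] at h1
    linarith
  -- For |T| ≥ 1 one has A + B|T| ≤ (A + B)|T|, so 4η|T|² ≤ (A + B)|T|; the summand 1 covers |T| ≤
  -- 1.
  refine ⟨1 + (A + B) / (4 * η), fun T hT => ?_⟩
  have h1 := main T hT
  have h2 : 0 ≤ (A + B) / (4 * η) := by positivity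
  rcases le_total |T| 1 with h3 | h3
  · linarith
  · have h4 : |T| ≤ (A + B) / (4 * η) := by
      rw [le_div_iff₀ (by positivity)]
      by_contra! hlt
      nlinarith
    linarith

end IsWeakSolution

/-! ### Dilations in x and the reduction to zero semivirial. -/

/-- The dilation `(x, y) ↦ (r x, y)`. -/
def dilate {r : ℝ} (hr : 0 < r) : Guide d ≃ₜ Guide d :=
  (Homeomorph.smulOfNeZero r hr.ne').prodCongr (Homeomorph.refl _)

theorem dilate_apply {r : ℝ} (hr : 0 < r) (p : Guide d) : dilate hr p = (r • p.1, p.2) := rfl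

theorem dilate_inv_dilate {r : ℝ} (hr : 0 < r) (p : Guide d) :
    dilate (inv_pos.2 hr) (dilate hr p) = p := by
  rw [dilate_apply, dilate_apply, inv_smul_smul₀ hr.ne']

theorem map_dilate {r : ℝ} (hr : 0 < r) : Measure.map (dilate hr) (volume : Measure (Guide d)) =
    ENNReal.ofReal (r ^ d)⁻¹ • volume := by
  have h1 := Measure.map_prod_map (volume : Measure (Space d)) (volume : Measure Torus)
    (f := fun x => r • x) (g := id) (measurable_const_smul r) measurable_id
  rw [Measure.map_addHaar_smul _ hr.ne', Measure.map_id, finrank_euclideanSpace, Fintype.card_fin,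
    abs_of_pos (by positivity), Measure.prod_smul_left] at h1
  exact h1.symm

theorem integral_dilate {E : Type*} [NormedAddCommGroup E] [NormedSpace ℝ E] {r : ℝ} (hr : 0 < r)
    (F : Guide d → E) : ∫ p, F (dilate hr p) = (r ^ d)⁻¹ • ∫ p, F p := by
  rw [← (dilate hr).measurableEmbedding.integral_map, map_dilate, integral_smul_measure,
    ENNReal.toReal_ofReal (by positivity)]

theorem memLp_dilate {r : ℝ} (hr : 0 < r) (f : L2 d) :
    MemLp (fun p => ((r ^ ((d : ℝ) / 2) : ℝ) : ℂ) * f (dilate hr p)) 2 volume := by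
  have h : MemLp f 2 (Measure.map (dilate hr) volume) := by
    rw [map_dilate]
    exact (Lp.memLp f).smul_measure ENNReal.ofReal_ne_top
  exact ((dilate hr).measurableEmbedding.memLp_map_measure_iff.1 h).const_mul _

/-- The mass preserving dilation on `L²`. -/
def dilL2 {r : ℝ} (hr : 0 < r) (f : L2 d) : L2 d := (memLp_dilate hr f).toLp

theorem coeFn_dilL2 {r : ℝ} (hr : 0 < r) (f : L2 d) : dilL2 hr f =ᵐ[volume] fun p =>
    ((r ^ ((d : ℝ) / 2) : ℝ) : ℂ) * f (dilate hr p) := MemLp.coeFn_toLp _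

theorem norm_sq_dilL2 {r : ℝ} (hr : 0 < r) (f : L2 d) : ‖dilL2 hr f‖ ^ 2 = ‖f‖ ^ 2 := by
  rw [norm_sq_eq_integral, norm_sq_eq_integral]
  have h1 : ∫ p, ‖dilL2 hr f p‖ ^ 2 = ∫ p, r ^ d * ‖f (dilate hr p)‖ ^ 2 := by
    refine integral_congr_ae ?_
    filter_upwards [coeFn_dilL2 hr f] with p hp
    rw [hp, norm_mul, mul_pow, Complex.norm_real, Real.norm_of_nonneg (by positivity),
      ← Real.rpow_natCast, ← Real.rpow_mul hr.le, Nat.cast_ofNat,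
      div_mul_cancel₀ _ two_ne_zero, Real.rpow_natCast]
  rw [h1, integral_const_mul, integral_dilate hr (fun p => ‖f p‖ ^ 2), smul_eq_mul, ← mul_assoc,
    mul_inv_cancel₀ (by positivity), one_mul]

/-- The factor that a derivative gains under dilation. -/
def dilFactor (r : ℝ) (i : Option (Fin d)) : ℝ := i.elim 1 fun _ => r

theorem dilate_add_shift {r : ℝ} (hr : 0 < r) (i : Option (Fin d)) (p : Guide d) (s : ℝ) :
    dilate hr (p + shift i s) = dilate hr p + shift i (dilFactor r i * s) := by
  rcases i with _ | j
  · simp [dilate_apply, shift, cover, basisDir, dilFactor]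
  · simp [dilate_apply, shift, cover, basisDir, dilFactor, mul_smul]

theorem pderiv_dilate {r : ℝ} (hr : 0 < r) (i : Option (Fin d)) (φ : Guide d → ℂ) (p : Guide d) :
    pderiv i (fun p => φ (dilate hr p)) p = (dilFactor r i : ℂ) * pderiv i φ (dilate hr p) := by
  simp only [pderiv, dilate_add_shift]
  have := deriv_comp_mul_left (dilFactor r i) (fun s => φ (dilate hr p + shift i s)) 0
  rw [mul_zero] at this
  rw [this]
  exact RCLike.real_smul_eq_coe_mul _ _

theorem IsTestFunction.dilate {φ : Guide d → ℂ} (h : IsTestFunction φ) {r : ℝ} (hr : 0 < r) :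
    IsTestFunction fun p => φ (dilate hr p) where
  smooth := h.smooth.comp (f := fun p : Space d × ℝ => (r • p.1, p.2)) (by fun_prop)
  compact := h.compact.comp_homeomorph (Waveguide.dilate hr)

theorem isWeakDeriv_dilL2 {i : Option (Fin d)} {f g : L2 d} (h : IsWeakDeriv i f g) {r : ℝ}
    (hr : 0 < r) : IsWeakDeriv i (dilL2 hr f) ((dilFactor r i : ℂ) • dilL2 hr g) := by
  intro φ hφ
  have hr' := inv_pos.2 hr
  obtain ⟨c, hc⟩ : ∃ c : ℂ, c = ((r ^ ((d : ℝ) / 2) : ℝ) : ℂ) := ⟨_, rfl⟩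
  have key : ∀ (f : L2 d) (ψ : Guide d → ℂ), ∫ p, dilL2 hr f p * ψ p =
      c * ((r ^ d)⁻¹ • ∫ p, f p * ψ (dilate hr' p)) := by
    intro f ψ
    rw [← integral_dilate hr, ← integral_const_mul]
    refine integral_congr_ae ?_
    filter_upwards [coeFn_dilL2 hr f] with p hp
    rw [hp, dilate_inv_dilate, hc, mul_assoc]
  have hk : (dilFactor r i : ℂ) * (dilFactor r⁻¹ i : ℂ) = 1 := by
    have : r ≠ 0 := hr.ne'
    rcases i with _ | j
    · simp [dilFactor]
    · simp [dilFactor, this]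
  have h1 := h _ (hφ.dilate hr')
  simp only [pderiv_dilate] at h1
  have e1 : ∫ p, f p * pderiv i φ (dilate hr' p) =
      (dilFactor r i : ℂ) * ∫ p, f p * ((dilFactor r⁻¹ i : ℂ) * pderiv i φ (dilate hr' p)) := by
    rw [← integral_const_mul]
    congr 1
    funext p
    linear_combination (-(f p * pderiv i φ (dilate hr' p))) * hk
  have e2 : ∫ p, ((dilFactor r i : ℂ) • dilL2 hr g) p * φ p =
      (dilFactor r i : ℂ) * ∫ p, dilL2 hr g p * φ p := by
    rw [← integral_const_mul]
    refine integral_congr_ae ?_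
    filter_upwards [Lp.coeFn_smul (dilFactor r i : ℂ) (dilL2 hr g)] with p hp
    rw [hp, Pi.smul_apply, smul_eq_mul, mul_assoc]
  rw [e2, key, key, e1, h1, Complex.real_smul, Complex.real_smul]
  ring

/-- The mass preserving dilation on the Sobolev space. -/
def dilSob {r : ℝ} (hr : 0 < r) (u : Sob d) : Sob d :=
  ⟨(dilL2 hr (fnL u), fun i => (dilFactor r i : ℂ) • dilL2 hr (weakD i u)),
    fun i => isWeakDeriv_dilL2 (isWeakDeriv_weakD i u) hr⟩

section Dilation

variable {r : ℝ} (hr : 0 < r) (u : Sob d)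

theorem norm_fnL_dilSob : ‖fnL (dilSob hr u)‖ ^ 2 = ‖fnL u‖ ^ 2 := norm_sq_dilL2 hr _

theorem norm_weakD_dilSob (i : Option (Fin d)) :
    ‖weakD i (dilSob hr u)‖ ^ 2 = dilFactor r i ^ 2 * ‖weakD i u‖ ^ 2 := by
  change ‖(dilFactor r i : ℂ) • dilL2 hr (weakD i u)‖ ^ 2 = _
  rw [norm_smul, mul_pow, norm_sq_dilL2, Complex.norm_real, Real.norm_eq_abs, sq_abs]

/-- The amplitude contributes r^{(α+2)d/2} and the change of variables r^{-d}. -/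
theorem pot_dilSob (α : ℝ) : pot α (dilSob hr u) = r ^ (α * d / 2) * pot α u := by
  have h1 : pot α (dilSob hr u) = ∫ p, r ^ ((d : ℝ) / 2 * (α + 2)) * ‖fnL u (dilate hr p)‖ ^ (α + 2) := by
    refine integral_congr_ae ?_
    filter_upwards [coeFn_dilL2 hr (fnL u)] with p hp
    change ‖dilL2 hr (fnL u) p‖ ^ (α + 2) = _
    rw [hp, norm_mul, Complex.norm_real, Real.norm_of_nonneg (by positivity),
      Real.mul_rpow (by positivity) (norm_nonneg _), ← Real.rpow_mul hr.le]
  rw [h1, integral_const_mul, integral_dilate hr (fun p => ‖fnL u p‖ ^ (α + 2)), smul_eq_mul,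
    ← mul_assoc, pot, ← Real.rpow_natCast, ← Real.rpow_neg hr.le, ← Real.rpow_add hr]
  congr 2
  ring

end Dilation

/-- `‖∇ₓ u‖₂²` on the Sobolev space. -/
def gradXS (u : Sob d) : ℝ := ∑ j, ‖weakD (some j) u‖ ^ 2

theorem gradXS_dilSob {r : ℝ} (hr : 0 < r) (u : Sob d) :
    gradXS (dilSob hr u) = r ^ 2 * gradXS u := by
  simp only [gradXS, norm_weakD_dilSob, dilFactor, Option.elim, Finset.mul_sum]

theorem energyS_eq_gradXS (α : ℝ) (u : Sob d) :
    energyS α u = 1 / 2 * (gradXS u + ‖weakD none u‖ ^ 2) - pot α u / (α + 2) := by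
  rw [energyS, gradSq, Fintype.sum_option, gradXS]
  ring

theorem virS_eq_gradXS (α : ℝ) (u : Sob d) :
    virS α u = gradXS u - α * d / 2 * (pot α u / (α + 2)) := by
  rw [virS, gradXS, div_mul_div_comm, div_mul_eq_mul_div]

theorem gradXS_nonneg (u : Sob d) : 0 ≤ gradXS u := Finset.sum_nonneg fun _ _ => by positivity

theorem pot_nonneg (α : ℝ) (u : Sob d) : 0 ≤ pot α u := integral_nonneg fun p => by positivity

/-- If ∇ₓu vanished, dilations would keep the H¹ norm fixed while multiplying the potential by
r^{αd/2}; letting r → ∞ contradicts the Sobolev bound. This makes the dilation parameter below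
positive. -/
theorem gradXS_pos {α : ℝ} (h : IsIntercritical d α) {u : Sob d} (hu : 0 < pot α u) :
    0 < gradXS u := by
  by_contra! hle
  have h0 : gradXS u = 0 := le_antisymm hle (gradXS_nonneg u)
  have hα := h.pos
  have hκ : 0 < α * d / 2 := by linarith [h.four_lt]
  obtain ⟨C, hC, hb⟩ := exists_integral_trilinear h
  have hj : ∀ j, ‖weakD (some j) u‖ ^ 2 = 0 := fun j =>
    (Finset.sum_eq_zero_iff_of_nonneg fun _ _ => by positivity).1 h0 j (Finset.mem_univ j)
  have hnorm : ∀ {r : ℝ} (hr : 0 < r), ‖dilSob hr u‖ = ‖u‖ := by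
    intro r hr
    refine norm_eq_of_sob ?_ fun i => ?_
    · exact (sq_eq_sq₀ (norm_nonneg _) (norm_nonneg _)).1 (norm_fnL_dilSob hr u)
    · refine (sq_eq_sq₀ (norm_nonneg _) (norm_nonneg _)).1 ?_
      rw [norm_weakD_dilSob]
      rcases i with _ | j
      · simp [dilFactor]
      · rw [hj, mul_zero]
  have hbound : ∀ r : ℝ, 0 < r → r ^ (α * d / 2) * pot α u ≤ C * (‖u‖ * ‖u‖ ^ α * ‖u‖) := by
    intro r hr
    have := hb (dilSob hr u) (dilSob hr u) (dilSob hr u)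
    simp only [hnorm hr, ← norm_rpow_add_two hα] at this
    rw [← pot_dilSob hr u]
    exact this
  have hlim : Tendsto (fun r : ℝ => r ^ (α * d / 2) * pot α u) atTop atTop :=
    (tendsto_rpow_atTop hκ).atTop_mul_const hu
  obtain ⟨r, h1, h2⟩ := ((hlim.eventually_gt_atTop (C * (‖u‖ * ‖u‖ ^ α * ‖u‖))).and
    (eventually_gt_atTop 0)).exists
  exact absurd (hbound r h2) (not_le.2 h1)

/-- A function of negative semivirial can be dilated to one of zero semivirial, of the same mass
and with control of the energy. -/
theorem exists_virS_eq_zero {α : ℝ} (h : IsIntercritical d α) {u : Sob d} (hu : virS α u < 0) :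
    ∃ v : Sob d, ‖fnL v‖ ^ 2 = ‖fnL u‖ ^ 2 ∧ virS α v = 0 ∧ energyS α v ≤ energyS α u - virS α u := by
  have hα := h.pos
  obtain ⟨κ, hκ⟩ : ∃ κ, κ = α * d / 2 := ⟨_, rfl⟩
  have hκ2 : 2 < κ := by linarith [h.four_lt]
  obtain ⟨G, hG⟩ : ∃ G, G = pot α u / (α + 2) := ⟨_, rfl⟩
  obtain ⟨K, hK⟩ : ∃ K, K = gradXS u := ⟨_, rfl⟩
  rw [virS_eq_gradXS, ← hκ, ← hG, ← hK] at hu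
  have hK0 : 0 ≤ K := hK ▸ gradXS_nonneg u
  have hG0 : 0 < G := by
    by_contra! hle
    nlinarith
  have hpot : 0 < pot α u := by
    rw [hG] at hG0
    exact (div_pos_iff_of_pos_right (by linarith)).1 hG0
  have hKpos : 0 < K := hK ▸ gradXS_pos h hpot
  -- The dilate has semivirial r²K - κ r^κ G, which vanishes when r^{κ-2} = K/(κG) = x; the
  -- hypothesis K - κG < 0 says x < 1.
  obtain ⟨x, hx⟩ : ∃ x, x = K / (κ * G) := ⟨_, rfl⟩
  have hx0 : 0 < x := hx ▸ by positivity
  have hx1 : x < 1 := by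
    rw [hx, div_lt_one (by positivity)]
    linarith
  obtain ⟨r, hr⟩ : ∃ r, r = x ^ (1 / (κ - 2)) := ⟨_, rfl⟩
  have hr0 : 0 < r := hr ▸ Real.rpow_pos_of_pos hx0 _
  have hκ' : 0 < κ - 2 := by linarith
  have hr1 : r ≤ 1 := hr ▸ Real.rpow_le_one hx0.le hx1.le (by positivity)
  have hrκ : r ^ κ = r ^ 2 * x := by
    have e : κ = 2 + (κ - 2) := by ring
    rw [e, Real.rpow_add hr0, Real.rpow_two, hr, ← Real.rpow_mul hx0.le, one_div_mul_cancel hκ'.ne',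
      Real.rpow_one]
  have hGx : κ * (G * x) = K := by
    rw [hx]
    field_simp
  refine ⟨dilSob hr0 u, norm_fnL_dilSob hr0 u, ?_, ?_⟩
  · rw [virS_eq_gradXS, gradXS_dilSob, pot_dilSob hr0 u, ← hκ, hrκ, mul_div_assoc, ← hG, ← hK]
    linear_combination (-r ^ 2) * hGx
  -- Apart from the ∂_y term, which dilation leaves unchanged, the dilate has energy r²K(1/2 - 1/κ)
  -- ≤ K/2 - K/κ because κ > 2. By K < κG this is at most (κ - 1)G - K/2, which is the corresponding
  -- part of E(u) - Q(u).
  · rw [energyS_eq_gradXS, energyS_eq_gradXS, virS_eq_gradXS, gradXS_dilSob, pot_dilSob hr0 u,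
      ← hκ, hrκ, mul_div_assoc, ← hG, ← hK, norm_weakD_dilSob]
    have e1 : dilFactor r (none : Option (Fin d)) = 1 := rfl
    rw [e1, one_pow, one_mul]
    have e2 : r ^ 2 * x * G = r ^ 2 * (K / κ) := by
      rw [← hGx]
      field_simp
    rw [e2]
    have e3 : r ^ 2 ≤ 1 := pow_le_one₀ hr0.le hr1
    have e4 : 0 ≤ K * (1 / 2 - 1 / κ) := by
      have : 1 / κ ≤ 1 / 2 := one_div_le_one_div_of_le two_pos hκ2.le
      exact mul_nonneg hK0 (by linarith)
    have e5 : r ^ 2 * (K * (1 / 2 - 1 / κ)) ≤ 1 * (K * (1 / 2 - 1 / κ)) := by gcongr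
    have e6 : K / κ ≤ G := by
      rw [div_le_iff₀ (by linarith)]
      linarith
    have e7 : (κ - 1) * (K / κ) ≤ (κ - 1) * G := by
      have : 0 ≤ κ - 1 := by linarith
      gcongr
    have e8 : (κ - 1) * (K / κ) = K - K / κ := by field_simp
    have e9 : K * (1 / 2 - 1 / κ) = K / 2 - K / κ := by ring
    rw [e9] at e5
    nlinarith

/-! ### The ground state level and trapping. -/

/-- An element of `Sob d` as an element of `H1 d`. -/
def toH1 (u : Sob d) : H1 d :=
  ⟨(fnL u, fun j => weakD (some j) u, weakD none u), fun j φ hφ => by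
    rw [derivX_eq_pderiv]
    exact isWeakDeriv_weakD (some j) u φ hφ, fun φ hφ => by
    rw [derivY_eq_pderiv]
    exact isWeakDeriv_weakD none u φ hφ⟩

theorem toSob_toH1 (u : Sob d) : (toH1 u).toSob = u := by
  refine Subtype.ext (Prod.ext rfl (funext fun i => ?_))
  rcases i with _ | j <;> rfl

theorem H1.mass_eq (u : H1 d) : u.mass = ‖fnL u.toSob‖ ^ 2 := rfl

theorem H1.semivirial_eq (α : ℝ) (u : H1 d) : u.semivirial α = virS α u.toSob := rfl

theorem H1.energy_eq (α : ℝ) (u : H1 d) : u.energy α = energyS α u.toSob := by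
  rw [energyS_eq_gradXS, H1.energy]
  change 1 / 2 * (u.gradXSq + ‖u.dy‖ ^ 2) - 1 / (α + 2) * u.potential α =
    1 / 2 * (u.gradXSq + ‖u.dy‖ ^ 2) - u.potential α / (α + 2)
  ring

theorem groundLevel_le {α : ℝ} (h : IsIntercritical d α) {u : Sob d} (hu : virS α u < 0) :
    groundLevel d α (‖fnL u‖ ^ 2) ≤ energyS α u - virS α u := by
  obtain ⟨v, h1, h2, h3⟩ := exists_virS_eq_zero h hu
  -- The set of energies is bounded below by 0: where Q = 0 the energy equals ½‖∂_y w‖² + (αd/4 - 1)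
  -- pot(w)/(α + 2), and αd > 4.
  refine le_trans (csInf_le ⟨0, ?_⟩ ⟨toH1 v, ?_, ?_, rfl⟩) (le_of_eq_of_le ?_ h3)
  · rintro _ ⟨w, -, hw, rfl⟩
    rw [H1.semivirial_eq, virS_eq_gradXS] at hw
    rw [H1.energy_eq, energyS_eq_gradXS]
    have hκ : 2 < α * d / 2 := by linarith [h.four_lt]
    have hG : 0 ≤ pot α w.toSob / (α + 2) := div_nonneg (pot_nonneg _ _) (by linarith [h.pos])
    nlinarith [sq_nonneg ‖weakD none w.toSob‖]
  · rw [H1.mass_eq, toSob_toH1, h1]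
  · rw [H1.semivirial_eq, toSob_toH1, h2]
  · rw [H1.energy_eq, toSob_toH1]

theorem continuous_virS {α : ℝ} (h : IsIntercritical d α) : Continuous (virS α : Sob d → ℝ) :=
  (continuous_finsetSum _ fun j _ => (weakD (some j)).continuous.norm.pow 2).sub
    (continuous_const.mul (continuous_pot h))

/-- Below the ground state level, the semivirial stays negative, uniformly in time. -/
theorem IsWeakSolution.virS_le {α : ℝ} {I : Set ℝ} {U : ℝ → Sob d} (S : IsWeakSolution α I U)
    (h : IsIntercritical d α) (hs : ∀ β, IsIntercritical d β → HasSmoothing β I U) (h0 : 0 ∈ I)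
    (hE : energyS α (U 0) < groundLevel d α (‖fnL (U 0)‖ ^ 2)) (hQ : virS α (U 0) < 0) :
    ∀ t ∈ I, virS α (U t) ≤ -(groundLevel d α (‖fnL (U 0)‖ ^ 2) - energyS α (U 0)) := by
  have key : ∀ t ∈ I, virS α (U t) < 0 →
      virS α (U t) ≤ -(groundLevel d α (‖fnL (U 0)‖ ^ 2) - energyS α (U 0)) := by
    intro t ht hneg
    have h1 := groundLevel_le h hneg
    rw [S.norm_fnL_eq h ht h0, S.energyS_eq h hs ht h0] at h1
    linarith
  intro t ht
  refine key t ht ?_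
  -- Otherwise the intermediate value theorem gives a time at which Q equals half of -(m_c - E):
  -- negative, yet above -(m_c - E), which `key` forbids.
  by_contra! hle
  obtain ⟨s, hsI, hs'⟩ := S.ordConnected.isPreconnected.intermediate_value h0 ht
    ((continuous_virS h).comp_continuousOn S.continuousOn)
    (⟨by have := key 0 h0 hQ; simp only [Function.comp_apply]; linarith,
      by simp only [Function.comp_apply]; linarith⟩ :
      -(groundLevel d α (‖fnL (U 0)‖ ^ 2) - energyS α (U 0)) / 2 ∈ Icc _ _)
  simp only [Function.comp_apply] at hs'
  have := key s hsI (by linarith)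
  linarith

end Waveguide

end

theorem theorem1p4 (d : ℕ) (hd : 1 ≤ d) (α : ℝ) (hα : 4 / (d : ℝ) < α)
    (hα' : 2 ≤ d → α < 4 / ((d : ℝ) - 1))
    (I : Set ℝ) (u : ℝ → Waveguide.H1 d) (hu : Waveguide.IsMaximalSolution α I u)
    (hx : MemLp (fun p : Waveguide.Guide d => (‖p.1‖ : ℂ) * (u 0).fn p) 2 volume)
    (hE : (u 0).energy α < Waveguide.groundLevel d α (u 0).mass)
    (hQ : (u 0).semivirial α < 0) :
    BddAbove I ∧ BddBelow I := by
  have h : Waveguide.IsIntercritical d α := ⟨hd, hα, hα'⟩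
  have S := hu.1.isWeakSolution
  have hs := fun β (hβ : Waveguide.IsIntercritical d β) => hu.1.hasSmoothing hβ
  rw [Waveguide.H1.energy_eq, Waveguide.H1.mass_eq] at hE
  rw [Waveguide.H1.semivirial_eq] at hQ
  -- The gap η is the ground state level minus the energy, positive by hypothesis.
  obtain ⟨K, hK⟩ := S.exists_abs_le h (hs α h) hu.1.zero_mem hx (sub_pos.2 hE)
    (S.virS_le h hs hu.1.zero_mem hE hQ)
  exact ⟨⟨K, fun T hT => (abs_le.1 (hK T hT)).2⟩, ⟨-K, fun T hT => (abs_le.1 (hK T hT)).1⟩⟩
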